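/- Let $p\in(0,1/2]$ and $\lambda$ be fixed. For $d>0$ let $a,b,c$ (depending on $d$) satisfy, for all large $d$, $$pa+(1-p)b=pb+(1-p)c=1,\qquad d(1-b)^2=\lambda .$$ For $n$ large, let $(X,G)$ be the two-community stochastic block model on the vertices $\{1,\dots,n\}$: the labels $X_i\in\{1,2\}$ are independent with $\mathbb P(X_i=1)=p$ and, given the labels, each pair $\{i,j\}$ is independently an edge of $G$ with probability $M_{X_i,X_j}$, where $M=\frac dn\begin{pmatrix}a&b\\ b&c\end{pmatrix}$. For an estimator $T(G)\in\{1,2\}^n$ define the rescaled average success probability $$P_{succ}(T)=\frac1n\sum_{i=1}^n\Big(\mathbb P(T_i(G)=1\mid X_i=1)+\mathbb P(T_i(G)=2\mid X_i=2)-1\Big),$$ and let $T^{opt}$ be the optimal test: $T^{opt}_i(G)=1$ if $\log\frac{\mathbb P(X_i=1\mid G)}{\mathbb P(X_i=2\mid G)}\ge\log\frac p{1-p}$, and $T^{opt}_i(G)=2$ otherwise. For $\ell\ge 0$ and $\mu\ge 0$ put $$G_\ell(\mu)=\frac{\ell}{(1-p)^2}\,\mathbb E\Big[\frac1{p+(1-p)\exp(\sqrt\mu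 Z-\mu/2)}-1\Big],\qquad Z\sim\mathcal N(0,1),$$ and let $\lambda_{sp}(p)=\sup\{\ell\ge0 : 0\text{ is the unique fixed point of }G_\ell\text{ on }[0,\infty)\}$ be the spinodal curve. If $\lambda<\lambda_{sp}(p)$, then $$\lim_{d\to\infty}\ \lim_{n\to\infty}P_{succ}(T^{opt})=0,$$ that is, for all sufficiently large $d$ the limit of $P_{succ}(T^{opt})$ as $n\to\infty$ exists, and this limit tends to $0$ as $d\to\infty$. -/

import Mathlib

open Filter Topology MeasureTheory ProbabilityTheory

noncomputable section

namespace SBM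

/- The two communities are indexed by `Fin 2`: the index `0` is community 1 (of probability `p`)
and the index `1` is community 2 (of probability `1 - p`). -/

/-- The law of one label: `P(X_i = 1) = p`, `P(X_i = 2) = 1 - p`. -/
def labelProb (p : ℝ) : Fin 2 → ℝ := ![p, 1 - p]

open Classical in
/-- The joint probability of the labelling `x` and the graph `G` in the stochastic block model with
parameters `(M, n, p)`: independent labels and, given the labels, independent edges, the pair
`i < j` being an edge with probability `M (x i) (x j)`. -/
def weight {n : ℕ} (M : Matrix (Fin 2) (Fin 2) ℝ) (p : ℝ)
    (x : Fin n → Fin 2) (G : SimpleGraph (Fin n)) : ℝ :=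
  (∏ i, labelProb p (x i)) *
    ∏ i, ∏ j ∈ Finset.Ioi i, if G.Adj i j then M (x i) (x j) else 1 - M (x i) (x j)

open Classical in
/-- The probability of an event `E`, a property of the pair (labelling, graph). -/
def prob {n : ℕ} (M : Matrix (Fin 2) (Fin 2) ℝ) (p : ℝ)
    (E : (Fin n → Fin 2) → SimpleGraph (Fin n) → Prop) : ℝ :=
  ∑ x : Fin n → Fin 2, ∑ G : SimpleGraph (Fin n), if E x G then weight M p x G else 0

/-- The conditional probability `P(A | B)`. -/
def condProb {n : ℕ} (M : Matrix (Fin 2) (Fin 2) ℝ) (p : ℝ)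
    (A B : (Fin n → Fin 2) → SimpleGraph (Fin n) → Prop) : ℝ :=
  prob M p (fun x G => A x G ∧ B x G) / prob M p B

/-- The probabilities of the model are nonnegative when `p` and the entries of `M` are in
`[0, 1]`. -/
theorem weight_nonneg {n : ℕ} {M : Matrix (Fin 2) (Fin 2) ℝ} {p : ℝ}
    (hp0 : 0 ≤ p) (hp1 : p ≤ 1) (hM0 : ∀ k l, 0 ≤ M k l) (hM1 : ∀ k l, M k l ≤ 1)
    (x : Fin n → Fin 2) (G : SimpleGraph (Fin n)) : 0 ≤ weight M p x G := by
  unfold weight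
  refine mul_nonneg (Finset.prod_nonneg fun i _ => ?_)
    (Finset.prod_nonneg fun i _ => Finset.prod_nonneg fun j _ => ?_)
  · generalize x i = k
    fin_cases k <;> simp [labelProb] <;> linarith
  · split_ifs
    · exact hM0 _ _
    · linarith [hM1 (x i) (x j)]

open Classical in
theorem sum_graph {n : ℕ} (f g : Fin n → Fin n → ℝ) :
    ∑ G : SimpleGraph (Fin n), ∏ i, ∏ j ∈ Finset.Ioi i, (if G.Adj i j then f i j else g i j)
      = ∏ i, ∏ j ∈ Finset.Ioi i, (f i j + g i j) := by
  have key : ∀ h : Fin n → Fin n → ℝ, ∏ i, ∏ j ∈ Finset.Ioi i, h i j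
      = ∏ e ∈ (Finset.univ : Finset (Fin n × Fin n)).filter (fun e => e.1 < e.2), h e.1 e.2 := by
    intro h
    rw [Finset.prod_filter, ← Finset.univ_product_univ, Finset.prod_product]
    refine Finset.prod_congr rfl fun i _ => ?_
    rw [← Finset.prod_filter]
    refine Finset.prod_congr ?_ fun _ _ => rfl
    ext j; simp
  simp only [key]
  rw [Finset.prod_add]
  refine Finset.sum_bij'
    (fun G _ => (Finset.univ : Finset (Fin n × Fin n)).filter
      (fun e => e.1 < e.2 ∧ G.Adj e.1 e.2))
    (fun t _ => SimpleGraph.fromRel (fun i j => i < j ∧ (i, j) ∈ t)) ?_ ?_ ?_ ?_ ?_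
  · intro G _
    simp only [Finset.mem_powerset]
    intro e he
    simp only [Finset.mem_filter, Finset.mem_univ, true_and] at he ⊢
    exact he.1
  · intro t _; exact Finset.mem_univ _
  · intro G _
    ext i j
    simp only [SimpleGraph.fromRel_adj, Finset.mem_filter, Finset.mem_univ, true_and]
    constructor
    · rintro ⟨_, h | h⟩
      · exact h.2.2
      · exact h.2.2.symm
    · intro h
      refine ⟨h.ne, ?_⟩
      rcases lt_or_gt_of_ne h.ne with h1 | h1
      · exact Or.inl ⟨h1, h1, h⟩
      · exact Or.inr ⟨h1, h1, h.symm⟩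
  · intro t ht
    simp only [Finset.mem_powerset] at ht
    ext ⟨i, j⟩
    simp only [SimpleGraph.fromRel_adj, Finset.mem_filter, Finset.mem_univ, true_and]
    constructor
    · rintro ⟨h1, _, h | h⟩
      · exact h.2
      · exact absurd h.1 (not_lt.2 h1.le)
    · intro h
      have h1 : i < j := by simpa using ht h
      exact ⟨h1, h1.ne, Or.inl ⟨h1, h⟩⟩
  · intro G _
    rw [Finset.prod_ite, Finset.filter_filter]
    congr 1
    refine Finset.prod_congr ?_ fun _ _ => rfl
    ext e
    simp only [Finset.mem_filter, Finset.mem_univ, true_and, Finset.mem_sdiff]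
    tauto

/-- The probabilities of the model sum to one. -/
theorem sum_weight {n : ℕ} (M : Matrix (Fin 2) (Fin 2) ℝ) (p : ℝ) :
    ∑ x : Fin n → Fin 2, ∑ G : SimpleGraph (Fin n), weight M p x G = 1 := by
  classical
  have h1 : ∀ x : Fin n → Fin 2,
      ∑ G : SimpleGraph (Fin n), weight M p x G = ∏ i, labelProb p (x i) := by
    intro x
    unfold weight
    rw [← Finset.mul_sum]
    have := sum_graph (fun i j => M (x i) (x j)) (fun i j => 1 - M (x i) (x j))
    simp only [add_sub_cancel, Finset.prod_const_one] at this
    refine (congrArg _ ?_).trans (mul_one _)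
    convert this
  simp only [h1]
  rw [← Fintype.prod_sum (fun (_ : Fin n) k => labelProb p k)]
  simp [labelProb]

/-- The rescaled average success probability of an estimator `T`, where `T i G` is the label
given to the vertex `i` when the graph is `G`:
`(1/n) ∑ i, (P(T_i(G) = 1 | X_i = 1) + P(T_i(G) = 2 | X_i = 2) - 1)`. -/
def successProb {n : ℕ} (M : Matrix (Fin 2) (Fin 2) ℝ) (p : ℝ)
    (T : Fin n → SimpleGraph (Fin n) → Fin 2) : ℝ :=
  (1 / (n : ℝ)) * ∑ i : Fin n,
    (condProb M p (fun _ G => T i G = 0) (fun x _ => x i = 0)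
      + condProb M p (fun _ G => T i G = 1) (fun x _ => x i = 1) - 1)

/-- The posterior probability `P(X_i = k | G)`. -/
def posterior {n : ℕ} (M : Matrix (Fin 2) (Fin 2) ℝ) (p : ℝ) (i : Fin n) (k : Fin 2)
    (G : SimpleGraph (Fin n)) : ℝ :=
  condProb M p (fun x _ => x i = k) (fun _ H => H = G)

open Classical in
/-- The optimal test: label 1 if `log (P(X_i = 1 | G) / P(X_i = 2 | G)) ≥ log (p / (1 - p))`, and
label 2 otherwise. The quotient and the logarithm take extended values, so that the log-ratio is
`+∞` when `P(X_i = 2 | G) = 0`. -/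
def optTest {n : ℕ} (M : Matrix (Fin 2) (Fin 2) ℝ) (p : ℝ) (i : Fin n)
    (G : SimpleGraph (Fin n)) : Fin 2 :=
  if ENNReal.log (ENNReal.ofReal p / ENNReal.ofReal (1 - p)) ≤
      ENNReal.log (ENNReal.ofReal (posterior M p i 0 G) / ENNReal.ofReal (posterior M p i 1 G))
  then 0 else 1

/-- The sparse connectivity matrix `(d / n) (a b; b c)`. Its entries are in `[0, 1]` as soon as
`a, b, c, d ≥ 0` and `n ≥ d * max a b c`. -/
def connectivity (a b c d : ℝ) (n : ℕ) : Matrix (Fin 2) (Fin 2) ℝ :=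
  (d / (n : ℝ)) • !![a, b; b, c]

/-- The optimal rescaled success probability in the sparse model on `n` vertices. -/
def optSuccess (p a b c d : ℝ) (n : ℕ) : ℝ :=
  successProb (connectivity a b c d n) p (optTest (n := n) (connectivity a b c d n) p)

/-- The map
`G(μ) = lam / (1 - p)² * E[1 / (p + (1 - p) exp (√μ Z - μ / 2)) - 1]`, with `Z` standard
Gaussian. -/
def gFun (lam p μ : ℝ) : ℝ :=
  lam / (1 - p) ^ 2 *
    ∫ z, (1 / (p + (1 - p) * Real.exp (Real.sqrt μ * z - μ / 2)) - 1) ∂(gaussianReal 0 1)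

/-- The spinodal curve: the supremum of the `lam ≥ 0` for which `0` is the unique fixed point of
`G` on `[0, ∞)`. -/
def spinodal (p : ℝ) : ℝ :=
  sSup {lam : ℝ | 0 ≤ lam ∧ ∀ μ : ℝ, 0 ≤ μ → (gFun lam p μ = μ ↔ μ = 0)}

end SBM

end

/-! Let φ be the label function with mean 0 and variance 1 under the prior. The energy of a vertex
is the second moment of the posterior mean of φ(X_i). By Cauchy-Schwarz its square root controls the
rescaled success of any estimator (`abs_successProb_le`), so it suffices that, for each fixed large
d, the energy tends to 0 as n → ∞. The inner limit is then exactly 0 for all large d.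

The energy satisfies an approximate self-consistent inequality. The balance equations make the
connectivity matrix θ(1 + ε φφᵀ) with θ = d/n and ε = 1 - b, so that d ε² = λ. Split off one vertex,
the root, of a graph on n + 1 vertices. Its neighbourhood is a noisy observation of its label
through the labels of the others. After a bounded number of labels has been revealed (pinning,
`exists_pinning`), a bounded set of other labels is nearly independent given the observation,
because further revelations barely raise the energy. In the likelihood of the neighbourhood each
label may then be replaced by its posterior mean m_j (`sum_abs_condMean_subsetLik_sub_le`). Given
the observation, the root thus sees independent Bernoulli channels of strengths ε m_j.

A Lindeberg exchange replaces these channels one at a time by Gaussian ones (`edge_step_le`,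
`sum_bern_potential_le`). Gaussian variances add, so what remains is one Gaussian channel of
variance V ≈ θ ε² ∑ m_j², whose energy is `gaussOp p V 1 1`. Up to scaling this is the map G of the
statement. Below the spinodal curve some λ' > λ still has 0 as its only fixed point, and since G is
continuous and bounded it lies below the diagonal: `gaussOp p V 1 1` ≤ V / λ' for every V
(`exists_gaussOp_le`). This bound is linear in V, so it can be averaged directly and no
concentration of ∑ m_j² is needed.

By exchangeability the average of ∑ m_j² is at most n times the energy Q of the root after pinning,
up to the pinned vertices. Hence Q ≤ (λ/λ' + C|ε|λ + o(1)) Q plus errors that can be made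
arbitrarily small (`exists_pinned_energy_le`). The term C|ε|λ is the part of the exchange error that
survives n → ∞. It is small once d is large, so the coefficient drops below 1 and Q → 0
(`tendsto_vertexEnergy_zero`). -/

namespace SBM

open scoped NNReal

/-! ### Conditional means and their second moments on a finite weighted space. -/

section FiniteConditioning

variable {Ω Ω' β γ : Type*} [Fintype Ω] [Fintype Ω']

open Classical in
/-- The conditional mean of `f` given the statistic `Y`, on a finite space with weights `w`. -/
noncomputable def condMean (w : Ω → ℝ) (Y : Ω → β) (f : Ω → ℝ) (ω : Ω) : ℝ :=
  (∑ ω', if Y ω' = Y ω then w ω' * f ω' else 0) / ∑ ω', if Y ω' = Y ω then w ω' else 0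

/-- The second moment of the conditional mean. -/
noncomputable def energy (w : Ω → ℝ) (Y : Ω → β) (f : Ω → ℝ) : ℝ :=
  ∑ ω, w ω * condMean w Y f ω ^ 2

theorem condMean_congr (w : Ω → ℝ) (Y : Ω → β) (f : Ω → ℝ) {ω ω' : Ω} (h : Y ω = Y ω') :
    condMean w Y f ω = condMean w Y f ω' := by
  unfold condMean
  congr! 4

open Classical in
theorem fiber_pos {w : Ω → ℝ} (hw : ∀ ω, 0 < w ω) (Y : Ω → β) (ω : Ω) :
    0 < ∑ ω', if Y ω' = Y ω then w ω' else 0 :=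
  Finset.sum_pos' (fun ω' _ => by split_ifs; exacts [(hw _).le, le_rfl])
    ⟨ω, Finset.mem_univ _, by simpa using hw ω⟩

theorem condMean_eq_of_rel {w : Ω → ℝ} {Y : Ω → β} {Y' : Ω → γ}
    (h : ∀ ω ω', Y ω = Y ω' ↔ Y' ω = Y' ω') (f : Ω → ℝ) : condMean w Y f = condMean w Y' f := by
  ext ω
  unfold condMean
  congr! 4 <;> exact h _ _

/-- Exchanging the sums over pairs in a common fibre of `Y` leaves, for each ω', the total mass of
its fibre over itself. Positive weights keep that mass nonzero. -/
theorem sum_mul_condMean {w : Ω → ℝ} (hw : ∀ ω, 0 < w ω) (Y : Ω → β) (f g : Ω → ℝ)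
    (hg : ∀ ω ω', Y ω = Y ω' → g ω = g ω') :
    ∑ ω, w ω * (g ω * condMean w Y f ω) = ∑ ω, w ω * (g ω * f ω) := by
  classical
  have h1 : ∀ ω, w ω * (g ω * condMean w Y f ω) =
      ∑ ω', if Y ω' = Y ω then
        (w ω' * f ω') * g ω' * (w ω / ∑ ω'', if Y ω'' = Y ω' then w ω'' else 0) else 0 := by
    intro ω
    rw [condMean, ← mul_assoc, ← mul_div_assoc, Finset.mul_sum, Finset.sum_div]
    refine Finset.sum_congr rfl fun ω' _ => ?_
    split_ifs with h
    · rw [hg _ _ h]; simp only [h]; ring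
    · simp
  simp only [h1]
  rw [Finset.sum_comm]
  refine Finset.sum_congr rfl fun ω' _ => ?_
  have h2 : ∀ ω, (if Y ω' = Y ω then
      (w ω' * f ω') * g ω' * (w ω / ∑ ω'', if Y ω'' = Y ω' then w ω'' else 0) else 0)
      = (w ω' * f ω') * g ω' / (∑ ω'', if Y ω'' = Y ω' then w ω'' else 0) *
        (if Y ω = Y ω' then w ω else 0) := by
    intro ω
    by_cases h : Y ω' = Y ω
    · rw [if_pos h, if_pos h.symm]; ring
    · rw [if_neg h, if_neg (Ne.symm h), mul_zero]
  simp only [h2]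
  rw [← Finset.mul_sum, div_mul_cancel₀ _ (fiber_pos hw Y ω').ne']
  ring

theorem condMean_add (w : Ω → ℝ) (Y : Ω → β) (f g : Ω → ℝ) (ω : Ω) :
    condMean w Y (fun ω => f ω + g ω) ω = condMean w Y f ω + condMean w Y g ω := by
  classical
  rw [condMean, condMean, condMean, ← add_div, ← Finset.sum_add_distrib]
  congr 1
  refine Finset.sum_congr rfl fun _ _ => ?_
  split_ifs <;> ring

theorem condMean_mul_left (w : Ω → ℝ) (Y : Ω → β) (f : Ω → ℝ) (g : Ω → ℝ)
    (hg : ∀ ω ω', Y ω = Y ω' → g ω = g ω') (ω : Ω) :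
    condMean w Y (fun ω => g ω * f ω) ω = g ω * condMean w Y f ω := by
  classical
  rw [condMean, condMean, ← mul_div_assoc, Finset.mul_sum]
  congr 1
  refine Finset.sum_congr rfl fun ω' _ => ?_
  split_ifs with h
  · rw [hg _ _ h]; ring
  · simp

theorem condMean_const_mul (w : Ω → ℝ) (Y : Ω → β) (f : Ω → ℝ) (c : ℝ) (ω : Ω) :
    condMean w Y (fun ω => c * f ω) ω = c * condMean w Y f ω :=
  condMean_mul_left w Y f (fun _ => c) (fun _ _ _ => rfl) ω

theorem condMean_sub (w : Ω → ℝ) (Y : Ω → β) (f g : Ω → ℝ) (ω : Ω) :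
    condMean w Y (fun ω => f ω - g ω) ω = condMean w Y f ω - condMean w Y g ω := by
  have h := condMean_add w Y f (fun ω => (-1) * g ω) ω
  rw [condMean_const_mul] at h
  simpa [sub_eq_add_neg] using h

theorem condMean_sum {ι : Type*} (w : Ω → ℝ) (Y : Ω → β) (s : Finset ι) (f : ι → Ω → ℝ) (ω : Ω) :
    condMean w Y (fun ω => ∑ i ∈ s, f i ω) ω = ∑ i ∈ s, condMean w Y (f i) ω := by
  classical
  induction s using Finset.induction_on with
  | empty => simp [condMean]
  | insert a s ha ih =>
    simp only [Finset.sum_insert ha]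
    rw [condMean_add, ih]

theorem condMean_mono {w : Ω → ℝ} (hw : ∀ ω, 0 < w ω) (Y : Ω → β) {f g : Ω → ℝ}
    (h : ∀ ω, f ω ≤ g ω) (ω : Ω) : condMean w Y f ω ≤ condMean w Y g ω := by
  classical
  refine div_le_div_of_nonneg_right (Finset.sum_le_sum fun ω' _ => ?_) (fiber_pos hw Y ω).le
  split_ifs
  · exact mul_le_mul_of_nonneg_left (h _) (hw _).le
  · exact le_rfl

theorem condMean_of_measurable {w : Ω → ℝ} (hw : ∀ ω, 0 < w ω) (Y : Ω → β) (g : Ω → ℝ)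
    (hg : ∀ ω ω', Y ω = Y ω' → g ω = g ω') (ω : Ω) : condMean w Y g ω = g ω := by
  classical
  have h := condMean_mul_left w Y (fun _ => 1) g hg ω
  simp only [mul_one] at h
  rw [h, condMean]
  simp only [mul_one]
  rw [div_self (fiber_pos hw Y ω).ne', mul_one]

theorem condMean_pos {w : Ω → ℝ} (hw : ∀ ω, 0 < w ω) (Y : Ω → β) {f : Ω → ℝ}
    (h : ∀ ω, 0 < f ω) (ω : Ω) : 0 < condMean w Y f ω := by
  classical
  refine div_pos (Finset.sum_pos' (fun ω' _ => ?_) ⟨ω, Finset.mem_univ _, ?_⟩) (fiber_pos hw Y ω)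
  · split_ifs
    · exact (mul_pos (hw _) (h _)).le
    · exact le_rfl
  · simpa using mul_pos (hw ω) (h ω)

theorem abs_condMean_le {w : Ω → ℝ} (hw : ∀ ω, 0 < w ω) (Y : Ω → β) (f : Ω → ℝ) (ω : Ω) :
    |condMean w Y f ω| ≤ condMean w Y (fun ω => |f ω|) ω := by
  rw [abs_le]
  constructor
  · have := condMean_mono hw Y (f := fun ω => (-1) * |f ω|) (g := f)
      (fun ω => by linarith [neg_abs_le (f ω)]) ω
    rw [condMean_const_mul] at this
    linarith
  · exact condMean_mono hw Y (fun ω => le_abs_self _) ω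

theorem abs_condMean_le_of_bound {w : Ω → ℝ} (hw : ∀ ω, 0 < w ω) (Y : Ω → β) {f : Ω → ℝ} {C : ℝ}
    (h : ∀ ω, |f ω| ≤ C) (ω : Ω) : |condMean w Y f ω| ≤ C := by
  refine (abs_condMean_le hw Y f ω).trans ((condMean_mono hw Y h ω).trans ?_)
  rw [condMean_of_measurable hw Y (fun _ => C) (fun _ _ _ => rfl)]

theorem sum_condMean {w : Ω → ℝ} (hw : ∀ ω, 0 < w ω) (Y : Ω → β) (f : Ω → ℝ) :
    ∑ ω, w ω * condMean w Y f ω = ∑ ω, w ω * f ω := by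
  simpa using sum_mul_condMean hw Y f (fun _ => 1) (fun _ _ _ => rfl)

theorem sum_abs_condMean_le {w : Ω → ℝ} (hw : ∀ ω, 0 < w ω) (Y : Ω → β) (f : Ω → ℝ) :
    ∑ ω, w ω * |condMean w Y f ω| ≤ ∑ ω, w ω * |f ω| := by
  rw [← sum_condMean hw Y (fun ω => |f ω|)]
  exact Finset.sum_le_sum fun ω _ => mul_le_mul_of_nonneg_left (abs_condMean_le hw Y f ω) (hw ω).le

/-- The tower property: the indicator of a fibre of the coarser `Y` is an admissible test function
in `sum_mul_condMean` for the finer `Y'`. -/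
theorem condMean_condMean {w : Ω → ℝ} (hw : ∀ ω, 0 < w ω) (Y : Ω → β) (Y' : Ω → γ)
    (h : ∀ ω ω', Y' ω = Y' ω' → Y ω = Y ω') (f : Ω → ℝ) (ω : Ω) :
    condMean w Y (condMean w Y' f) ω = condMean w Y f ω := by
  classical
  have := sum_mul_condMean hw Y' f (fun ω' => if Y ω' = Y ω then 1 else 0)
    (fun a b hab => by rw [h a b hab])
  simp only [ite_mul, one_mul, zero_mul, mul_ite, mul_zero] at this
  rw [condMean, this, condMean]

/-- Pythagoras for nested projections. It turns a small gain of energy into a small L² change of the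
posterior mean, which is how pinning is exploited. -/
theorem sum_sq_condMean_sub {w : Ω → ℝ} (hw : ∀ ω, 0 < w ω) (Y : Ω → β) (Y' : Ω → γ)
    (h : ∀ ω ω', Y' ω = Y' ω' → Y ω = Y ω') (f : Ω → ℝ) :
    ∑ ω, w ω * (condMean w Y' f ω - condMean w Y f ω) ^ 2 = energy w Y' f - energy w Y f := by
  have h1 : ∑ ω, w ω * (condMean w Y f ω * condMean w Y' f ω)
      = ∑ ω, w ω * (condMean w Y f ω * condMean w Y f ω) := by
    rw [← sum_mul_condMean hw Y (condMean w Y' f) _ (fun a b => condMean_congr w Y f)]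
    simp only [condMean_condMean hw Y Y' h]
  have h2 : ∀ ω, w ω * (condMean w Y' f ω - condMean w Y f ω) ^ 2
      = w ω * condMean w Y' f ω ^ 2 + w ω * (condMean w Y f ω * condMean w Y f ω)
        - 2 * (w ω * (condMean w Y f ω * condMean w Y' f ω)) := fun ω => by ring
  simp only [h2, energy, Finset.sum_sub_distrib, Finset.sum_add_distrib, ← Finset.mul_sum, h1]
  simp only [sq]
  ring

theorem energy_mono {w : Ω → ℝ} (hw : ∀ ω, 0 < w ω) (Y : Ω → β) (Y' : Ω → γ)
    (h : ∀ ω ω', Y' ω = Y' ω' → Y ω = Y ω') (f : Ω → ℝ) : energy w Y f ≤ energy w Y' f := by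
  have := sum_sq_condMean_sub hw Y Y' h f
  have h2 : 0 ≤ ∑ ω, w ω * (condMean w Y' f ω - condMean w Y f ω) ^ 2 :=
    Finset.sum_nonneg fun ω _ => mul_nonneg (hw ω).le (sq_nonneg _)
  linarith

theorem energy_le_of_bound {w : Ω → ℝ} (hw : ∀ ω, 0 < w ω) (hw1 : ∑ ω, w ω = 1) (Y : Ω → β)
    {f : Ω → ℝ} {C : ℝ} (h : ∀ ω, |f ω| ≤ C) : energy w Y f ≤ C ^ 2 := by
  calc energy w Y f ≤ ∑ ω, w ω * C ^ 2 := Finset.sum_le_sum fun ω _ =>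
        mul_le_mul_of_nonneg_left (sq_le_sq' (neg_le_of_abs_le (abs_condMean_le_of_bound hw Y h ω))
          (le_of_abs_le (abs_condMean_le_of_bound hw Y h ω))) (hw ω).le
    _ = C ^ 2 := by rw [← Finset.sum_mul, hw1, one_mul]

theorem condMean_comp_equiv (e : Ω' ≃ Ω) (w : Ω → ℝ) (Y : Ω → β) (f : Ω → ℝ) (ω : Ω') :
    condMean (fun ω => w (e ω)) (fun ω => Y (e ω)) (fun ω => f (e ω)) ω
      = condMean w Y f (e ω) := by
  classical
  rw [condMean, condMean]
  congr 1
  · exact e.sum_comp (fun ω' => if Y ω' = Y (e ω) then w ω' * f ω' else 0)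
  · exact e.sum_comp (fun ω' => if Y ω' = Y (e ω) then w ω' else 0)

theorem energy_comp_equiv (e : Ω' ≃ Ω) (w : Ω → ℝ) (Y : Ω → β) (f : Ω → ℝ) :
    energy (fun ω => w (e ω)) (fun ω => Y (e ω)) (fun ω => f (e ω)) = energy w Y f := by
  simp only [energy, condMean_comp_equiv]
  exact e.sum_comp (fun ω => w ω * condMean w Y f ω ^ 2)

theorem energy_eq_of_rel {w : Ω → ℝ} {Y : Ω → β} {Y' : Ω → γ}
    (h : ∀ ω ω', Y ω = Y ω' ↔ Y' ω = Y' ω') (f : Ω → ℝ) : energy w Y f = energy w Y' f := by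
  simp only [energy, condMean_eq_of_rel h]

/-- Cauchy-Schwarz for a finite probability. -/
theorem sum_abs_le_sqrt {w : Ω → ℝ} (hw : ∀ ω, 0 < w ω) (hw1 : ∑ ω, w ω = 1) (f : Ω → ℝ) :
    ∑ ω, w ω * |f ω| ≤ √(∑ ω, w ω * f ω ^ 2) := by
  refine Real.le_sqrt_of_sq_le ?_
  have := Finset.sum_mul_sq_le_sq_mul_sq Finset.univ (fun ω => √(w ω)) (fun ω => √(w ω) * |f ω|)
  simp only [← mul_assoc, Real.mul_self_sqrt (hw _).le, mul_pow, Real.sq_sqrt (hw _).le, hw1,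
    one_mul, sq_abs] at this
  exact this

/-- Forgetting an auxiliary coordinate does not change the energy. -/
theorem energy_fst {A : Type*} [Fintype A] (w : Ω → ℝ) (u : A → Ω → ℝ) (hu : ∀ ω, ∑ a, u a ω = 1)
    (Y : Ω → β) (f : Ω → ℝ) :
    energy (fun z : A × Ω => w z.2 * u z.1 z.2) (fun z => Y z.2) (fun z => f z.2)
      = energy w Y f := by
  classical
  have h : ∀ z : A × Ω, condMean (fun z : A × Ω => w z.2 * u z.1 z.2) (fun z => Y z.2)
      (fun z => f z.2) z = condMean w Y f z.2 := by
    intro z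
    rw [condMean, condMean, Fintype.sum_prod_type_right, Fintype.sum_prod_type_right]
    congr 1
    · refine Finset.sum_congr rfl fun ω _ => ?_
      by_cases h : Y ω = Y z.2
      · simp only [h, if_true]
        rw [← Finset.sum_mul, ← Finset.mul_sum, hu, mul_one]
      · simp [h]
    · refine Finset.sum_congr rfl fun ω _ => ?_
      by_cases h : Y ω = Y z.2
      · simp only [h, if_true]
        rw [← Finset.mul_sum, hu, mul_one]
      · simp [h]
  rw [energy, energy, Fintype.sum_prod_type_right]
  refine Finset.sum_congr rfl fun ω _ => ?_
  simp only [h]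
  rw [← Finset.sum_mul, ← Finset.mul_sum, hu, mul_one]

/-- The energy of a root label `k` with prior `π`, seen through a channel `u` that depends on a
hidden state `ω`, when a statistic of `ω` and the output of the channel are observed. -/
theorem energy_channel {K S : Type*} [Fintype K] [Fintype S] (w : Ω → ℝ) (hw : ∀ ω, 0 < w ω)
    (π : K → ℝ) (u : K → S → Ω → ℝ) (Y : Ω → β) (φ : K → ℝ) :
    energy (fun z : (K × S) × Ω => w z.2 * (π z.1.1 * u z.1.1 z.1.2 z.2))
      (fun z => (Y z.2, z.1.2)) (fun z => φ z.1.1)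
      = ∑ ω, w ω * ∑ s, (∑ k, π k * φ k * condMean w Y (u k s) ω) ^ 2 /
          ∑ k, π k * condMean w Y (u k s) ω := by
  classical
  set W : Ω → ℝ := fun ω => ∑ ω', if Y ω' = Y ω then w ω' else 0 with hW
  have hWpos : ∀ ω, 0 < W ω := fun ω => fiber_pos hw Y ω
  have hN : ∀ (g : K → ℝ) (z : (K × S) × Ω), (∑ z' : (K × S) × Ω,
      if (Y z'.2, z'.1.2) = (Y z.2, z.1.2) then
        w z'.2 * (π z'.1.1 * u z'.1.1 z'.1.2 z'.2) * g z'.1.1 else 0)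
      = W z.2 * ∑ k, π k * g k * condMean w Y (u k z.1.2) z.2 := by
    intro g z
    rw [Fintype.sum_prod_type, Fintype.sum_prod_type, Finset.mul_sum]
    refine Finset.sum_congr rfl fun k _ => ?_
    rw [Finset.sum_eq_single z.1.2]
    · simp only [Prod.mk.injEq, and_true]
      rw [condMean, mul_left_comm, mul_div_cancel₀ _ (hWpos z.2).ne', Finset.mul_sum]
      refine Finset.sum_congr rfl fun ω' _ => ?_
      split_ifs <;> ring
    · intro s _ hs
      simp [hs]
    · simp
  have hc : ∀ z : (K × S) × Ω, condMean (fun z : (K × S) × Ω => w z.2 * (π z.1.1 * u z.1.1 z.1.2 z.2))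
      (fun z => (Y z.2, z.1.2)) (fun z => φ z.1.1) z
      = (∑ k, π k * φ k * condMean w Y (u k z.1.2) z.2) /
        ∑ k, π k * condMean w Y (u k z.1.2) z.2 := by
    intro z
    have h1 := hN φ z
    have h2 := hN (fun _ => 1) z
    simp only [mul_one] at h2
    rw [← mul_div_mul_left _ _ (hWpos z.2).ne', ← h1, ← h2, condMean]
    congr!
  rw [energy, Fintype.sum_prod_type_right]
  have h3 : ∀ ω : Ω, ∑ x : K × S, w ω * (π x.1 * u x.1 x.2 ω) *
      condMean (fun z : (K × S) × Ω => w z.2 * (π z.1.1 * u z.1.1 z.1.2 z.2))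
      (fun z => (Y z.2, z.1.2)) (fun z => φ z.1.1) (x, ω) ^ 2 =
      ∑ s, ∑ k, π k * (w ω * ((((∑ k, π k * φ k * condMean w Y (u k s) ω) /
        ∑ k, π k * condMean w Y (u k s) ω)) ^ 2 * u k s ω)) := by
    intro ω
    rw [Fintype.sum_prod_type_right]
    refine Finset.sum_congr rfl fun s _ => Finset.sum_congr rfl fun k _ => ?_
    rw [hc]; ring
  simp only [h3]
  simp only [Finset.mul_sum]
  rw [Finset.sum_comm, Finset.sum_comm (s := Finset.univ (α := Ω))]
  refine Finset.sum_congr rfl fun s _ => ?_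
  rw [Finset.sum_comm]
  have h4 : ∀ k, ∑ ω, π k * (w ω * ((((∑ k, π k * φ k * condMean w Y (u k s) ω) /
        ∑ k, π k * condMean w Y (u k s) ω)) ^ 2 * u k s ω)) =
      ∑ ω, π k * (w ω * ((((∑ k, π k * φ k * condMean w Y (u k s) ω) /
        ∑ k, π k * condMean w Y (u k s) ω)) ^ 2 * condMean w Y (u k s) ω)) := by
    intro k
    rw [← Finset.mul_sum, ← Finset.mul_sum, sum_mul_condMean hw Y (u k s)]
    intro a b hab
    simp only [condMean_congr w Y _ hab]
  simp only [h4]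
  rw [Finset.sum_comm]
  refine Finset.sum_congr rfl fun ω _ => ?_
  set D := ∑ k, π k * condMean w Y (u k s) ω with hD
  set Nn := ∑ k, π k * φ k * condMean w Y (u k s) ω
  have : ∀ k, π k * (w ω * ((Nn / D) ^ 2 * condMean w Y (u k s) ω))
      = (w ω * (Nn / D) ^ 2) * (π k * condMean w Y (u k s) ω) := fun k => by ring
  simp only [this]
  rw [← Finset.mul_sum, ← hD]
  by_cases h0 : D = 0
  · simp [h0]
  · field_simp

end FiniteConditioning

/-! ### Standardized labels and the rank-one form of the connectivity matrix. -/

/-- The standardized label function: mean zero and variance one under `labelProb p`. -/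
noncomputable def phi (p : ℝ) : Fin 2 → ℝ := ![√((1 - p) / p), -√(p / (1 - p))]

/-- The connectivity matrix `θ (1 + ε φ φᵀ)`. -/
noncomputable def rankOne (p θ ε : ℝ) : Matrix (Fin 2) (Fin 2) ℝ :=
  Matrix.of fun k l => θ * (1 + ε * phi p k * phi p l)

/-- The probability of the pair (labelling, graph). -/
noncomputable def modelWeight {n : ℕ} (M : Matrix (Fin 2) (Fin 2) ℝ) (p : ℝ)
    (ω : (Fin n → Fin 2) × SimpleGraph (Fin n)) : ℝ := weight M p ω.1 ω.2

/-- The graph together with the labels of the vertices in `R`. -/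
def obs {n : ℕ} (R : Finset (Fin n)) (ω : (Fin n → Fin 2) × SimpleGraph (Fin n)) :
    SimpleGraph (Fin n) × (R → Fin 2) := (ω.2, fun i => ω.1 i)

/-- The energy of the label of the vertex `i` when the graph and the labels in `R` are known. -/
noncomputable def vertexEnergy {n : ℕ} (M : Matrix (Fin 2) (Fin 2) ℝ) (p : ℝ) (i : Fin n)
    (R : Finset (Fin n)) : ℝ :=
  energy (modelWeight M p) (obs R) (fun ω => phi p (ω.1 i))

theorem obs_eq_iff {n : ℕ} (R : Finset (Fin n)) (ω ω' : (Fin n → Fin 2) × SimpleGraph (Fin n)) :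
    obs R ω = obs R ω' ↔ ω.2 = ω'.2 ∧ ∀ i ∈ R, ω.1 i = ω'.1 i := by
  simp [obs, funext_iff]

section Phi

variable {p : ℝ}

theorem phi_zero_mul_phi_zero (hp0 : 0 < p) (hp1 : p < 1) : phi p 0 * phi p 0 = (1 - p) / p := by
  simp only [phi, Matrix.cons_val_zero]
  exact Real.mul_self_sqrt (div_nonneg (by linarith) hp0.le)

theorem phi_one_mul_phi_one (hp0 : 0 < p) (hp1 : p < 1) : phi p 1 * phi p 1 = p / (1 - p) := by
  simp only [phi, Matrix.cons_val_one, Matrix.cons_val_fin_one, neg_mul_neg]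
  exact Real.mul_self_sqrt (div_nonneg hp0.le (by linarith))

theorem phi_zero_mul_phi_one (hp0 : 0 < p) (hp1 : p < 1) : phi p 0 * phi p 1 = -1 := by
  simp only [phi, Matrix.cons_val_one, Matrix.cons_val_fin_one, Matrix.cons_val_zero, mul_neg]
  rw [← Real.sqrt_mul (div_nonneg (by linarith) hp0.le)]
  have : (1 - p) / p * (p / (1 - p)) = 1 := by
    have : 1 - p ≠ 0 := by linarith
    field_simp
  rw [this, Real.sqrt_one]

theorem abs_phi_mul_phi_le (hp0 : 0 < p) (hp1 : p ≤ 1 / 2) (k l : Fin 2) :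
    |phi p k * phi p l| ≤ 1 / p := by
  have h1 : p < 1 := by linarith
  have hp : 1 ≤ 1 / p := by rw [le_div_iff₀ hp0]; linarith
  have h00 := phi_zero_mul_phi_zero hp0 h1
  have h11 := phi_one_mul_phi_one hp0 h1
  have h01 := phi_zero_mul_phi_one hp0 h1
  have h10 : phi p 1 * phi p 0 = -1 := by rw [mul_comm, h01]
  fin_cases k <;> fin_cases l <;> simp only [Fin.zero_eta, Fin.mk_one, Fin.isValue, h00, h01, h10, h11]
  · rw [abs_of_nonneg (div_nonneg (by linarith) hp0.le)]
    exact div_le_div_of_nonneg_right (by linarith) hp0.le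
  · simpa using hp
  · simpa using hp
  · rw [abs_of_nonneg (div_nonneg hp0.le (by linarith))]
    refine le_trans ?_ hp
    rw [div_le_one (by linarith)]
    linarith

theorem abs_phi_le (hp0 : 0 < p) (hp1 : p ≤ 1 / 2) (k : Fin 2) : |phi p k| ≤ 1 / p := by
  have h := abs_phi_mul_phi_le hp0 hp1 k k
  have hp : 1 ≤ 1 / p := by rw [le_div_iff₀ hp0]; linarith
  rw [abs_mul] at h
  by_contra! h2
  nlinarith [abs_nonneg (phi p k)]

theorem labelProb_pos (hp0 : 0 < p) (hp1 : p < 1) (k : Fin 2) : 0 < labelProb p k := by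
  fin_cases k <;> simp [labelProb] <;> linarith

theorem sum_labelProb : ∑ k, labelProb p k = 1 := by simp [labelProb]

theorem labelProb_mul_phi_zero (hp0 : 0 < p) :
    labelProb p 0 * phi p 0 = √(p * (1 - p)) := by
  simp only [labelProb, phi, Matrix.cons_val_zero]
  rw [← Real.sqrt_sq hp0.le, ← Real.sqrt_mul (sq_nonneg _), Real.sqrt_sq hp0.le]
  congr 1; field_simp

theorem labelProb_mul_phi_one (hp0 : 0 < p) (hp1 : p < 1) :
    labelProb p 1 * phi p 1 = -√(p * (1 - p)) := by
  simp only [labelProb, phi, Matrix.cons_val_one, Matrix.cons_val_fin_one, mul_neg]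
  have h1 : 0 < 1 - p := by linarith
  rw [← Real.sqrt_sq h1.le, ← Real.sqrt_mul (sq_nonneg _), Real.sqrt_sq h1.le]
  congr 2; field_simp

theorem sum_labelProb_mul_phi (hp0 : 0 < p) (hp1 : p < 1) :
    ∑ k, labelProb p k * phi p k = 0 := by
  rw [Fin.sum_univ_two, labelProb_mul_phi_zero hp0, labelProb_mul_phi_one hp0 hp1]
  ring

theorem sum_labelProb_mul_phi_sq (hp0 : 0 < p) (hp1 : p < 1) :
    ∑ k, labelProb p k * phi p k ^ 2 = 1 := by
  have h1 : 1 - p ≠ 0 := by linarith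
  simp only [Fin.sum_univ_two, sq, phi_zero_mul_phi_zero hp0 hp1, phi_one_mul_phi_one hp0 hp1]
  simp only [labelProb, Matrix.cons_val_zero, Matrix.cons_val_one, Matrix.cons_val_fin_one]
  field_simp
  ring

end Phi

/-- Balance says that the deviation of (a b; b c) from the constant matrix kills constants under the
prior, so it is a multiple of φφᵀ. The off-diagonal entry, where φφᵀ equals -1, identifies the
multiple as 1 - b. -/
theorem connectivity_eq_rankOne {p a b c d : ℝ} (hp0 : 0 < p) (hp1 : p < 1)
    (h1 : p * a + (1 - p) * b = 1) (h2 : p * b + (1 - p) * c = 1) (n : ℕ) :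
    connectivity a b c d n = rankOne p (d / n) (1 - b) := by
  have hq : 1 - p ≠ 0 := by linarith
  have ha : 1 + (1 - b) * (phi p 0 * phi p 0) = a := by
    rw [phi_zero_mul_phi_zero hp0 hp1]; field_simp; linarith
  have hc : 1 + (1 - b) * (phi p 1 * phi p 1) = c := by
    rw [phi_one_mul_phi_one hp0 hp1]; field_simp; linarith
  have hb : 1 + (1 - b) * (phi p 0 * phi p 1) = b := by
    rw [phi_zero_mul_phi_one hp0 hp1]; ring
  have hb' : 1 + (1 - b) * (phi p 1 * phi p 0) = b := by rw [mul_comm (phi p 1), hb]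
  ext k l
  fin_cases k <;> fin_cases l <;>
    simp [connectivity, rankOne, mul_assoc, ha, hb, hb', hc]

/-! ### Positivity and exchangeability of the model. -/

theorem sum_modelWeight {n : ℕ} (M : Matrix (Fin 2) (Fin 2) ℝ) (p : ℝ) :
    ∑ ω : (Fin n → Fin 2) × SimpleGraph (Fin n), modelWeight M p ω = 1 := by
  rw [Fintype.sum_prod_type]
  exact sum_weight M p

theorem modelWeight_pos {n : ℕ} {M : Matrix (Fin 2) (Fin 2) ℝ} {p : ℝ} (hp0 : 0 < p) (hp1 : p < 1)
    (hM0 : ∀ k l, 0 < M k l) (hM1 : ∀ k l, M k l < 1)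
    (ω : (Fin n → Fin 2) × SimpleGraph (Fin n)) : 0 < modelWeight M p ω := by
  refine mul_pos (Finset.prod_pos fun i _ => labelProb_pos hp0 hp1 _)
    (Finset.prod_pos fun i _ => Finset.prod_pos fun j _ => ?_)
  split_ifs
  · exact hM0 _ _
  · linarith [hM1 (ω.1 i) (ω.1 j)]

/-- A permutation may reverse the order of a pair; sorting the image gives a bijection of ordered
pairs, and symmetry of `f` makes the sorting harmless. -/
theorem prod_pairs_comp_perm {n : ℕ} (f : Fin n → Fin n → ℝ) (hf : ∀ i j, f i j = f j i)
    (σ : Equiv.Perm (Fin n)) :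
    ∏ i, ∏ j ∈ Finset.Ioi i, f (σ i) (σ j) = ∏ i, ∏ j ∈ Finset.Ioi i, f i j := by
  have key : ∀ h : Fin n → Fin n → ℝ, ∏ i, ∏ j ∈ Finset.Ioi i, h i j
      = ∏ e ∈ (Finset.univ : Finset (Fin n × Fin n)).filter (fun e => e.1 < e.2), h e.1 e.2 := by
    intro h
    rw [Finset.prod_filter, ← Finset.univ_product_univ, Finset.prod_product]
    refine Finset.prod_congr rfl fun i _ => ?_
    rw [← Finset.prod_filter]
    refine Finset.prod_congr ?_ fun _ _ => rfl
    ext j; simp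
  have hsort : ∀ e : Fin n × Fin n, f (min e.1 e.2) (max e.1 e.2) = f e.1 e.2 := by
    intro e
    rcases le_total e.1 e.2 with h | h
    · rw [min_eq_left h, max_eq_right h]
    · rw [min_eq_right h, max_eq_left h, hf]
  rw [key, key]
  refine Finset.prod_bij' (fun e _ => (min (σ e.1) (σ e.2), max (σ e.1) (σ e.2)))
    (fun e _ => (min (σ.symm e.1) (σ.symm e.2), max (σ.symm e.1) (σ.symm e.2))) ?_ ?_ ?_ ?_ ?_
  · intro e he
    simp only [Finset.mem_filter, Finset.mem_univ, true_and] at he ⊢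
    exact min_lt_max.2 fun h => he.ne (σ.injective h)
  · intro e he
    simp only [Finset.mem_filter, Finset.mem_univ, true_and] at he ⊢
    exact min_lt_max.2 fun h => he.ne (σ.symm.injective h)
  · rintro ⟨i, j⟩ he
    simp only [Finset.mem_filter, Finset.mem_univ, true_and] at he
    rcases le_total (σ i) (σ j) with h | h
    · simp [min_eq_left h, max_eq_right h, he.le]
    · simp [min_eq_right h, max_eq_left h, he.le]
  · rintro ⟨i, j⟩ he
    simp only [Finset.mem_filter, Finset.mem_univ, true_and] at he
    rcases le_total (σ.symm i) (σ.symm j) with h | h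
    · simp [min_eq_left h, max_eq_right h, he.le]
    · simp [min_eq_right h, max_eq_left h, he.le]
  · intro e _
    exact (hsort (σ e.1, σ e.2)).symm

/-- Relabelling the vertices. -/
def relabel {n : ℕ} (σ : Equiv.Perm (Fin n)) :
    (Fin n → Fin 2) × SimpleGraph (Fin n) ≃ (Fin n → Fin 2) × SimpleGraph (Fin n) where
  toFun ω := (ω.1 ∘ σ, ω.2.comap σ)
  invFun ω := (ω.1 ∘ σ.symm, ω.2.comap σ.symm)
  left_inv ω := by
    refine Prod.ext ?_ ?_
    · ext i; simp
    · ext i j; simp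
  right_inv ω := by
    refine Prod.ext ?_ ?_
    · ext i; simp
    · ext i j; simp

theorem modelWeight_relabel {n : ℕ} {M : Matrix (Fin 2) (Fin 2) ℝ} (hM : ∀ k l, M k l = M l k)
    (p : ℝ) (σ : Equiv.Perm (Fin n)) (ω : (Fin n → Fin 2) × SimpleGraph (Fin n)) :
    modelWeight M p (relabel σ ω) = modelWeight M p ω := by
  classical
  unfold modelWeight weight relabel
  congr 1
  · exact Equiv.prod_comp σ (fun i => labelProb p (ω.1 i))
  · have := prod_pairs_comp_perm (fun i j => if ω.2.Adj i j then M (ω.1 i) (ω.1 j)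
      else 1 - M (ω.1 i) (ω.1 j)) (fun i j => by simp only [ω.2.adj_comm i j, hM (ω.1 i)]) σ
    simp only [Equiv.coe_fn_mk, SimpleGraph.comap_adj, Function.comp_apply]
    convert this

theorem vertexEnergy_relabel {n : ℕ} {M : Matrix (Fin 2) (Fin 2) ℝ} (hM : ∀ k l, M k l = M l k)
    (p : ℝ) (σ : Equiv.Perm (Fin n)) (i : Fin n) (R : Finset (Fin n)) :
    vertexEnergy M p (σ i) (R.map σ.toEmbedding) = vertexEnergy M p i R := by
  unfold vertexEnergy
  rw [← energy_comp_equiv (relabel σ) (modelWeight M p) (obs R)]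
  simp only [modelWeight_relabel hM]
  refine energy_eq_of_rel (fun ω ω' => ?_) _
  simp only [obs_eq_iff, relabel, Equiv.coe_fn_mk, Finset.mem_map_equiv, Function.comp_apply]
  refine and_congr ⟨fun h => by rw [h], fun h => ?_⟩ ⟨fun h i hi => h _ (by simpa using hi),
    fun h i hi => by simpa using h _ hi⟩
  ext a b
  have := congrArg (fun G => G.Adj (σ.symm a) (σ.symm b)) h
  simpa using this

/-- By exchangeability the energy depends only on the number of revealed labels. -/
theorem vertexEnergy_eq_of_card_eq {n : ℕ} {M : Matrix (Fin 2) (Fin 2) ℝ}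
    (hM : ∀ k l, M k l = M l k) (p : ℝ) {i j : Fin n} {R T : Finset (Fin n)} (hi : i ∉ R)
    (hj : j ∉ T) (hc : R.card = T.card) : vertexEnergy M p i R = vertexEnergy M p j T := by
  classical
  -- Colour the vertices as distinguished, revealed or other. Both colourings have the same class
  -- sizes, so some permutation carries one to the other.
  let f : Fin n → Finset (Fin n) → Fin n → Fin 3 :=
    fun i R a => if a = i then 0 else if a ∈ R then 1 else 2
  have hcard : ∀ (i : Fin n) (R : Finset (Fin n)), i ∉ R → ∀ c, Fintype.card {a // f i R a = c} =
      ![1, R.card, n - 1 - R.card] c := by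
    intro i R hi c
    rw [Fintype.card_subtype]
    fin_cases c
    · have : (Finset.univ.filter fun a => f i R a = 0) = {i} := by
        ext a
        by_cases h : a = i <;> by_cases h' : a ∈ R <;> simp [f, h, h']
      simpa using congrArg Finset.card this
    · have : (Finset.univ.filter fun a => f i R a = 1) = R := by
        ext a
        by_cases h : a = i
        · simp [f, h, hi]
        · by_cases h' : a ∈ R <;> simp [f, h, h']
      simpa using congrArg Finset.card this
    · have : (Finset.univ.filter fun a => f i R a = 2) = (insert i R)ᶜ := by
        ext a
        by_cases h : a = i <;> by_cases h' : a ∈ R <;> simp [f, h, h']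
      have h2 := congrArg Finset.card this
      rw [Finset.card_compl, Finset.card_insert_of_notMem hi, Fintype.card_fin] at h2
      simp only [Fin.reduceFinMk, Fin.isValue, Matrix.cons_val]
      omega
  have he : ∀ c, Nonempty ({a // f i R a = c} ≃ {a // f j T a = c}) := fun c =>
    Fintype.card_eq.1 (by rw [hcard i R hi, hcard j T hj, hc])
  let σ : Equiv.Perm (Fin n) := Equiv.ofFiberEquiv fun c => (he c).some
  have hσ : ∀ a, f j T (σ a) = f i R a := fun a => Equiv.ofFiberEquiv_map _ a
  have h1 : σ i = j := by
    have := hσ i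
    by_contra h
    by_cases h' : σ i ∈ T <;> simp [f, h, h'] at this
  have h2 : R.map σ.toEmbedding = T := by
    refine Finset.eq_of_subset_of_card_le (fun b hb => ?_) (by rw [Finset.card_map, hc])
    obtain ⟨a, ha, rfl⟩ := Finset.mem_map.1 hb
    have := hσ a
    have hai : a ≠ i := fun h => hi (h ▸ ha)
    have haj : σ a ≠ j := fun h => hai (σ.injective (h.trans h1.symm))
    by_contra h
    have h' : σ a ∉ T := h
    simp [f, hai, ha, haj, h'] at this
  rw [← h2, ← h1]
  exact (vertexEnergy_relabel hM p σ i R).symm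

theorem vertexEnergy_mono {n : ℕ} {M : Matrix (Fin 2) (Fin 2) ℝ} {p : ℝ} (hp0 : 0 < p)
    (hp1 : p < 1) (hM0 : ∀ k l, 0 < M k l) (hM1 : ∀ k l, M k l < 1) (i : Fin n)
    {R T : Finset (Fin n)} (h : R ⊆ T) : vertexEnergy M p i R ≤ vertexEnergy M p i T := by
  refine energy_mono (modelWeight_pos hp0 hp1 hM0 hM1) _ _ (fun ω ω' h' => ?_) _
  rw [obs_eq_iff] at h' ⊢
  exact ⟨h'.1, fun i hi => h'.2 i (h hi)⟩

/-! ### Splitting off the root. -/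

/-- The graph obtained from a graph on the nonroot vertices and the neighbours of the root. -/
def joinRoot {n : ℕ} (S : Finset (Fin n)) (G : SimpleGraph (Fin n)) :
    SimpleGraph (Fin (n + 1)) where
  Adj a b := (a = 0 ∧ ∃ j ∈ S, b = j.succ) ∨ (b = 0 ∧ ∃ j ∈ S, a = j.succ) ∨
    ∃ i j, G.Adj i j ∧ a = i.succ ∧ b = j.succ
  symm := ⟨fun a b h => by
    rcases h with h | h | ⟨i, j, h, h1, h2⟩
    · exact Or.inr (Or.inl h)
    · exact Or.inl h
    · exact Or.inr (Or.inr ⟨j, i, h.symm, h2, h1⟩)⟩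
  loopless := ⟨fun a h => by
    rcases h with ⟨h, j, _, h'⟩ | ⟨h, j, _, h'⟩ | ⟨i, j, h, h1, h2⟩
    · exact Fin.succ_ne_zero j (h'.symm.trans h)
    · exact Fin.succ_ne_zero j (h'.symm.trans h)
    · rw [h1] at h2
      exact h.ne (Fin.succ_injective _ h2)⟩

theorem joinRoot_adj_zero_succ {n : ℕ} (S : Finset (Fin n)) (G : SimpleGraph (Fin n)) (j : Fin n) :
    (joinRoot S G).Adj 0 j.succ ↔ j ∈ S := by
  simp [joinRoot, Fin.succ_ne_zero, Fin.succ_inj, (Fin.succ_ne_zero _).symm]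

theorem joinRoot_adj_succ_succ {n : ℕ} (S : Finset (Fin n)) (G : SimpleGraph (Fin n))
    (i j : Fin n) : (joinRoot S G).Adj i.succ j.succ ↔ G.Adj i j := by
  simp only [joinRoot, Fin.succ_ne_zero, Fin.succ_inj, false_and, false_or]
  constructor
  · rintro ⟨_, _, h, rfl, rfl⟩
    exact h
  · exact fun h => ⟨i, j, h, rfl, rfl⟩

open Classical in
/-- Splitting off the root: its label, its neighbours, and the model on the other vertices. -/
noncomputable def splitRoot (n : ℕ) :
    (Fin 2 × Finset (Fin n)) × ((Fin n → Fin 2) × SimpleGraph (Fin n)) ≃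
      (Fin (n + 1) → Fin 2) × SimpleGraph (Fin (n + 1)) where
  toFun z := (Fin.cons z.1.1 z.2.1, joinRoot z.1.2 z.2.2)
  invFun ω := ((ω.1 0, Finset.univ.filter fun j => ω.2.Adj 0 j.succ),
    (fun i => ω.1 i.succ, ω.2.comap Fin.succ))
  left_inv z := by
    refine Prod.ext (Prod.ext ?_ ?_) (Prod.ext ?_ ?_)
    · simp
    · ext j; simp [joinRoot_adj_zero_succ]
    · ext j; simp
    · ext i j; simp [joinRoot_adj_succ_succ]
  right_inv ω := by
    refine Prod.ext ?_ ?_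
    · ext j
      refine Fin.cases ?_ (fun j => ?_) j <;> simp
    · ext i j
      refine Fin.cases ?_ (fun i => ?_) i <;> refine Fin.cases ?_ (fun j => ?_) j
      · simp
      · simp [joinRoot_adj_zero_succ]
      · rw [SimpleGraph.adj_comm, joinRoot_adj_zero_succ, SimpleGraph.adj_comm]
        simp
      · simp [joinRoot_adj_succ_succ]

open Classical in
/-- The probability that the neighbours of the root are `S`, given the root label `k` and the
labels `x`. -/
noncomputable def rootLaw {n : ℕ} (M : Matrix (Fin 2) (Fin 2) ℝ) (k : Fin 2) (S : Finset (Fin n))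
    (x : Fin n → Fin 2) : ℝ := ∏ j, if j ∈ S then M k (x j) else 1 - M k (x j)

theorem sum_rootLaw {n : ℕ} (M : Matrix (Fin 2) (Fin 2) ℝ) (k : Fin 2) (x : Fin n → Fin 2) :
    ∑ S, rootLaw M k S x = 1 := by
  classical
  have := Finset.prod_add (fun j => M k (x j)) (fun j => 1 - M k (x j)) Finset.univ
  simp only [add_sub_cancel, Finset.prod_const_one, Finset.powerset_univ] at this
  rw [this]
  refine Finset.sum_congr rfl fun S _ => ?_
  rw [rootLaw, Finset.prod_ite]
  congr 1 <;> refine Finset.prod_congr ?_ fun _ _ => rfl <;> ext <;> simp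

theorem modelWeight_splitRoot {n : ℕ} (M : Matrix (Fin 2) (Fin 2) ℝ) (p : ℝ)
    (z : (Fin 2 × Finset (Fin n)) × ((Fin n → Fin 2) × SimpleGraph (Fin n))) :
    modelWeight M p (splitRoot n z) =
      modelWeight M p z.2 * (labelProb p z.1.1 * rootLaw M z.1.1 z.1.2 z.2.1) := by
  classical
  simp only [modelWeight, weight, splitRoot, Equiv.coe_fn_mk, rootLaw, Fin.prod_univ_succ,
    Fin.cons_zero, Fin.cons_succ, Fin.prod_Ioi_zero, Fin.prod_Ioi_succ, joinRoot_adj_zero_succ,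
    joinRoot_adj_succ_succ]
  ring_nf

/-- The model on n vertices, with the same `M`, is what remains of the model on n + 1 vertices when
the root and its edges are forgotten (`energy_fst`). Seeing those edges can only increase the
energy. -/
theorem vertexEnergy_succ_le {n : ℕ} {M : Matrix (Fin 2) (Fin 2) ℝ} {p : ℝ} (hp0 : 0 < p)
    (hp1 : p < 1) (hM0 : ∀ k l, 0 < M k l) (hM1 : ∀ k l, M k l < 1) (i : Fin n)
    (R : Finset (Fin n)) :
    vertexEnergy M p i R ≤ vertexEnergy M p i.succ (R.map (Fin.succEmb n)) := by
  have h1 := energy_fst (A := Fin 2 × Finset (Fin n)) (modelWeight (n := n) M p)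
    (fun a ω => labelProb p a.1 * rootLaw M a.1 a.2 ω.1) (fun ω => by
      rw [Fintype.sum_prod_type]
      simp only [← Finset.mul_sum, sum_rootLaw, mul_one, sum_labelProb])
    (obs R) (fun ω => phi p (ω.1 i))
  have h2 := energy_comp_equiv (splitRoot n) (modelWeight M p) (obs (R.map (Fin.succEmb n)))
    (fun ω => phi p (ω.1 i.succ))
  simp only [modelWeight_splitRoot] at h2
  rw [vertexEnergy, vertexEnergy, ← h1, ← h2]
  simp only [splitRoot, Equiv.coe_fn_mk, Fin.cons_succ]
  refine energy_mono (fun z => ?_) _ _ (fun z z' h => ?_) _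
  · rw [← modelWeight_splitRoot]
    exact modelWeight_pos hp0 hp1 hM0 hM1 _
  · rw [obs_eq_iff] at h ⊢
    refine ⟨?_, fun i hi => ?_⟩
    · ext a b
      have := congrArg (fun G => G.Adj a.succ b.succ) h.1
      simpa [joinRoot_adj_succ_succ] using this
    · simpa using h.2 i.succ (by simpa using hi)

/-- Given the other labels, the neighbourhood of the root is independent of the rest of the graph,
so it is the output of a channel in the sense of `energy_channel`, with the other vertices as hidden
state. -/
theorem vertexEnergy_zero {n : ℕ} {M : Matrix (Fin 2) (Fin 2) ℝ} {p : ℝ} (hp0 : 0 < p)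
    (hp1 : p < 1) (hM0 : ∀ k l, 0 < M k l) (hM1 : ∀ k l, M k l < 1) (R : Finset (Fin n)) :
    vertexEnergy M p 0 (R.map (Fin.succEmb n)) =
      ∑ ω, modelWeight M p ω * ∑ S, (∑ k, labelProb p k * phi p k *
        condMean (modelWeight M p) (obs R) (fun ω => rootLaw M k S ω.1) ω) ^ 2 /
          ∑ k, labelProb p k *
            condMean (modelWeight M p) (obs R) (fun ω => rootLaw M k S ω.1) ω := by
  rw [← energy_channel (modelWeight M p) (modelWeight_pos hp0 hp1 hM0 hM1) (labelProb p)
    (fun k S ω => rootLaw M k S ω.1) (obs R) (phi p)]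
  have h2 := energy_comp_equiv (splitRoot n) (modelWeight M p) (obs (R.map (Fin.succEmb n)))
    (fun ω => phi p (ω.1 0))
  simp only [modelWeight_splitRoot] at h2
  rw [vertexEnergy, ← h2]
  simp only [splitRoot, Equiv.coe_fn_mk, Fin.cons_zero]
  refine energy_eq_of_rel (fun z z' => ?_) _
  rw [obs_eq_iff, Prod.mk.injEq, obs_eq_iff]
  simp only [Finset.mem_map, Fin.coe_succEmb, forall_exists_index, and_imp,
    forall_apply_eq_imp_iff₂, Fin.cons_succ]
  constructor
  · rintro ⟨h, h'⟩
    refine ⟨⟨?_, h'⟩, ?_⟩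
    · ext a b
      have := congrArg (fun G => G.Adj a.succ b.succ) h
      simpa [joinRoot_adj_succ_succ] using this
    · ext a
      have := congrArg (fun G => G.Adj 0 a.succ) h
      simpa [joinRoot_adj_zero_succ] using this
  · rintro ⟨⟨h, h'⟩, h''⟩
    exact ⟨by rw [h, h''], h'⟩

/-! ### Products close to one and Bernoulli random subsets. -/

theorem abs_prod_one_add_le {ι : Type*} {u : ι → ℝ} (hu : ∀ j, |u j| ≤ 1) (S : Finset ι) :
    |∏ j ∈ S, (1 + u j)| ≤ 2 ^ S.card := by
  rw [Finset.abs_prod, ← Finset.prod_const]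
  refine Finset.prod_le_prod (fun _ _ => abs_nonneg _) fun j _ => ?_
  have := abs_le.1 (hu j)
  rw [abs_le]; constructor <;> linarith

/-- The lower bound log(1 - t) ≥ -t - t², proved without logarithms and separately for each sign of
t. -/
theorem exp_neg_sub_sq_le {t : ℝ} (ht : |t| ≤ 1 / 2) : Real.exp (-t - t ^ 2) ≤ 1 - t := by
  have h := abs_le.1 ht
  have h1 : 0 < 1 - t := by linarith
  have key : 1 ≤ (1 - t) * Real.exp (t + t ^ 2) := by
    rcases le_total 0 t with h0 | h0
    · have hq := Real.quadratic_le_exp_of_nonneg (by positivity : 0 ≤ t + t ^ 2)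
      have h2 := mul_le_mul_of_nonneg_left hq h1.le
      have h3 : 0 ≤ t ^ 2 * ((1 - t) * (1 + t) ^ 2 / 2 - t) := by
        refine mul_nonneg (sq_nonneg _) ?_
        nlinarith [mul_nonneg h0 (by linarith : 0 ≤ 1 / 2 - t),
          mul_nonneg (mul_nonneg h0 h0) (by linarith : 0 ≤ 1 / 2 - t)]
      nlinarith
    · have h2 := mul_le_mul_of_nonneg_left (Real.add_one_le_exp (t + t ^ 2)) h1.le
      nlinarith [mul_nonneg (neg_nonneg.2 h0) (sq_nonneg t)]
  have h2 : Real.exp (-t - t ^ 2) * Real.exp (t + t ^ 2) = 1 := by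
    rw [← Real.exp_add]; simp
  exact le_of_mul_le_mul_right (h2.le.trans key) (Real.exp_pos _)

/-- The bound keeps the modulus of the signed sum rather than the sum of moduli. For the non-edges
of the root only the signed sum is small. -/
theorem abs_prod_one_sub_sub_one_le {ι : Type*} {t : ι → ℝ} (S : Finset ι) (ht : ∀ j ∈ S, |t j| ≤ 1 / 2) :
    |∏ j ∈ S, (1 - t j) - 1| ≤
      (|∑ j ∈ S, t j| + ∑ j ∈ S, t j ^ 2) * Real.exp (|∑ j ∈ S, t j| + ∑ j ∈ S, t j ^ 2) := by
  set τ := ∑ j ∈ S, t j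
  set v := ∑ j ∈ S, t j ^ 2 with hv
  have hv0 : 0 ≤ v := Finset.sum_nonneg fun _ _ => sq_nonneg _
  have hup : ∏ j ∈ S, (1 - t j) ≤ Real.exp (-τ) := by
    rw [← Finset.sum_neg_distrib, Real.exp_sum]
    refine Finset.prod_le_prod (fun j hj => ?_) fun j _ => ?_
    · linarith [(abs_le.1 (ht j hj)).2]
    · linarith [Real.add_one_le_exp (-t j)]
  have hlo : Real.exp (-τ - v) ≤ ∏ j ∈ S, (1 - t j) := by
    rw [hv, ← Finset.sum_neg_distrib, ← Finset.sum_sub_distrib, Real.exp_sum]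
    exact Finset.prod_le_prod (fun j _ => (Real.exp_pos _).le) fun j hj => exp_neg_sub_sq_le (ht j hj)
  have hexp : ∀ y : ℝ, 0 ≤ y → Real.exp y - 1 ≤ y * Real.exp y := by
    intro y _
    have h1 := Real.add_one_le_exp (-y)
    have h2 : Real.exp (-y) * Real.exp y = 1 := by rw [← Real.exp_add]; simp
    nlinarith [Real.exp_pos y]
  have hy0 : 0 ≤ |τ| + v := by positivity
  have hE := hexp _ hy0
  have h1 : Real.exp (-τ) ≤ Real.exp (|τ| + v) :=
    Real.exp_le_exp.2 (by linarith [neg_abs_le τ])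
  have h2 : 1 - (|τ| + v) ≤ Real.exp (-τ - v) := by
    have := Real.add_one_le_exp (-τ - v); linarith [le_abs_self τ]
  have h3 : (1 : ℝ) ≤ Real.exp (|τ| + v) := Real.one_le_exp hy0
  rw [abs_le]
  constructor
  · nlinarith
  · linarith

section Subsets

variable {ι : Type*} [DecidableEq ι]

/-- The probability that a Bernoulli(`θ`) random subset of `I` is `S`. -/
def bern (θ : ℝ) (I S : Finset ι) : ℝ := θ ^ S.card * (1 - θ) ^ (I \ S).card

/-- The likelihood ratio of the subset `S` of `I` when the point `j` is chosen with probability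
`θ (1 + u j)` instead of `θ`. -/
noncomputable def subsetLik (θ : ℝ) (I : Finset ι) (u : ι → ℝ) (S : Finset ι) : ℝ :=
  (∏ j ∈ S, (1 + u j)) * ∏ j ∈ I \ S, (1 - θ / (1 - θ) * u j)

theorem bern_nonneg {θ : ℝ} (h0 : 0 ≤ θ) (h1 : θ ≤ 1) (I S : Finset ι) : 0 ≤ bern θ I S :=
  mul_nonneg (pow_nonneg h0 _) (pow_nonneg (by linarith) _)

theorem sum_bern_mul_pow (θ c : ℝ) (I : Finset ι) :
    ∑ S ∈ I.powerset, bern θ I S * c ^ S.card = (c * θ + (1 - θ)) ^ I.card := by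
  have := Finset.prod_add (fun _ : ι => c * θ) (fun _ => 1 - θ) I
  simp only [Finset.prod_const] at this
  rw [this]
  refine Finset.sum_congr rfl fun S _ => ?_
  rw [bern, mul_pow]; ring

theorem sum_bern_mul_pow_le {θ c d : ℝ} (h0 : 0 ≤ θ) (hc : 1 ≤ c) (I : Finset ι)
    (hd : θ * I.card ≤ d) :
    ∑ S ∈ I.powerset, bern θ I S * c ^ S.card ≤ Real.exp ((c - 1) * d) := by
  rw [sum_bern_mul_pow]
  have h1 : c * θ + (1 - θ) ≤ Real.exp ((c - 1) * θ) := by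
    have := Real.add_one_le_exp ((c - 1) * θ); linarith
  calc (c * θ + (1 - θ)) ^ I.card ≤ Real.exp ((c - 1) * θ) ^ I.card :=
        pow_le_pow_left₀ (by nlinarith) h1 _
    _ = Real.exp ((c - 1) * (θ * I.card)) := by rw [← Real.exp_nat_mul]; congr 1; ring
    _ ≤ _ := Real.exp_le_exp.2 (mul_le_mul_of_nonneg_left hd (by linarith))

/-- The sum over `I \ S` is the full sum minus at most |S|/2, and the weight θ/(1 - θ) is at most
2θ. The exponent stays below 2d because both the linear and the quadratic sum are at most d. -/
theorem abs_nonedge_sub_one_le {θ d : ℝ} (h0 : 0 < θ) (h1 : θ ≤ 1 / 2) (I S : Finset ι)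
    (hS : S ⊆ I) (hd : θ * I.card ≤ d) {u : ι → ℝ} (hu : ∀ j, |u j| ≤ 1 / 2) :
    |∏ j ∈ I \ S, (1 - θ / (1 - θ) * u j) - 1| ≤
      Real.exp (2 * d) * θ * (2 * |∑ j ∈ I, u j| + S.card + d) := by
  have hθ' : θ / (1 - θ) ≤ 2 * θ := by
    rw [div_le_iff₀ (by linarith)]; nlinarith
  have hθ0 : 0 ≤ θ / (1 - θ) := div_nonneg h0.le (by linarith)
  have hd0 : 0 ≤ d := le_trans (by positivity) hd
  have hterm : ∀ j, |θ / (1 - θ) * u j| ≤ θ := by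
    intro j
    rw [abs_mul, abs_of_nonneg hθ0]
    nlinarith [hu j, abs_nonneg (u j)]
  have hsub : ((I \ S).card : ℝ) ≤ I.card := by exact_mod_cast Finset.card_le_card Finset.sdiff_subset
  have hsum1 : |∑ j ∈ I \ S, θ / (1 - θ) * u j| ≤ d := by
    refine (Finset.abs_sum_le_sum_abs _ _).trans ((Finset.sum_le_sum fun j _ => hterm j).trans ?_)
    rw [Finset.sum_const, nsmul_eq_mul]
    nlinarith
  have hsum2 : ∑ j ∈ I \ S, (θ / (1 - θ) * u j) ^ 2 ≤ θ * d := by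
    have : ∀ j ∈ I \ S, (θ / (1 - θ) * u j) ^ 2 ≤ θ * θ := by
      intro j _
      rw [← sq_abs, sq]
      exact mul_le_mul (hterm j) (hterm j) (abs_nonneg _) h0.le
    refine (Finset.sum_le_sum this).trans ?_
    rw [Finset.sum_const, nsmul_eq_mul]
    nlinarith
  have hsum3 : |∑ j ∈ I \ S, θ / (1 - θ) * u j| ≤ θ * (2 * |∑ j ∈ I, u j| + S.card) := by
    rw [← Finset.mul_sum, abs_mul, abs_of_nonneg hθ0]
    have e : ∑ j ∈ I \ S, u j = ∑ j ∈ I, u j - ∑ j ∈ S, u j := by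
      rw [← Finset.sum_sdiff hS]; ring
    have h2 : |∑ j ∈ S, u j| ≤ S.card * (1 / 2) := by
      refine (Finset.abs_sum_le_sum_abs _ _).trans ((Finset.sum_le_sum fun j _ => hu j).trans ?_)
      rw [Finset.sum_const, nsmul_eq_mul]
    have h3 : |∑ j ∈ I \ S, u j| ≤ |∑ j ∈ I, u j| + S.card * (1 / 2) := by
      rw [e]; exact (abs_sub _ _).trans (by linarith)
    calc θ / (1 - θ) * |∑ j ∈ I \ S, u j| ≤ (2 * θ) * (|∑ j ∈ I, u j| + S.card * (1 / 2)) :=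
          mul_le_mul hθ' h3 (abs_nonneg _) (by linarith)
      _ = _ := by ring
  refine (abs_prod_one_sub_sub_one_le _ fun j _ => (hterm j).trans h1).trans ?_
  have hE : Real.exp (|∑ j ∈ I \ S, θ / (1 - θ) * u j| + ∑ j ∈ I \ S, (θ / (1 - θ) * u j) ^ 2)
      ≤ Real.exp (2 * d) := Real.exp_le_exp.2 (by nlinarith)
  have hnn : 0 ≤ |∑ j ∈ I \ S, θ / (1 - θ) * u j| + ∑ j ∈ I \ S, (θ / (1 - θ) * u j) ^ 2 :=
    add_nonneg (abs_nonneg _) (Finset.sum_nonneg fun _ _ => sq_nonneg _)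
  calc _ ≤ (θ * (2 * |∑ j ∈ I, u j| + S.card) + θ * d) * Real.exp (2 * d) :=
        mul_le_mul (by linarith) hE (Real.exp_pos _).le (by positivity)
    _ = _ := by ring

/-- Averaged over the random subset, dropping the factors of the points that are not chosen
costs little. -/
theorem sum_bern_nonedge_le {θ d : ℝ} (h0 : 0 < θ) (h1 : θ ≤ 1 / 2) (I : Finset ι)
    (hd : θ * I.card ≤ d) {u : ι → ℝ} (hu : ∀ j, |u j| ≤ 1 / 2) :
    ∑ S ∈ I.powerset, bern θ I S * |subsetLik θ I u S - ∏ j ∈ S, (1 + u j)| ≤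
      Real.exp (5 * d) * θ * (2 * |∑ j ∈ I, u j| + 1 + d) := by
  have hd0 : 0 ≤ d := le_trans (by positivity) hd
  have hterm : ∀ S ∈ I.powerset, bern θ I S * |subsetLik θ I u S - ∏ j ∈ S, (1 + u j)| ≤
      Real.exp (2 * d) * θ * (2 * |∑ j ∈ I, u j| + 1 + d) * (bern θ I S * 4 ^ S.card) := by
    intro S hS
    have hS' := Finset.mem_powerset.1 hS
    have h2 := abs_nonedge_sub_one_le h0 h1 I S hS' hd hu
    have h3 := abs_prod_one_add_le (fun j => (hu j).trans (by norm_num)) S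
    have h4 : subsetLik θ I u S - ∏ j ∈ S, (1 + u j) =
        (∏ j ∈ S, (1 + u j)) * (∏ j ∈ I \ S, (1 - θ / (1 - θ) * u j) - 1) := by
      rw [subsetLik]; ring
    have h5 : (S.card : ℝ) + 1 ≤ 2 ^ S.card := by exact_mod_cast Nat.lt_two_pow_self
    have h6 : (1 : ℝ) ≤ 2 ^ S.card := one_le_pow₀ (by norm_num)
    have h7 : (4 : ℝ) ^ S.card = 2 ^ S.card * 2 ^ S.card := by rw [← mul_pow]; norm_num
    -- One factor 2^|S| bounds the edge product and a second absorbs |S|. Together they are 4^|S|,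
    -- whose Bernoulli average is at most exp(3d); hence the final exp(5d).
    have h8 : 2 * |∑ j ∈ I, u j| + S.card + d ≤ (2 * |∑ j ∈ I, u j| + 1 + d) * 2 ^ S.card := by
      nlinarith [abs_nonneg (∑ j ∈ I, u j)]
    rw [h4, abs_mul, h7]
    have hb := bern_nonneg h0.le (by linarith : θ ≤ 1) I S
    have hE : 0 ≤ Real.exp (2 * d) * θ := by positivity
    calc _ ≤ bern θ I S * (2 ^ S.card * (Real.exp (2 * d) * θ *
          ((2 * |∑ j ∈ I, u j| + 1 + d) * 2 ^ S.card))) :=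
        mul_le_mul_of_nonneg_left (mul_le_mul h3
          (h2.trans (mul_le_mul_of_nonneg_left h8 hE)) (abs_nonneg _) (by positivity)) hb
      _ = _ := by ring
  refine (Finset.sum_le_sum hterm).trans ?_
  rw [← Finset.mul_sum]
  have h9 := sum_bern_mul_pow_le h0.le (by norm_num : (1 : ℝ) ≤ 4) I hd
  have h10 : Real.exp (5 * d) = Real.exp (2 * d) * Real.exp ((4 - 1) * d) := by
    rw [← Real.exp_add]; congr 1; ring
  rw [h10]
  calc _ ≤ Real.exp (2 * d) * θ * (2 * |∑ j ∈ I, u j| + 1 + d) * Real.exp ((4 - 1) * d) :=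
        mul_le_mul_of_nonneg_left h9 (by positivity)
    _ = _ := by ring

end Subsets

/-! ### The posterior second moment as a function of the likelihoods. -/

/-- The posterior second moment of a label of prior `labelProb p`, as a function of the two
likelihoods. -/
noncomputable def potential (p a₀ a₁ : ℝ) : ℝ :=
  p * (1 - p) * (a₀ - a₁) ^ 2 / (p * a₀ + (1 - p) * a₁)

theorem potential_eq {p : ℝ} (hp0 : 0 < p) (hp1 : p < 1) (a : Fin 2 → ℝ) :
    (∑ k, labelProb p k * phi p k * a k) ^ 2 / ∑ k, labelProb p k * a k
      = potential p (a 0) (a 1) := by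
  rw [Fin.sum_univ_two, Fin.sum_univ_two, labelProb_mul_phi_zero hp0,
    labelProb_mul_phi_one hp0 hp1, potential]
  congr 1
  have := Real.sq_sqrt (mul_nonneg hp0.le (by linarith : 0 ≤ 1 - p))
  calc _ = √(p * (1 - p)) ^ 2 * (a 0 - a 1) ^ 2 := by ring
    _ = _ := by rw [this]

theorem abs_div_mix_le {p a b : ℝ} (hp0 : 0 < p) (hp1 : p ≤ 1 / 2) (ha : 0 < a) (hb : 0 < b) :
    |(a - b) / (p * a + (1 - p) * b)| ≤ 1 / p := by
  have hT : 0 < p * a + (1 - p) * b := by nlinarith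
  rw [abs_div, abs_of_pos hT, div_le_div_iff₀ hT hp0, one_mul]
  rcases abs_cases (a - b) with ⟨h, _⟩ | ⟨h, _⟩ <;> rw [h] <;> nlinarith

/-- `potential` is homogeneous of degree one, so its slope depends only on the ratio (a₀ - a₁)/(p a₀
+ (1 - p) a₁), which is bounded by 1/p. The identity `key` writes the difference exactly in terms of
the two ratios. -/
theorem abs_potential_sub_le {p a₀ a₁ b₀ b₁ : ℝ} (hp0 : 0 < p) (hp1 : p ≤ 1 / 2) (ha₀ : 0 < a₀)
    (ha₁ : 0 < a₁) (hb₀ : 0 < b₀) (hb₁ : 0 < b₁) :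
    |potential p a₀ a₁ - potential p b₀ b₁| ≤ 3 / p ^ 2 * (|a₀ - b₀| + |a₁ - b₁|) := by
  have hTa : 0 < p * a₀ + (1 - p) * a₁ := by nlinarith
  have hTb : 0 < p * b₀ + (1 - p) * b₁ := by nlinarith
  have ha := abs_div_mix_le hp0 hp1 ha₀ ha₁
  have hb := abs_div_mix_le hp0 hp1 hb₀ hb₁
  have key : potential p a₀ a₁ - potential p b₀ b₁ = p * (1 - p) *
      (((a₀ - b₀) - (a₁ - b₁)) * ((a₀ - a₁) / (p * a₀ + (1 - p) * a₁) +
        (b₀ - b₁) / (p * b₀ + (1 - p) * b₁)) - (a₀ - a₁) / (p * a₀ + (1 - p) * a₁) *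
        ((b₀ - b₁) / (p * b₀ + (1 - p) * b₁)) * (p * (a₀ - b₀) + (1 - p) * (a₁ - b₁))) := by
    rw [potential, potential]
    field_simp
    ring
  set ρ := (a₀ - a₁) / (p * a₀ + (1 - p) * a₁)
  set ρ' := (b₀ - b₁) / (p * b₀ + (1 - p) * b₁)
  set D := 1 / p with hD
  have hD2 : 2 ≤ D := by rw [hD, le_div_iff₀ hp0]; linarith
  have h3 : 3 / p ^ 2 = 3 * D ^ 2 := by rw [hD]; field_simp
  set x := a₀ - b₀
  set y := a₁ - b₁
  have h1 : |x - y| ≤ |x| + |y| := abs_sub _ _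
  have h2 : |p * x + (1 - p) * y| ≤ |x| + |y| := by
    refine (abs_add_le _ _).trans ?_
    rw [abs_mul, abs_mul, abs_of_pos hp0, abs_of_pos (by linarith : 0 < 1 - p)]
    nlinarith [abs_nonneg x, abs_nonneg y]
  have h4 : |ρ + ρ'| ≤ 2 * D := (abs_add_le _ _).trans (by linarith)
  have h5 : |ρ * ρ'| ≤ D ^ 2 := by
    rw [abs_mul, sq]; exact mul_le_mul ha hb (abs_nonneg _) (by linarith)
  have hs : 0 ≤ |x| + |y| := by positivity
  rw [key, h3, abs_mul]
  have h6 : |(x - y) * (ρ + ρ') - ρ * ρ' * (p * x + (1 - p) * y)| ≤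
      (|x| + |y|) * (2 * D) + D ^ 2 * (|x| + |y|) := by
    refine (abs_sub _ _).trans (add_le_add ?_ ?_)
    · rw [abs_mul]; exact mul_le_mul h1 h4 (abs_nonneg _) hs
    · rw [abs_mul]; exact mul_le_mul h5 h2 (abs_nonneg _) (by positivity)
  have h7 : |p * (1 - p)| ≤ 1 := by
    rw [abs_of_nonneg (by nlinarith)]; nlinarith
  calc _ ≤ 1 * ((|x| + |y|) * (2 * D) + D ^ 2 * (|x| + |y|)) :=
        mul_le_mul h7 h6 (abs_nonneg _) (by norm_num)
    _ = (2 * D + D ^ 2) * (|x| + |y|) := by ring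
    _ ≤ 3 * D ^ 2 * (|x| + |y|) := mul_le_mul_of_nonneg_right (by nlinarith) hs

/-- The posterior mean of the label of `i` when the graph and the labels in `R` are known. -/
noncomputable def vertexMean {n : ℕ} (M : Matrix (Fin 2) (Fin 2) ℝ) (p : ℝ) (R : Finset (Fin n))
    (i : Fin n) : (Fin n → Fin 2) × SimpleGraph (Fin n) → ℝ :=
  condMean (modelWeight M p) (obs R) (fun ω => phi p (ω.1 i))

/-! ### Fluctuations of the labels, and approximate independence after pinning. -/

section Decoupling

variable {n : ℕ} {M : Matrix (Fin 2) (Fin 2) ℝ} {p : ℝ}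

/-- The labels are independent with mean 0 and variance 1. Each split-off root adds its variance 1,
the cross term vanishes, and its neighbourhood sums out. -/
theorem sum_sq_sum_phi (M : Matrix (Fin 2) (Fin 2) ℝ) (hp0 : 0 < p) (hp1 : p < 1) (n : ℕ) :
    ∑ ω : (Fin n → Fin 2) × SimpleGraph (Fin n),
      modelWeight M p ω * (∑ i, phi p (ω.1 i)) ^ 2 = n := by
  induction n with
  | zero => simp
  | succ n ih =>
    rw [← Equiv.sum_comp (splitRoot n)]
    simp only [modelWeight_splitRoot, Fin.sum_univ_succ]
    simp only [splitRoot, Equiv.coe_fn_mk, Fin.cons_zero, Fin.cons_succ]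
    rw [Fintype.sum_prod_type_right]
    have h : ∀ ω : (Fin n → Fin 2) × SimpleGraph (Fin n), ∑ x : Fin 2 × Finset (Fin n),
        modelWeight M p ω * (labelProb p x.1 * rootLaw M x.1 x.2 ω.1) *
          (phi p x.1 + ∑ i, phi p (ω.1 i)) ^ 2 =
        modelWeight M p ω + modelWeight M p ω * (∑ i, phi p (ω.1 i)) ^ 2 := by
      intro ω
      set s := ∑ i, phi p (ω.1 i)
      rw [Fintype.sum_prod_type]
      have h1 : ∀ k : Fin 2, ∑ S : Finset (Fin n), modelWeight M p ω *
          (labelProb p k * rootLaw M k S ω.1) * (phi p k + s) ^ 2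
          = modelWeight M p ω * (labelProb p k * phi p k ^ 2 +
            2 * s * (labelProb p k * phi p k) + s ^ 2 * labelProb p k) := by
        intro k
        rw [← Finset.sum_mul, ← Finset.mul_sum, ← Finset.mul_sum, sum_rootLaw]
        ring
      simp only [h1]
      rw [← Finset.mul_sum, Finset.sum_add_distrib, Finset.sum_add_distrib, ← Finset.mul_sum,
        ← Finset.mul_sum, sum_labelProb_mul_phi_sq hp0 hp1, sum_labelProb_mul_phi hp0 hp1,
        sum_labelProb]
      ring
    simp only [h]
    rw [Finset.sum_add_distrib, ih, sum_modelWeight]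
    push_cast; ring

theorem sum_abs_sum_phi_le (hp0 : 0 < p) (hp1 : p < 1) (hM0 : ∀ k l, 0 < M k l)
    (hM1 : ∀ k l, M k l < 1) (n : ℕ) :
    ∑ ω : (Fin n → Fin 2) × SimpleGraph (Fin n),
      modelWeight M p ω * |∑ i, phi p (ω.1 i)| ≤ √n := by
  rw [← sum_sq_sum_phi M hp0 hp1 n]
  exact sum_abs_le_sqrt (modelWeight_pos hp0 hp1 hM0 hM1) (sum_modelWeight M p) _

/-- The sum of the posterior means is the conditional mean of the sum of the labels, and
conditioning contracts L¹. The non-edge estimate therefore applies to the means as it does to the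
labels. -/
theorem sum_abs_sum_vertexMean_le (hp0 : 0 < p) (hp1 : p < 1) (hM0 : ∀ k l, 0 < M k l)
    (hM1 : ∀ k l, M k l < 1) (R : Finset (Fin n)) :
    ∑ ω, modelWeight M p ω * |∑ i, vertexMean M p R i ω| ≤ √n := by
  refine le_trans ?_ (sum_abs_sum_phi_le hp0 hp1 hM0 hM1 n)
  have := sum_abs_condMean_le (modelWeight_pos hp0 hp1 hM0 hM1) (obs R)
    (fun ω : (Fin n → Fin 2) × SimpleGraph (Fin n) => ∑ i, phi p (ω.1 i))
  simp only [condMean_sum] at this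
  exact this

theorem vertexMean_congr (R : Finset (Fin n)) (i : Fin n)
    {ω ω' : (Fin n → Fin 2) × SimpleGraph (Fin n)} (h : obs R ω = obs R ω') :
    vertexMean M p R i ω = vertexMean M p R i ω' := condMean_congr _ _ _ h

/-- If revealing at most `s` further labels changes the posterior means little, then the labels
of a set of at most `s` vertices are nearly independent given the observation. -/
theorem sum_abs_condMean_prod_sub_le (hp0 : 0 < p) (hp1 : p < 1) (hM0 : ∀ k l, 0 < M k l)
    (hM1 : ∀ k l, M k l < 1) (R : Finset (Fin n)) {s : ℕ} {Δ c : ℝ}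
    (hΔ : ∀ i, ∀ T : Finset (Fin n), R ⊆ T → i ∉ T → T.card ≤ R.card + s →
      vertexEnergy M p i T - vertexEnergy M p i R ≤ Δ)
    (hc : |c| ≤ 1) (hcφ : ∀ k, |c * phi p k| ≤ 1) (S : Finset (Fin n)) (hS : S.card ≤ s) :
    ∑ ω, modelWeight M p ω * |condMean (modelWeight M p) (obs R)
      (fun ω => ∏ j ∈ S, (1 + c * phi p (ω.1 j))) ω - ∏ j ∈ S, (1 + c * vertexMean M p R j ω)|
      ≤ 4 ^ S.card * √Δ := by
  classical
  have hw := modelWeight_pos (n := n) hp0 hp1 hM0 hM1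
  induction S using Finset.induction_on with
  | empty =>
    have : ∀ ω, condMean (modelWeight M p) (obs R) (fun _ => 1) ω = 1 :=
      condMean_of_measurable hw (obs R) _ (fun _ _ _ => rfl)
    simp [this]
  | insert i S hi ih =>
    rw [Finset.card_insert_of_notMem hi] at hS ⊢
    have ih := ih (by omega)
    set w := modelWeight (n := n) M p
    set P : (Fin n → Fin 2) × SimpleGraph (Fin n) → ℝ :=
      fun ω => ∏ j ∈ S, (1 + c * phi p (ω.1 j)) with hP
    set m := vertexMean M p R with hm
    set f : (Fin n → Fin 2) × SimpleGraph (Fin n) → ℝ := fun ω => phi p (ω.1 i)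
    set m' : (Fin n → Fin 2) × SimpleGraph (Fin n) → ℝ := condMean w (obs (R ∪ S)) f with hm'
    have hPle : ∀ ω, |P ω| ≤ 2 ^ S.card := fun ω => abs_prod_one_add_le (fun j => hcφ _) S
    have href : ∀ ω ω' : (Fin n → Fin 2) × SimpleGraph (Fin n),
        obs (R ∪ S) ω = obs (R ∪ S) ω' → obs R ω = obs R ω' := by
      intro ω ω' h
      rw [obs_eq_iff] at h ⊢
      exact ⟨h.1, fun j hj => h.2 j (Finset.mem_union_left _ hj)⟩
    have hPm : ∀ ω ω' : (Fin n → Fin 2) × SimpleGraph (Fin n),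
        obs (R ∪ S) ω = obs (R ∪ S) ω' → P ω = P ω' := by
      intro ω ω' h
      rw [obs_eq_iff] at h
      exact Finset.prod_congr rfl fun j hj => by rw [h.2 j (Finset.mem_union_right _ hj)]
    -- Revealing the labels in `S` moves the posterior mean of `i` by at most √Δ in L², by
    -- Pythagoras. If `i` is already revealed, nothing moves.
    have hdiff : ∑ ω, w ω * |m' ω - m i ω| ≤ √Δ := by
      by_cases hiR : i ∈ R
      · have h1 : ∀ ω, m' ω = f ω := condMean_of_measurable hw _ _ fun ω ω' h => by
          rw [obs_eq_iff] at h
          simp only [f, h.2 i (Finset.mem_union_left _ hiR)]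
        have h2 : ∀ ω, m i ω = f ω := condMean_of_measurable hw _ _ fun ω ω' h => by
          rw [obs_eq_iff] at h
          simp only [h.2 i hiR]
        simp [h1, h2, Real.sqrt_nonneg]
      · refine (sum_abs_le_sqrt hw (sum_modelWeight M p) _).trans (Real.sqrt_le_sqrt ?_)
        refine (sum_sq_condMean_sub hw (obs R) (obs (R ∪ S)) href f).le.trans ?_
        exact hΔ i (R ∪ S) Finset.subset_union_left (by simp [hiR, hi])
          ((Finset.card_union_le _ _).trans (by omega))
    -- The product over `S` is known once `S` is revealed, so conditioning first on `R ∪ S` replaces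
    -- the label of `i` by `m'`. The error made by using `m i` instead is isolated in the last term.
    have hdec : ∀ ω, condMean w (obs R) (fun ω => ∏ j ∈ insert i S, (1 + c * phi p (ω.1 j))) ω -
        ∏ j ∈ insert i S, (1 + c * m j ω) =
        (1 + c * m i ω) * (condMean w (obs R) P ω - ∏ j ∈ S, (1 + c * m j ω)) +
          condMean w (obs R) (fun ω => P ω * (c * (m' ω - m i ω))) ω := by
      intro ω
      have e1 : (fun ω : (Fin n → Fin 2) × SimpleGraph (Fin n) =>
          ∏ j ∈ insert i S, (1 + c * phi p (ω.1 j))) =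
          fun ω => (1 + c * m i ω) * P ω + P ω * (c * (f ω - m i ω)) := by
        ext ω
        rw [Finset.prod_insert hi]
        simp only [hP, f]; ring
      have e2 : condMean w (obs R) (fun ω => P ω * (c * (m' ω - m i ω))) ω
          = condMean w (obs R) (fun ω => P ω * (c * (f ω - m i ω))) ω := by
        rw [← condMean_condMean hw (obs R) (obs (R ∪ S)) href
          (fun ω => P ω * (c * (f ω - m i ω)))]
        congr 1
        ext ω'
        rw [condMean_mul_left w (obs (R ∪ S)) (fun ω => c * (f ω - m i ω)) P hPm,
          condMean_const_mul, condMean_sub, condMean_of_measurable hw (obs (R ∪ S)) (m i)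
          fun a b hab => vertexMean_congr R i (href a b hab)]
      rw [e2, e1, condMean_add, condMean_mul_left w (obs R) P (fun ω => 1 + c * m i ω)
        (fun a b hab => by simp only [hm, vertexMean_congr R i hab]), Finset.prod_insert hi]
      ring
    have hmi : ∀ ω, |1 + c * m i ω| ≤ 2 := by
      intro ω
      have h1 : |c * m i ω| ≤ 1 := by
        rw [hm, vertexMean, ← condMean_const_mul]
        exact abs_condMean_le_of_bound hw (obs R) (fun ω => hcφ _) ω
      rw [abs_le] at h1 ⊢
      constructor <;> linarith
    have h2 : ∑ ω, w ω * |condMean w (obs R) (fun ω => P ω * (c * (m' ω - m i ω))) ω|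
        ≤ 2 ^ S.card * √Δ := by
      refine (sum_abs_condMean_le hw _ _).trans
        (le_trans ?_ (mul_le_mul_of_nonneg_left hdiff (by positivity)))
      rw [Finset.mul_sum]
      refine Finset.sum_le_sum fun ω _ => ?_
      rw [abs_mul, abs_mul]
      have : |c| * |m' ω - m i ω| ≤ |m' ω - m i ω| := mul_le_of_le_one_left (abs_nonneg _) hc
      calc _ ≤ w ω * (2 ^ S.card * |m' ω - m i ω|) :=
            mul_le_mul_of_nonneg_left (mul_le_mul (hPle ω) this (by positivity) (by positivity))
              (hw ω).le
        _ = _ := by ring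
    calc _ ≤ ∑ ω, (2 * (w ω * |condMean w (obs R) P ω - ∏ j ∈ S, (1 + c * m j ω)|) +
          w ω * |condMean w (obs R) (fun ω => P ω * (c * (m' ω - m i ω))) ω|) := by
          refine Finset.sum_le_sum fun ω _ => ?_
          rw [hdec]
          have h3 := abs_add_le ((1 + c * m i ω) * (condMean w (obs R) P ω -
            ∏ j ∈ S, (1 + c * m j ω))) (condMean w (obs R) (fun ω => P ω * (c * (m' ω - m i ω))) ω)
          rw [abs_mul] at h3
          have h4 := mul_le_mul_of_nonneg_right (hmi ω)
            (abs_nonneg (condMean w (obs R) P ω - ∏ j ∈ S, (1 + c * m j ω)))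
          calc _ ≤ w ω * (2 * |condMean w (obs R) P ω - ∏ j ∈ S, (1 + c * m j ω)| +
                |condMean w (obs R) (fun ω => P ω * (c * (m' ω - m i ω))) ω|) :=
                mul_le_mul_of_nonneg_left (h3.trans (by linarith)) (hw ω).le
            _ = _ := by ring
      _ ≤ 2 * (4 ^ S.card * √Δ) + 2 ^ S.card * √Δ := by
          rw [Finset.sum_add_distrib, ← Finset.mul_sum]
          exact add_le_add (mul_le_mul_of_nonneg_left ih (by norm_num)) h2
      -- The recursion gives 2 · 4^k + 2^k ≤ 3 · 4^k, so base 4 has room to spare.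
      _ ≤ 4 ^ (S.card + 1) * √Δ := by
          have : (2 : ℝ) ^ S.card ≤ 4 ^ S.card := pow_le_pow_left₀ (by norm_num) (by norm_num) _
          have h5 := mul_le_mul_of_nonneg_right this (Real.sqrt_nonneg Δ)
          have h6 : 0 ≤ (4 : ℝ) ^ S.card * √Δ := by positivity
          have h7 : (4 : ℝ) ^ (S.card + 1) * √Δ = 4 * (4 ^ S.card * √Δ) := by rw [pow_succ]; ring
          linarith

/-- A bounded number of labels can be revealed so that revealing `s` more has little effect. -/
theorem exists_pinning (hp0 : 0 < p) (hp1 : p ≤ 1 / 2) (hM : ∀ k l, M k l = M l k)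
    (hM0 : ∀ k l, 0 < M k l) (hM1 : ∀ k l, M k l < 1) (s J : ℕ) (hJ : 0 < J)
    (hn : J * s + 1 ≤ n) :
    ∃ R : Finset (Fin n), R.card ≤ J * s ∧ R.card < n ∧
      ∀ i, ∀ T : Finset (Fin n), R ⊆ T → i ∉ T → T.card ≤ R.card + s →
        vertexEnergy M p i T - vertexEnergy M p i R ≤ (1 / p) ^ 2 / J := by
  have hp1' : p < 1 := by linarith
  have hw := modelWeight_pos (n := n) hp0 hp1' hM0 hM1
  let T : ℕ → Finset (Fin n) := fun j => Finset.univ.filter fun a => (a : ℕ) < j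
  have hT : ∀ j, j ≤ n → (T j).card = j := by
    intro j hj
    simp only [T, Fin.card_filter_val_lt]
    exact min_eq_right hj
  let i₀ : Fin n := ⟨n - 1, by omega⟩
  have hi₀ : ∀ j, j + 1 ≤ n → i₀ ∉ T j := by
    intro j hj
    simp only [T, i₀, Finset.mem_filter, Finset.mem_univ, true_and]
    omega
  -- The energy as a function of the number of revealed labels alone; the last vertex stays outside
  -- every initial segment of fewer than `n` vertices.
  let q : ℕ → ℝ := fun j => vertexEnergy M p i₀ (T j)
  have hq : ∀ (i : Fin n) (R : Finset (Fin n)), i ∉ R → vertexEnergy M p i R = q R.card := by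
    intro i R hi
    have hR : R.card + 1 ≤ n := by
      have := Finset.card_le_univ (insert i R)
      rwa [Finset.card_insert_of_notMem hi, Fintype.card_fin] at this
    exact vertexEnergy_eq_of_card_eq hM p hi (hi₀ _ hR) (hT _ (by omega)).symm
  have hmono : ∀ j k, j ≤ k → q j ≤ q k := fun j k hjk =>
    vertexEnergy_mono hp0 hp1' hM0 hM1 _ fun a ha => by
      simp only [T, Finset.mem_filter, Finset.mem_univ, true_and] at ha ⊢
      omega
  have hb : ∀ j, q j ≤ (1 / p) ^ 2 := fun j =>
    energy_le_of_bound hw (sum_modelWeight M p) _ fun ω => abs_phi_le hp0 hp1 _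
  have h0 : 0 ≤ q 0 := Finset.sum_nonneg fun ω _ => mul_nonneg (hw ω).le (sq_nonneg _)
  have htel : ∑ j ∈ Finset.range J, (q ((j + 1) * s) - q (j * s)) = q (J * s) - q 0 := by
    rw [Finset.sum_range_sub (fun j => q (j * s))]; simp
  -- Pigeonhole: `J` successive increments of a nonnegative quantity bounded by (1/p)² cannot all
  -- exceed (1/p)²/J.
  obtain ⟨j, hj, hle⟩ := Finset.exists_le_of_sum_le (s := Finset.range J)
    (f := fun j => q ((j + 1) * s) - q (j * s)) (g := fun _ => (1 / p) ^ 2 / J)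
    ⟨0, Finset.mem_range.2 hJ⟩ (by
      rw [htel, Finset.sum_const, Finset.card_range, nsmul_eq_mul,
        mul_div_cancel₀ _ (by positivity : (J : ℝ) ≠ 0)]
      linarith [hb (J * s)])
  rw [Finset.mem_range] at hj
  have hjs : (j + 1) * s ≤ J * s := Nat.mul_le_mul_right s hj
  have hjs' : (j + 1) * s = j * s + s := by ring
  refine ⟨T (j * s), by rw [hT _ (by omega)]; omega, by rw [hT _ (by omega)]; omega, ?_⟩
  intro i T' hsub hi hcard
  rw [hT _ (by omega)] at hcard
  rw [hq i T' hi, hq i _ (fun h => hi (hsub h)), hT _ (by omega)]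
  have := hmono _ _ (hcard.trans hjs'.ge)
  linarith

end Decoupling

/-! ### Replacing the labels of the root's neighbours by posterior means. -/

section Root

variable {n : ℕ} {p θ ε : ℝ}

theorem abs_mul_phi_mul_phi_le (hp0 : 0 < p) (hp1 : p ≤ 1 / 2) (hε : |ε| / p ≤ 1 / 2)
    (k l : Fin 2) : |ε * phi p k * phi p l| ≤ 1 / 2 := by
  rw [mul_assoc, abs_mul]
  refine le_trans (mul_le_mul_of_nonneg_left (abs_phi_mul_phi_le hp0 hp1 k l) (abs_nonneg _)) ?_
  rwa [mul_one_div]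

theorem rankOne_pos (hp0 : 0 < p) (hp1 : p ≤ 1 / 2) (hε : |ε| / p ≤ 1 / 2) (h0 : 0 < θ)
    (k l : Fin 2) : 0 < rankOne p θ ε k l := by
  have := abs_le.1 (abs_mul_phi_mul_phi_le hp0 hp1 hε k l)
  exact mul_pos h0 (by linarith)

theorem rankOne_lt_one (hp0 : 0 < p) (hp1 : p ≤ 1 / 2) (hε : |ε| / p ≤ 1 / 2) (h0 : 0 < θ)
    (h1 : θ ≤ 1 / 2) (k l : Fin 2) : rankOne p θ ε k l < 1 := by
  have := abs_le.1 (abs_mul_phi_mul_phi_le hp0 hp1 hε k l)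
  have h2 : rankOne p θ ε k l = θ * (1 + ε * phi p k * phi p l) := rfl
  rw [h2]
  nlinarith

theorem rankOne_symm (p θ ε : ℝ) (k l : Fin 2) : rankOne p θ ε k l = rankOne p θ ε l k := by
  simp only [rankOne, Matrix.of_apply]; ring

/-- With u = ε φ(k) φ(x_j), use 1 - θ(1 + u) = (1 - θ)(1 - θ/(1 - θ) · u). The factor `bern` is free
of labels and serves as reference measure. -/
theorem rootLaw_rankOne (h1 : θ < 1) (k : Fin 2) (S : Finset (Fin n)) (x : Fin n → Fin 2) :
    rootLaw (rankOne p θ ε) k S x = bern θ Finset.univ S *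
      subsetLik θ Finset.univ (fun j => ε * phi p k * phi p (x j)) S := by
  classical
  have h2 : 1 - θ ≠ 0 := by linarith
  rw [rootLaw, Finset.prod_ite, bern, subsetLik, mul_mul_mul_comm, ← Finset.prod_const,
    ← Finset.prod_const, ← Finset.prod_mul_distrib, ← Finset.prod_mul_distrib]
  congr 1
  · refine Finset.prod_congr (by ext; simp) fun j _ => ?_
    simp [rankOne]
  · refine Finset.prod_congr (by ext; simp) fun j _ => ?_
    simp only [rankOne, Matrix.of_apply]
    field_simp
    ring

theorem subsetLik_pos {ι : Type*} [DecidableEq ι] (h0 : 0 ≤ θ) (h1 : θ ≤ 1 / 2) {u : ι → ℝ}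
    (hu : ∀ j, |u j| ≤ 1 / 2) (I S : Finset ι) : 0 < subsetLik θ I u S := by
  refine mul_pos (Finset.prod_pos fun j _ => ?_) (Finset.prod_pos fun j _ => ?_)
  · linarith [(abs_le.1 (hu j)).1]
  · have h2 : θ / (1 - θ) ≤ 1 := by rw [div_le_one (by linarith)]; linarith
    have h3 : 0 ≤ θ / (1 - θ) := div_nonneg h0 (by linarith)
    have := abs_le.1 (hu j)
    nlinarith

theorem potential_smul (p β a₀ a₁ : ℝ) :
    potential p (β * a₀) (β * a₁) = β * potential p a₀ a₁ := by
  by_cases h : β = 0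
  · simp [h, potential]
  · have e1 : p * (1 - p) * (β * a₀ - β * a₁) ^ 2 = β * (β * (p * (1 - p) * (a₀ - a₁) ^ 2)) := by
      ring
    have e2 : p * (β * a₀) + (1 - p) * (β * a₁) = β * (p * a₀ + (1 - p) * a₁) := by ring
    rw [potential, potential, e1, e2, mul_div_mul_left _ _ h, mul_div_assoc]

/-- The expected error made when the neighbours of the root are treated as independent given the
observation, with their posterior means in place of their labels. -/
theorem sum_abs_condMean_subsetLik_sub_le {d : ℝ} (hp0 : 0 < p) (hp1 : p ≤ 1 / 2)
    (hε : |ε| / p ≤ 1 / 2) (h0 : 0 < θ) (h1 : θ ≤ 1 / 2) (hd : θ * n ≤ d)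
    (R : Finset (Fin n)) {s : ℕ} {Δ : ℝ}
    (hΔ : ∀ i, ∀ T : Finset (Fin n), R ⊆ T → i ∉ T → T.card ≤ R.card + s →
      vertexEnergy (rankOne p θ ε) p i T - vertexEnergy (rankOne p θ ε) p i R ≤ Δ) (k : Fin 2) :
    ∑ ω, modelWeight (rankOne p θ ε) p ω * ∑ S : Finset (Fin n), bern θ Finset.univ S *
      |condMean (modelWeight (rankOne p θ ε) p) (obs R)
        (fun ω => subsetLik θ Finset.univ (fun j => ε * phi p k * phi p (ω.1 j)) S) ω -
        subsetLik θ Finset.univ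
          (fun j => ε * phi p k * vertexMean (rankOne p θ ε) p R j ω) S| ≤
      2 * (Real.exp (5 * d) * θ * (√n + 1 + d)) + Real.exp (3 * d) * (√Δ + 2 / 2 ^ s) := by
  classical
  set M := rankOne p θ ε
  have hp1' : p < 1 := by linarith
  have hM0 : ∀ k l, 0 < M k l := rankOne_pos hp0 hp1 hε h0
  have hM1 : ∀ k l, M k l < 1 := rankOne_lt_one hp0 hp1 hε h0 h1
  have hw := modelWeight_pos (n := n) hp0 hp1' hM0 hM1
  set w := modelWeight (n := n) M p
  set c := ε * phi p k with hc
  have hcφ : ∀ l, |c * phi p l| ≤ 1 / 2 := abs_mul_phi_mul_phi_le hp0 hp1 hε k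
  have hc2 : |c| ≤ 1 / 2 := by
    rw [hc, abs_mul]
    refine le_trans (mul_le_mul_of_nonneg_left (abs_phi_le hp0 hp1 k) (abs_nonneg _)) ?_
    rwa [mul_one_div]
  set m := vertexMean M p R with hm
  have hcm : ∀ j ω, |c * m j ω| ≤ 1 / 2 := fun j ω => by
    rw [hm, vertexMean, ← condMean_const_mul]
    exact abs_condMean_le_of_bound hw (obs R) (fun ω => hcφ _) ω
  set LX : Finset (Fin n) → (Fin n → Fin 2) × SimpleGraph (Fin n) → ℝ :=
    fun S ω => subsetLik θ Finset.univ (fun j => c * phi p (ω.1 j)) S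
  set EX : Finset (Fin n) → (Fin n → Fin 2) × SimpleGraph (Fin n) → ℝ :=
    fun S ω => ∏ j ∈ S, (1 + c * phi p (ω.1 j)) with hEX
  set Lm : Finset (Fin n) → (Fin n → Fin 2) × SimpleGraph (Fin n) → ℝ :=
    fun S ω => subsetLik θ Finset.univ (fun j => c * m j ω) S
  set Em : Finset (Fin n) → (Fin n → Fin 2) × SimpleGraph (Fin n) → ℝ :=
    fun S ω => ∏ j ∈ S, (1 + c * m j ω) with hEm
  have hb : ∀ S : Finset (Fin n), 0 ≤ bern θ Finset.univ S :=
    bern_nonneg h0.le (by linarith) _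
  have hcard : θ * (Finset.univ : Finset (Fin n)).card ≤ d := by simpa using hd
  have hd0 : 0 ≤ d := le_trans (by positivity) hd
  -- Three moves: drop the non-edge factors with the true labels, decouple the remaining finite
  -- product, then restore the non-edge factors with the posterior means. Restoring them makes the
  -- result a product over all vertices, as the edge-by-edge exchange requires.
  have htri : ∀ S ω, |condMean w (obs R) (LX S) ω - Lm S ω| ≤
      condMean w (obs R) (fun ω => |LX S ω - EX S ω|) ω +
        |condMean w (obs R) (EX S) ω - Em S ω| + |Lm S ω - Em S ω| := by
    intro S ω
    have h2 := abs_condMean_le hw (obs R) (fun ω => LX S ω - EX S ω) ω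
    rw [condMean_sub] at h2
    have h3 : condMean w (obs R) (LX S) ω - Lm S ω =
        (condMean w (obs R) (LX S) ω - condMean w (obs R) (EX S) ω) +
        (condMean w (obs R) (EX S) ω - Em S ω) - (Lm S ω - Em S ω) := by ring
    rw [h3]
    exact (abs_sub _ _).trans (by linarith [abs_add_le (condMean w (obs R) (LX S) ω -
      condMean w (obs R) (EX S) ω) (condMean w (obs R) (EX S) ω - Em S ω)])
  have hfun : ∀ (u : Fin n → (Fin n → Fin 2) × SimpleGraph (Fin n) → ℝ),
      (∀ j ω, |c * u j ω| ≤ 1 / 2) → ∑ ω, w ω * |∑ j, u j ω| ≤ √n →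
      ∑ ω, w ω * ∑ S : Finset (Fin n), bern θ Finset.univ S *
        |subsetLik θ Finset.univ (fun j => c * u j ω) S - ∏ j ∈ S, (1 + c * u j ω)| ≤
        Real.exp (5 * d) * θ * (√n + 1 + d) := by
    intro u hu hs
    have h2 : ∀ ω, ∑ S : Finset (Fin n), bern θ Finset.univ S *
        |subsetLik θ Finset.univ (fun j => c * u j ω) S - ∏ j ∈ S, (1 + c * u j ω)| ≤
        Real.exp (5 * d) * θ * (|∑ j, u j ω| + 1 + d) := by
      intro ω
      have h3 := sum_bern_nonedge_le h0 h1 Finset.univ hcard (u := fun j => c * u j ω)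
        (fun j => hu j ω)
      rw [Finset.powerset_univ] at h3
      refine h3.trans (mul_le_mul_of_nonneg_left ?_ (by positivity))
      rw [← Finset.mul_sum, abs_mul]
      nlinarith [abs_nonneg (∑ j, u j ω)]
    calc _ ≤ ∑ ω, w ω * (Real.exp (5 * d) * θ * (|∑ j, u j ω| + 1 + d)) :=
          Finset.sum_le_sum fun ω _ => mul_le_mul_of_nonneg_left (h2 ω) (hw ω).le
      _ = Real.exp (5 * d) * θ * (∑ ω, w ω * |∑ j, u j ω|) +
            Real.exp (5 * d) * θ * (1 + d) * ∑ ω, w ω := by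
          rw [Finset.mul_sum, Finset.mul_sum, ← Finset.sum_add_distrib]
          exact Finset.sum_congr rfl fun ω _ => by ring
      _ ≤ Real.exp (5 * d) * θ * √n + Real.exp (5 * d) * θ * (1 + d) * 1 := by
          refine add_le_add (mul_le_mul_of_nonneg_left hs (by positivity)) (le_of_eq ?_)
          rw [sum_modelWeight M p]
      _ = _ := by ring
  have hA := hfun (fun j ω => phi p (ω.1 j)) (fun j ω => hcφ _)
    (sum_abs_sum_phi_le hp0 hp1' hM0 hM1 n)
  have hC := hfun m hcm (sum_abs_sum_vertexMean_le hp0 hp1' hM0 hM1 R)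
  have hB : ∀ S : Finset (Fin n), ∑ ω, w ω * |condMean w (obs R) (EX S) ω - Em S ω| ≤
      4 ^ S.card * (√Δ + 2 / 2 ^ s) := by
    intro S
    by_cases hS : S.card ≤ s
    · refine (sum_abs_condMean_prod_sub_le hp0 hp1' hM0 hM1 R hΔ (by linarith)
        (fun k => (hcφ k).trans (by norm_num)) S hS).trans
        (mul_le_mul_of_nonneg_left ?_ (by positivity))
      have : (0 : ℝ) ≤ 2 / 2 ^ s := by positivity
      linarith
    -- For neighbourhoods larger than the pinning budget `s` the crude bound suffices, since |S| > s
    -- gives 2 · 2^|S| ≤ 4^|S| · 2/2^s.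
    · have h2 : ∀ ω, |condMean w (obs R) (EX S) ω - Em S ω| ≤ 2 * 2 ^ S.card := by
        intro ω
        have h3 := abs_condMean_le_of_bound hw (obs R) (f := EX S) (fun ω =>
          abs_prod_one_add_le (fun j => (hcφ (ω.1 j)).trans (by norm_num)) S) ω
        have h4 : |Em S ω| ≤ 2 ^ S.card :=
          abs_prod_one_add_le (fun j => (hcm j ω).trans (by norm_num)) S
        exact (abs_sub _ _).trans (by linarith)
      have h5 : (2 : ℝ) ^ s ≤ 2 ^ S.card := pow_le_pow_right₀ (by norm_num) (by omega)
      have h6 : (2 : ℝ) * 2 ^ S.card ≤ 4 ^ S.card * (2 / 2 ^ s) := by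
        have h7 : (4 : ℝ) ^ S.card = 2 ^ S.card * 2 ^ S.card := by rw [← mul_pow]; norm_num
        rw [h7, mul_div_assoc', le_div_iff₀ (by positivity)]
        have : (0 : ℝ) < 2 ^ S.card := by positivity
        nlinarith
      calc _ ≤ ∑ ω, w ω * (2 * 2 ^ S.card) :=
            Finset.sum_le_sum fun ω _ => mul_le_mul_of_nonneg_left (h2 ω) (hw ω).le
        _ = 2 * 2 ^ S.card := by rw [← Finset.sum_mul, sum_modelWeight M p, one_mul]
        _ ≤ 4 ^ S.card * (2 / 2 ^ s) := h6
        _ ≤ _ := mul_le_mul_of_nonneg_left (by linarith [Real.sqrt_nonneg Δ]) (by positivity)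
  have hB' : ∑ ω, w ω * ∑ S : Finset (Fin n), bern θ Finset.univ S *
      |condMean w (obs R) (EX S) ω - Em S ω| ≤ Real.exp (3 * d) * (√Δ + 2 / 2 ^ s) := by
    simp only [Finset.mul_sum]
    rw [Finset.sum_comm]
    have h2 : ∀ S : Finset (Fin n), ∑ ω, w ω * (bern θ Finset.univ S *
        |condMean w (obs R) (EX S) ω - Em S ω|) ≤
        (bern θ Finset.univ S * 4 ^ S.card) * (√Δ + 2 / 2 ^ s) := by
      intro S
      rw [mul_assoc]
      refine le_trans (le_of_eq ?_) (mul_le_mul_of_nonneg_left (hB S) (hb S))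
      rw [Finset.mul_sum]
      exact Finset.sum_congr rfl fun ω _ => by ring
    refine (Finset.sum_le_sum fun S _ => h2 S).trans ?_
    rw [← Finset.sum_mul]
    have h3 := sum_bern_mul_pow_le h0.le (by norm_num : (1 : ℝ) ≤ 4) Finset.univ hcard
    rw [Finset.powerset_univ] at h3
    norm_num at h3 ⊢
    exact mul_le_mul_of_nonneg_right h3 (by positivity)
  have hA' : ∑ ω, w ω * ∑ S : Finset (Fin n), bern θ Finset.univ S *
      condMean w (obs R) (fun ω => |LX S ω - EX S ω|) ω ≤
      Real.exp (5 * d) * θ * (√n + 1 + d) := by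
    refine le_trans (le_of_eq ?_) hA
    simp only [Finset.mul_sum]
    rw [Finset.sum_comm, Finset.sum_comm (s := Finset.univ (α := (Fin n → Fin 2) × _))]
    refine Finset.sum_congr rfl fun S _ => ?_
    have h2 := sum_condMean hw (obs R) (fun ω => |LX S ω - EX S ω|)
    simp only [mul_left_comm _ (bern θ Finset.univ S), ← Finset.mul_sum]
    rw [h2]
  calc _ ≤ ∑ ω, w ω * ∑ S : Finset (Fin n), bern θ Finset.univ S *
        (condMean w (obs R) (fun ω => |LX S ω - EX S ω|) ω +
        |condMean w (obs R) (EX S) ω - Em S ω| + |Lm S ω - Em S ω|) :=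
        Finset.sum_le_sum fun ω _ => mul_le_mul_of_nonneg_left
          (Finset.sum_le_sum fun S _ => mul_le_mul_of_nonneg_left (htri S ω) (hb S)) (hw ω).le
    _ = ∑ ω, w ω * ∑ S : Finset (Fin n), bern θ Finset.univ S *
        condMean w (obs R) (fun ω => |LX S ω - EX S ω|) ω +
        ∑ ω, w ω * ∑ S : Finset (Fin n), bern θ Finset.univ S *
        |condMean w (obs R) (EX S) ω - Em S ω| +
        ∑ ω, w ω * ∑ S : Finset (Fin n), bern θ Finset.univ S * |Lm S ω - Em S ω| := by
        simp only [mul_add, Finset.sum_add_distrib]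
    _ ≤ _ := by
        have hC' : ∑ ω, w ω * ∑ S : Finset (Fin n), bern θ Finset.univ S * |Lm S ω - Em S ω| ≤
          Real.exp (5 * d) * θ * (√n + 1 + d) := hC
        linarith

/-- By `abs_potential_sub_le`, changing the likelihoods costs 3 / p² times their L¹ distance for
each of the two root labels, whence 6 / p². -/
theorem vertexEnergy_root_le {d : ℝ} (hp0 : 0 < p) (hp1 : p ≤ 1 / 2)
    (hε : |ε| / p ≤ 1 / 2) (h0 : 0 < θ) (h1 : θ ≤ 1 / 2) (hd : θ * n ≤ d)
    (R : Finset (Fin n)) {s : ℕ} {Δ : ℝ}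
    (hΔ : ∀ i, ∀ T : Finset (Fin n), R ⊆ T → i ∉ T → T.card ≤ R.card + s →
      vertexEnergy (rankOne p θ ε) p i T - vertexEnergy (rankOne p θ ε) p i R ≤ Δ) :
    vertexEnergy (rankOne p θ ε) p 0 (R.map (Fin.succEmb n)) ≤
      ∑ ω, modelWeight (rankOne p θ ε) p ω * ∑ S : Finset (Fin n), bern θ Finset.univ S *
        potential p
          (subsetLik θ Finset.univ
            (fun j => ε * phi p 0 * vertexMean (rankOne p θ ε) p R j ω) S)
          (subsetLik θ Finset.univ
            (fun j => ε * phi p 1 * vertexMean (rankOne p θ ε) p R j ω) S) +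
      6 / p ^ 2 * (2 * (Real.exp (5 * d) * θ * (√n + 1 + d)) +
        Real.exp (3 * d) * (√Δ + 2 / 2 ^ s)) := by
  classical
  have hp1' : p < 1 := by linarith
  have hM0 := rankOne_pos hp0 hp1 hε h0
  have hM1 := rankOne_lt_one hp0 hp1 hε h0 h1
  have hw := modelWeight_pos (n := n) hp0 hp1' hM0 hM1
  have herr := sum_abs_condMean_subsetLik_sub_le hp0 hp1 hε h0 h1 hd R hΔ
  set E := 2 * (Real.exp (5 * d) * θ * (√n + 1 + d)) + Real.exp (3 * d) * (√Δ + 2 / 2 ^ s)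
  set M := rankOne p θ ε
  set w := modelWeight (n := n) M p
  set m := vertexMean M p R with hm
  have hcm : ∀ k j ω, |ε * phi p k * m j ω| ≤ 1 / 2 := fun k j ω => by
    rw [hm, vertexMean, ← condMean_const_mul]
    exact abs_condMean_le_of_bound hw (obs R)
      (fun ω => abs_mul_phi_mul_phi_le hp0 hp1 hε k _) ω
  set LX : Fin 2 → Finset (Fin n) → (Fin n → Fin 2) × SimpleGraph (Fin n) → ℝ :=
    fun k S ω => condMean w (obs R)
      (fun ω => subsetLik θ Finset.univ (fun j => ε * phi p k * phi p (ω.1 j)) S) ω with hLX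
  set Lm : Fin 2 → Finset (Fin n) → (Fin n → Fin 2) × SimpleGraph (Fin n) → ℝ :=
    fun k S ω => subsetLik θ Finset.univ (fun j => ε * phi p k * m j ω) S
  have hLXpos : ∀ k S ω, 0 < LX k S ω := fun k S ω => condMean_pos hw _
    (fun ω => subsetLik_pos h0.le h1 (fun j => abs_mul_phi_mul_phi_le hp0 hp1 hε k _) _ _) ω
  have hLmpos : ∀ k S ω, 0 < Lm k S ω := fun k S ω => subsetLik_pos h0.le h1 (hcm k · ω) _ _
  have hb : ∀ S : Finset (Fin n), 0 ≤ bern θ Finset.univ S :=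
    bern_nonneg h0.le (by linarith) _
  have hrw : ∀ k S ω, condMean w (obs R) (fun ω => rootLaw M k S ω.1) ω
      = bern θ Finset.univ S * LX k S ω := by
    intro k S ω
    simp only [M, rootLaw_rankOne (by linarith : θ < 1)]
    exact condMean_const_mul _ _ _ _ _
  rw [vertexEnergy_zero hp0 hp1' hM0 hM1 R]
  have hterm : ∀ ω S, (∑ k, labelProb p k * phi p k *
      condMean w (obs R) (fun ω => rootLaw M k S ω.1) ω) ^ 2 /
      ∑ k, labelProb p k * condMean w (obs R) (fun ω => rootLaw M k S ω.1) ω ≤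
      bern θ Finset.univ S * potential p (Lm 0 S ω) (Lm 1 S ω) +
      3 / p ^ 2 * ∑ k, bern θ Finset.univ S * |LX k S ω - Lm k S ω| := by
    intro ω S
    rw [potential_eq hp0 hp1' (fun k => condMean w (obs R) (fun ω => rootLaw M k S ω.1) ω),
      hrw, hrw, potential_smul, Fin.sum_univ_two, ← mul_add, mul_left_comm, ← mul_add]
    refine mul_le_mul_of_nonneg_left ?_ (hb S)
    have := abs_potential_sub_le hp0 hp1 (hLXpos 0 S ω) (hLXpos 1 S ω) (hLmpos 0 S ω)
      (hLmpos 1 S ω)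
    linarith [le_abs_self (potential p (LX 0 S ω) (LX 1 S ω) - potential p (Lm 0 S ω) (Lm 1 S ω))]
  calc _ ≤ ∑ ω, w ω * ∑ S : Finset (Fin n),
        (bern θ Finset.univ S * potential p (Lm 0 S ω) (Lm 1 S ω) +
        3 / p ^ 2 * ∑ k, bern θ Finset.univ S * |LX k S ω - Lm k S ω|) :=
        Finset.sum_le_sum fun ω _ => mul_le_mul_of_nonneg_left
          (Finset.sum_le_sum fun S _ => hterm ω S) (hw ω).le
    _ = ∑ ω, w ω * ∑ S : Finset (Fin n),
        bern θ Finset.univ S * potential p (Lm 0 S ω) (Lm 1 S ω) +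
        3 / p ^ 2 * ∑ k, ∑ ω, w ω * ∑ S : Finset (Fin n),
          bern θ Finset.univ S * |LX k S ω - Lm k S ω| := by
        simp only [Fin.sum_univ_two, Finset.sum_add_distrib, mul_add, Finset.mul_sum]
        congr 2 <;> refine Finset.sum_congr rfl fun ω _ => Finset.sum_congr rfl fun S _ => ?_ <;>
          ring
    _ ≤ _ := by
        refine add_le_add le_rfl ?_
        rw [Fin.sum_univ_two]
        have h2 := herr 0
        have h3 := herr 1
        have h4 : 6 / p ^ 2 * E = 3 / p ^ 2 * (E + E) := by ring
        rw [h4]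
        exact mul_le_mul_of_nonneg_left (add_le_add h2 h3) (by positivity)

end Root

/-! ### Second-order expansion of the potential. -/

/-- Homogeneity of degree one makes the Hessian vanish along (a₀, a₁), so beyond the linear terms
only s₀ - s₁ enters. The identity is exact: all higher orders sit in the denominator, one plus a
weighted mean of s₀ and s₁. -/
theorem potential_expand {p a₀ a₁ s₀ s₁ : ℝ} (hp0 : 0 < p) (hp1 : p < 1) (ha₀ : 0 < a₀)
    (ha₁ : 0 < a₁) (hs₀ : 0 < 1 + s₀) (hs₁ : 0 < 1 + s₁) :
    potential p (a₀ * (1 + s₀)) (a₁ * (1 + s₁)) = potential p a₀ a₁ +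
      p * (1 - p) * a₀ * (2 * (a₀ - a₁) / (p * a₀ + (1 - p) * a₁) -
        p * (a₀ - a₁) ^ 2 / (p * a₀ + (1 - p) * a₁) ^ 2) * s₀ +
      -(p * (1 - p) * a₁ * (2 * (a₀ - a₁) / (p * a₀ + (1 - p) * a₁) +
        (1 - p) * (a₀ - a₁) ^ 2 / (p * a₀ + (1 - p) * a₁) ^ 2)) * s₁ +
      p * (1 - p) * a₀ ^ 2 * a₁ ^ 2 / (p * a₀ + (1 - p) * a₁) ^ 3 * ((s₀ - s₁) ^ 2 /
        (1 + (p * a₀ * s₀ + (1 - p) * a₁ * s₁) / (p * a₀ + (1 - p) * a₁))) := by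
  have hq : 0 < 1 - p := by linarith
  have hT : 0 < p * a₀ + (1 - p) * a₁ := by positivity
  have hT' : 0 < p * (a₀ * (1 + s₀)) + (1 - p) * (a₁ * (1 + s₁)) := by positivity
  have h1 : 1 + (p * a₀ * s₀ + (1 - p) * a₁ * s₁) / (p * a₀ + (1 - p) * a₁) =
      (p * (a₀ * (1 + s₀)) + (1 - p) * (a₁ * (1 + s₁))) / (p * a₀ + (1 - p) * a₁) := by
    field_simp; ring
  rw [h1, potential, potential]
  field_simp
  ring

theorem potential_nonneg {p a₀ a₁ : ℝ} (hp0 : 0 < p) (hp1 : p < 1) (ha₀ : 0 < a₀) (ha₁ : 0 < a₁) :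
    0 ≤ potential p a₀ a₁ := by
  have hq : 0 < 1 - p := by linarith
  unfold potential
  positivity

theorem potential_le {p a₀ a₁ : ℝ} (hp0 : 0 < p) (hp1 : p < 1) (ha₀ : 0 < a₀) (ha₁ : 0 < a₁) :
    potential p a₀ a₁ ≤ a₀ + a₁ := by
  have hq : 0 < 1 - p := by linarith
  have hT : 0 < p * a₀ + (1 - p) * a₁ := by positivity
  rw [potential, div_le_iff₀ hT]
  have e : (a₀ + a₁) * (p * a₀ + (1 - p) * a₁) - p * (1 - p) * (a₀ - a₁) ^ 2
      = p * p * a₀ ^ 2 + (1 - p) * (1 - p) * a₁ ^ 2 + (1 + 2 * p * (1 - p)) * (a₀ * a₁) := by ring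
  have : 0 ≤ p * p * a₀ ^ 2 + (1 - p) * (1 - p) * a₁ ^ 2 + (1 + 2 * p * (1 - p)) * (a₀ * a₁) := by
    positivity
  linarith

/-- The coefficient of the quadratic term of `potential`. -/
noncomputable def curvature (p a₀ a₁ : ℝ) : ℝ :=
  p * (1 - p) * a₀ ^ 2 * a₁ ^ 2 / (p * a₀ + (1 - p) * a₁) ^ 3

theorem curvature_nonneg {p a₀ a₁ : ℝ} (hp0 : 0 < p) (hp1 : p < 1) (ha₀ : 0 < a₀) (ha₁ : 0 < a₁) :
    0 ≤ curvature p a₀ a₁ := by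
  have hq : 0 < 1 - p := by linarith
  unfold curvature
  positivity

theorem curvature_le {p a₀ a₁ : ℝ} (hp0 : 0 < p) (hp1 : p < 1) (ha₀ : 0 < a₀) (ha₁ : 0 < a₁) :
    curvature p a₀ a₁ ≤ (a₀ + a₁) / p := by
  have hq : 0 < 1 - p := by linarith
  have hT : 0 < p * a₀ + (1 - p) * a₁ := by positivity
  set T := p * a₀ + (1 - p) * a₁ with hTd
  have h1 : p * a₀ ≤ T := by rw [hTd]; nlinarith [mul_pos hq ha₁]
  have h2 : (1 - p) * a₁ ≤ T := by rw [hTd]; nlinarith [mul_pos hp0 ha₀]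
  rw [curvature, div_le_div_iff₀ (by positivity) hp0]
  have h3 : (p * a₀) * (p * a₀) * ((1 - p) * a₁) ≤ T * T * T :=
    mul_le_mul (mul_le_mul h1 h1 (by positivity) hT.le) h2 (by positivity) (by positivity)
  calc p * (1 - p) * a₀ ^ 2 * a₁ ^ 2 * p = (p * a₀) * (p * a₀) * ((1 - p) * a₁) * a₁ := by ring
    _ ≤ T * T * T * a₁ := mul_le_mul_of_nonneg_right h3 ha₁.le
    _ ≤ T * T * T * (a₀ + a₁) := mul_le_mul_of_nonneg_left (by linarith) (by positivity)
    _ = (a₀ + a₁) * T ^ 3 := by ring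

theorem abs_weighted_mean_le {p a₀ a₁ s₀ s₁ : ℝ} (hp0 : 0 < p) (hp1 : p < 1) (ha₀ : 0 < a₀)
    (ha₁ : 0 < a₁) : |(p * a₀ * s₀ + (1 - p) * a₁ * s₁) / (p * a₀ + (1 - p) * a₁)| ≤
      max |s₀| |s₁| := by
  have hq : 0 < 1 - p := by linarith
  have hT : 0 < p * a₀ + (1 - p) * a₁ := by positivity
  rw [abs_div, abs_of_pos hT, div_le_iff₀ hT]
  refine (abs_add_le _ _).trans ?_
  rw [abs_mul (p * a₀), abs_mul ((1 - p) * a₁), abs_of_pos (mul_pos hp0 ha₀),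
    abs_of_pos (mul_pos hq ha₁)]
  have h1 := mul_le_mul_of_nonneg_left (le_max_left |s₀| |s₁|) (mul_pos hp0 ha₀).le
  have h2 := mul_le_mul_of_nonneg_left (le_max_right |s₀| |s₁|) (mul_pos hq ha₁).le
  linarith

/-- The second-order expansion of `potential` under small multiplicative perturbations and under
arbitrary ones, with common coefficients. -/
theorem exists_potential_bounds {p a₀ a₁ : ℝ} (hp0 : 0 < p) (hp1 : p < 1) (ha₀ : 0 < a₀)
    (ha₁ : 0 < a₁) : ∃ c₀ c₁ : ℝ,
    (∀ s₀ s₁ X : ℝ, X ≤ 1 / 2 → |s₀| ≤ X → |s₁| ≤ X →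
      potential p (a₀ * (1 + s₀)) (a₁ * (1 + s₁)) ≤ potential p a₀ a₁ + c₀ * s₀ + c₁ * s₁ +
        curvature p a₀ a₁ * ((1 + 2 * X) * (s₀ - s₁) ^ 2)) ∧
    (∀ s₀ s₁ η : ℝ, 0 < 1 + s₀ → 0 < 1 + s₁ → 0 < η →
      potential p a₀ a₁ + c₀ * s₀ + c₁ * s₁ +
        curvature p a₀ a₁ * ((1 - η / 2) * (s₀ - s₁) ^ 2 - 2 / η * (s₀ ^ 4 + s₁ ^ 4)) ≤
      potential p (a₀ * (1 + s₀)) (a₁ * (1 + s₁))) := by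
  refine ⟨p * (1 - p) * a₀ * (2 * (a₀ - a₁) / (p * a₀ + (1 - p) * a₁) -
        p * (a₀ - a₁) ^ 2 / (p * a₀ + (1 - p) * a₁) ^ 2),
      -(p * (1 - p) * a₁ * (2 * (a₀ - a₁) / (p * a₀ + (1 - p) * a₁) +
        (1 - p) * (a₀ - a₁) ^ 2 / (p * a₀ + (1 - p) * a₁) ^ 2)), ?_, ?_⟩
  · intro s₀ s₁ X hX h0 h1
    have h0' := abs_le.1 h0
    have h1' := abs_le.1 h1
    rw [potential_expand hp0 hp1 ha₀ ha₁ (by linarith) (by linarith)]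
    refine add_le_add le_rfl (mul_le_mul_of_nonneg_left ?_ (curvature_nonneg hp0 hp1 ha₀ ha₁))
    have hτ := abs_le.1 ((abs_weighted_mean_le (s₀ := s₀) (s₁ := s₁) hp0 hp1 ha₀ ha₁).trans
      (max_le h0 h1))
    set τ := (p * a₀ * s₀ + (1 - p) * a₁ * s₁) / (p * a₀ + (1 - p) * a₁)
    rw [div_le_iff₀ (by linarith)]
    have hX0 : 0 ≤ X := (abs_nonneg _).trans h0
    -- As τ ≥ -X and X ≤ 1/2, the product is at least (1 + 2X)(1 - X) ≥ 1.
    have h2 : 1 ≤ (1 + 2 * X) * (1 + τ) := by nlinarith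
    nlinarith [sq_nonneg (s₀ - s₁)]
  · intro s₀ s₁ η h0 h1 hη
    rw [potential_expand hp0 hp1 ha₀ ha₁ h0 h1]
    refine add_le_add le_rfl (mul_le_mul_of_nonneg_left ?_ (curvature_nonneg hp0 hp1 ha₀ ha₁))
    have hτ := abs_weighted_mean_le (s₀ := s₀) (s₁ := s₁) hp0 hp1 ha₀ ha₁
    have hq : 0 < 1 - p := by linarith
    have hT : 0 < p * a₀ + (1 - p) * a₁ := by positivity
    have hτ1 : 0 < 1 + (p * a₀ * s₀ + (1 - p) * a₁ * s₁) / (p * a₀ + (1 - p) * a₁) := by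
      have : 1 + (p * a₀ * s₀ + (1 - p) * a₁ * s₁) / (p * a₀ + (1 - p) * a₁) =
        (p * a₀ * (1 + s₀) + (1 - p) * a₁ * (1 + s₁)) / (p * a₀ + (1 - p) * a₁) := by
          field_simp; ring
      rw [this]; positivity
    set τ := (p * a₀ * s₀ + (1 - p) * a₁ * s₁) / (p * a₀ + (1 - p) * a₁)
    have hτ2 : τ ^ 2 ≤ s₀ ^ 2 + s₁ ^ 2 := by
      rw [← sq_abs τ, ← sq_abs s₀, ← sq_abs s₁]
      rcases le_total |s₀| |s₁| with h | h
      · rw [max_eq_right h] at hτ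
        nlinarith [abs_nonneg τ, sq_nonneg |s₀|]
      · rw [max_eq_left h] at hτ
        nlinarith [abs_nonneg τ, sq_nonneg |s₁|]
    -- Here τ is unbounded above, as Gaussian factors require, so 1/(1 + τ) ≥ 1 - τ is used. The
    -- term linear in τ is then split by Young's inequality with the free parameter η, leaving a
    -- fourth-order remainder.
    have h2 : (s₀ - s₁) ^ 2 * (1 - τ) ≤ (s₀ - s₁) ^ 2 / (1 + τ) := by
      rw [le_div_iff₀ hτ1]
      nlinarith [mul_nonneg (sq_nonneg (s₀ - s₁)) (sq_nonneg τ)]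
    refine le_trans ?_ h2
    have h3 : τ ≤ η / 2 + τ ^ 2 / (2 * η) := by
      have : η / 2 + τ ^ 2 / (2 * η) - τ = (η - τ) ^ 2 / (2 * η) := by field_simp; ring
      have h4 : 0 ≤ (η - τ) ^ 2 / (2 * η) := by positivity
      linarith
    have h5 : (s₀ - s₁) ^ 2 * τ ^ 2 ≤ 4 * (s₀ ^ 4 + s₁ ^ 4) := by
      have h6 : (s₀ - s₁) ^ 2 ≤ 2 * (s₀ ^ 2 + s₁ ^ 2) := by nlinarith [sq_nonneg (s₀ + s₁)]
      have h7 := mul_le_mul h6 hτ2 (sq_nonneg _) (by positivity)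
      nlinarith [sq_nonneg (s₀ ^ 2 - s₁ ^ 2)]
    have h8 := mul_le_mul_of_nonneg_left h3 (sq_nonneg (s₀ - s₁))
    have h9 : (s₀ - s₁) ^ 2 * (τ ^ 2 / (2 * η)) ≤ 2 / η * (s₀ ^ 4 + s₁ ^ 4) := by
      have : (s₀ - s₁) ^ 2 * (τ ^ 2 / (2 * η)) = (s₀ - s₁) ^ 2 * τ ^ 2 / (2 * η) := by ring
      rw [this, div_le_iff₀ (by positivity)]
      refine h5.trans (le_of_eq ?_)
      field_simp; ring
    linarith

/-! ### The Gaussian channel and its moments. -/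

/-- The likelihood of the label `k` under a Gaussian observation of variance `v`. -/
noncomputable def gaussFactor (p : ℝ) (k : Fin 2) (v : ℝ≥0) (y : ℝ) : ℝ :=
  Real.exp (phi p k * y - phi p k ^ 2 * v / 2)

/-- The average of `potential` after a Gaussian observation of variance `v`. -/
noncomputable def gaussOp (p : ℝ) (v : ℝ≥0) (a₀ a₁ : ℝ) : ℝ :=
  ∫ y, potential p (a₀ * gaussFactor p 0 v y) (a₁ * gaussFactor p 1 v y) ∂gaussianReal 0 v

theorem gaussFactor_pos (p : ℝ) (k : Fin 2) (v : ℝ≥0) (y : ℝ) : 0 < gaussFactor p k v y :=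
  Real.exp_pos _

theorem gaussFactor_mul (p : ℝ) (k : Fin 2) (v w : ℝ≥0) (x y : ℝ) :
    gaussFactor p k v x * gaussFactor p k w y = gaussFactor p k (v + w) (x + y) := by
  rw [gaussFactor, gaussFactor, gaussFactor, ← Real.exp_add]
  congr 1; push_cast; ring

theorem integrable_exp_gaussianReal (v : ℝ≥0) (t c : ℝ) :
    Integrable (fun y => Real.exp (t * y - c)) (gaussianReal 0 v) := by
  simp only [Real.exp_sub]
  exact (integrable_exp_mul_gaussianReal t).div_const _

theorem integral_exp_gaussianReal (v : ℝ≥0) (t c : ℝ) :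
    ∫ y, Real.exp (t * y - c) ∂gaussianReal 0 v = Real.exp (v * t ^ 2 / 2 - c) := by
  simp only [Real.exp_sub]
  rw [integral_div]
  congr 1
  have := congrFun (mgf_fun_id_gaussianReal (μ := 0) (v := v)) t
  simpa [mgf] using this

theorem integrable_gaussFactor (p : ℝ) (k : Fin 2) (v : ℝ≥0) :
    Integrable (gaussFactor p k v) (gaussianReal 0 v) :=
  integrable_exp_gaussianReal v _ _

theorem integral_gaussFactor (p : ℝ) (k : Fin 2) (v : ℝ≥0) :
    ∫ y, gaussFactor p k v y ∂gaussianReal 0 v = 1 := by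
  simp only [gaussFactor]
  rw [integral_exp_gaussianReal, Real.exp_eq_one_iff]
  ring

theorem continuous_gaussFactor (p : ℝ) (k : Fin 2) (v : ℝ≥0) : Continuous (gaussFactor p k v) := by
  unfold gaussFactor; fun_prop

theorem continuous_potential_gaussFactor {p : ℝ} (hp0 : 0 < p) (hp1 : p < 1) (v : ℝ≥0) {a₀ a₁ : ℝ}
    (ha₀ : 0 < a₀) (ha₁ : 0 < a₁) :
    Continuous fun y => potential p (a₀ * gaussFactor p 0 v y) (a₁ * gaussFactor p 1 v y) := by
  have h0 := continuous_gaussFactor p 0 v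
  have h1 := continuous_gaussFactor p 1 v
  have hq : 0 < 1 - p := by linarith
  unfold potential
  refine Continuous.div (by fun_prop) (by fun_prop) fun y => ?_
  have := gaussFactor_pos p 0 v y
  have := gaussFactor_pos p 1 v y
  positivity

theorem integrable_potential_gaussFactor {p : ℝ} (hp0 : 0 < p) (hp1 : p < 1) (v : ℝ≥0)
    {a₀ a₁ : ℝ} (ha₀ : 0 < a₀) (ha₁ : 0 < a₁) :
    Integrable (fun y => potential p (a₀ * gaussFactor p 0 v y) (a₁ * gaussFactor p 1 v y))
      (gaussianReal 0 v) := by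
  refine Integrable.mono' (((integrable_gaussFactor p 0 v).const_mul a₀).add
    ((integrable_gaussFactor p 1 v).const_mul a₁))
    (continuous_potential_gaussFactor hp0 hp1 v ha₀ ha₁).aestronglyMeasurable
    (Eventually.of_forall fun y => ?_)
  have h0 := mul_pos ha₀ (gaussFactor_pos p 0 v y)
  have h1 := mul_pos ha₁ (gaussFactor_pos p 1 v y)
  rw [Real.norm_of_nonneg (potential_nonneg hp0 hp1 h0 h1)]
  exact potential_le hp0 hp1 h0 h1

/-- The semigroup property: likelihoods of successive observations multiply to that of their sum,
and centred Gaussians convolve by adding variances. -/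
theorem gaussOp_add {p : ℝ} (hp0 : 0 < p) (hp1 : p < 1) (v w : ℝ≥0) {a₀ a₁ : ℝ} (ha₀ : 0 < a₀)
    (ha₁ : 0 < a₁) :
    Integrable (fun x => gaussOp p w (a₀ * gaussFactor p 0 v x) (a₁ * gaussFactor p 1 v x))
      (gaussianReal 0 v) ∧
    ∫ x, gaussOp p w (a₀ * gaussFactor p 0 v x) (a₁ * gaussFactor p 1 v x) ∂gaussianReal 0 v
      = gaussOp p (v + w) a₀ a₁ := by
  have hint := integrable_potential_gaussFactor hp0 hp1 (v + w) ha₀ ha₁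
  have hconv : gaussianReal 0 v ∗ gaussianReal 0 w = gaussianReal 0 (v + w) := by
    simpa using gaussianReal_conv_gaussianReal (m₁ := 0) (m₂ := 0) (v₁ := v) (v₂ := w)
  rw [← hconv] at hint
  have h1 : ∀ x, gaussOp p w (a₀ * gaussFactor p 0 v x) (a₁ * gaussFactor p 1 v x) =
      ∫ y, potential p (a₀ * gaussFactor p 0 (v + w) (x + y))
        (a₁ * gaussFactor p 1 (v + w) (x + y)) ∂gaussianReal 0 w := by
    intro x
    simp only [gaussOp, mul_assoc, gaussFactor_mul]
  simp only [h1]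
  constructor
  · have := (integrable_map_measure hint.1 (by fun_prop)).1 hint
    exact this.integral_prod_left
  · rw [gaussOp, ← hconv, integral_conv hint]

theorem integrable_fun_sub {μ : Measure ℝ} {f g : ℝ → ℝ} (hf : Integrable f μ)
    (hg : Integrable g μ) : Integrable (fun x => f x - g x) μ := hf.sub hg

section Moments

variable {p : ℝ}

theorem integral_gaussFactor_sub_one_pow_four (p : ℝ) (k : Fin 2) (v : ℝ≥0) :
    Integrable (fun y => (gaussFactor p k v y - 1) ^ 4) (gaussianReal 0 v) ∧
    ∫ y, (gaussFactor p k v y - 1) ^ 4 ∂gaussianReal 0 v =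
      Real.exp (6 * (phi p k ^ 2 * v)) - 4 * Real.exp (3 * (phi p k ^ 2 * v)) +
        6 * Real.exp (phi p k ^ 2 * v) - 3 := by
  set t := phi p k
  have e : ∀ y, (gaussFactor p k v y - 1) ^ 4 = Real.exp (4 * t * y - 2 * t ^ 2 * v) -
      4 * Real.exp (3 * t * y - 3 / 2 * t ^ 2 * v) + 6 * Real.exp (2 * t * y - t ^ 2 * v) -
      4 * Real.exp (t * y - t ^ 2 * v / 2) + 1 := by
    intro y
    have h2 : Real.exp (2 * t * y - t ^ 2 * v) = Real.exp (t * y - t ^ 2 * v / 2) ^ 2 := by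
      rw [← Real.exp_nat_mul]; congr 1; push_cast; ring
    have h3 : Real.exp (3 * t * y - 3 / 2 * t ^ 2 * v) = Real.exp (t * y - t ^ 2 * v / 2) ^ 3 := by
      rw [← Real.exp_nat_mul]; congr 1; push_cast; ring
    have h4 : Real.exp (4 * t * y - 2 * t ^ 2 * v) = Real.exp (t * y - t ^ 2 * v / 2) ^ 4 := by
      rw [← Real.exp_nat_mul]; congr 1; push_cast; ring
    rw [h2, h3, h4, gaussFactor]
    ring
  simp only [e]
  have i4 := integrable_exp_gaussianReal v (4 * t) (2 * t ^ 2 * v)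
  have i3 := (integrable_exp_gaussianReal v (3 * t) (3 / 2 * t ^ 2 * v)).const_mul 4
  have i2 := (integrable_exp_gaussianReal v (2 * t) (t ^ 2 * v)).const_mul 6
  have i1 := (integrable_exp_gaussianReal v t (t ^ 2 * v / 2)).const_mul 4
  have i0 : Integrable (fun _ : ℝ => (1 : ℝ)) (gaussianReal 0 v) := integrable_const _
  refine ⟨(integrable_fun_sub ((integrable_fun_sub i4 i3).fun_add i2) i1).fun_add i0, ?_⟩
  rw [integral_add (integrable_fun_sub ((integrable_fun_sub i4 i3).fun_add i2) i1) i0,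
    integral_sub ((integrable_fun_sub i4 i3).fun_add i2) i1,
    integral_add (integrable_fun_sub i4 i3) i2, integral_sub i4 i3]
  simp only [integral_const_mul, integral_exp_gaussianReal]
  have e4 : (v : ℝ) * (4 * t) ^ 2 / 2 - 2 * t ^ 2 * v = 6 * (t ^ 2 * v) := by ring
  have e3 : (v : ℝ) * (3 * t) ^ 2 / 2 - 3 / 2 * t ^ 2 * v = 3 * (t ^ 2 * v) := by ring
  have e2 : (v : ℝ) * (2 * t) ^ 2 / 2 - t ^ 2 * v = t ^ 2 * v := by ring
  have e1 : (v : ℝ) * t ^ 2 / 2 - t ^ 2 * v / 2 = 0 := by ring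
  rw [e4, e3, e2, e1]
  simp
  ring

theorem integral_gaussFactor_sub_sq (hp0 : 0 < p) (hp1 : p < 1) (v : ℝ≥0) :
    Integrable (fun y => (gaussFactor p 0 v y - gaussFactor p 1 v y) ^ 2) (gaussianReal 0 v) ∧
    ∫ y, (gaussFactor p 0 v y - gaussFactor p 1 v y) ^ 2 ∂gaussianReal 0 v =
      Real.exp (phi p 0 ^ 2 * v) + Real.exp (phi p 1 ^ 2 * v) - 2 * Real.exp (-v) := by
  set t := phi p 0
  set u := phi p 1
  have htu : t * u = -1 := phi_zero_mul_phi_one hp0 hp1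
  have e : ∀ y, (gaussFactor p 0 v y - gaussFactor p 1 v y) ^ 2 =
      Real.exp (2 * t * y - t ^ 2 * v) + Real.exp (2 * u * y - u ^ 2 * v) -
      2 * Real.exp ((t + u) * y - (t ^ 2 + u ^ 2) * v / 2) := by
    intro y
    have h2 : Real.exp (2 * t * y - t ^ 2 * v) = Real.exp (t * y - t ^ 2 * v / 2) ^ 2 := by
      rw [← Real.exp_nat_mul]; congr 1; push_cast; ring
    have h3 : Real.exp (2 * u * y - u ^ 2 * v) = Real.exp (u * y - u ^ 2 * v / 2) ^ 2 := by
      rw [← Real.exp_nat_mul]; congr 1; push_cast; ring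
    have h4 : Real.exp ((t + u) * y - (t ^ 2 + u ^ 2) * v / 2) =
        Real.exp (t * y - t ^ 2 * v / 2) * Real.exp (u * y - u ^ 2 * v / 2) := by
      rw [← Real.exp_add]; congr 1; ring
    rw [h2, h3, h4, gaussFactor, gaussFactor]
    ring
  simp only [e]
  have i2 := integrable_exp_gaussianReal v (2 * t) (t ^ 2 * v)
  have i1 := integrable_exp_gaussianReal v (2 * u) (u ^ 2 * v)
  have i0 := (integrable_exp_gaussianReal v (t + u) ((t ^ 2 + u ^ 2) * v / 2)).const_mul 2
  refine ⟨integrable_fun_sub (i2.fun_add i1) i0, ?_⟩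
  rw [integral_sub (i2.fun_add i1) i0, integral_add i2 i1]
  simp only [integral_const_mul, integral_exp_gaussianReal]
  have e2 : (v : ℝ) * (2 * t) ^ 2 / 2 - t ^ 2 * v = t ^ 2 * v := by ring
  have e1 : (v : ℝ) * (2 * u) ^ 2 / 2 - u ^ 2 * v = u ^ 2 * v := by ring
  have e0 : (v : ℝ) * (t + u) ^ 2 / 2 - (t ^ 2 + u ^ 2) * v / 2 = -v := by
    linear_combination (v : ℝ) * htu
  rw [e2, e1, e0]

theorem phi_sq_le (hp0 : 0 < p) (hp1 : p ≤ 1 / 2) (k : Fin 2) : phi p k ^ 2 ≤ 1 / p := by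
  rw [sq]; exact (le_abs_self _).trans (abs_phi_mul_phi_le hp0 hp1 k k)

/-- In the exact formula the terms of order 0 and 1 in t = φ(k)² v cancel. The quadratic remainders
of the exponentials contribute 36 + 4 · 9 + 6 = 78, and 6v ≤ p keeps each exponent at most 1. -/
theorem fourth_moment_le (hp0 : 0 < p) (hp1 : p ≤ 1 / 2) (k : Fin 2) {v : ℝ≥0} (hv : 6 * v ≤ p) :
    ∫ y, (gaussFactor p k v y - 1) ^ 4 ∂gaussianReal 0 v ≤ 78 * (v / p) ^ 2 := by
  rw [(integral_gaussFactor_sub_one_pow_four p k v).2]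
  set t := phi p k ^ 2 * v
  have ht0 : 0 ≤ t := by positivity
  have ht : t ≤ v / p := by
    have := mul_le_mul_of_nonneg_right (phi_sq_le hp0 hp1 k) v.coe_nonneg
    rwa [one_div_mul_eq_div] at this
  have ht6 : 6 * t ≤ 1 := by
    have : 6 * (v / p) ≤ 1 := by rw [← mul_div_assoc, div_le_one hp0]; exact hv
    linarith
  have h6 := abs_le.1 (Real.abs_exp_sub_one_sub_id_le (x := 6 * t)
    (by rw [abs_of_nonneg (by positivity)]; linarith))
  have h3 := abs_le.1 (Real.abs_exp_sub_one_sub_id_le (x := 3 * t)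
    (by rw [abs_of_nonneg (by positivity)]; linarith))
  have h1 := abs_le.1 (Real.abs_exp_sub_one_sub_id_le (x := t)
    (by rw [abs_of_nonneg (by positivity)]; linarith))
  have : t ^ 2 ≤ (v / p) ^ 2 := pow_le_pow_left₀ ht0 ht 2
  nlinarith

/-- The leading coefficient is φ(0)² + φ(1)² + 2 = (φ(0) - φ(1))² = 1/(p(1 - p)). The lower bound
must have it sharp; the upper bound only feeds an error term. -/
theorem second_moment_bounds (hp0 : 0 < p) (hp1 : p ≤ 1 / 2) {v : ℝ≥0} (hv : 6 * v ≤ p) :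
    v / (p * (1 - p)) - 2 * v ^ 2 ≤
      ∫ y, (gaussFactor p 0 v y - gaussFactor p 1 v y) ^ 2 ∂gaussianReal 0 v ∧
    ∫ y, (gaussFactor p 0 v y - gaussFactor p 1 v y) ^ 2 ∂gaussianReal 0 v ≤ 6 * (v / p) := by
  have hp1' : p < 1 := by linarith
  rw [(integral_gaussFactor_sub_sq hp0 hp1' v).2]
  have hv0 : (0 : ℝ) ≤ v := v.coe_nonneg
  have hsum : phi p 0 ^ 2 + phi p 1 ^ 2 + 2 = 1 / (p * (1 - p)) := by
    rw [sq, sq, phi_zero_mul_phi_zero hp0 hp1', phi_one_mul_phi_one hp0 hp1']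
    have : 1 - p ≠ 0 := by linarith
    field_simp
    ring
  have hneg := abs_le.1 (Real.abs_exp_sub_one_sub_id_le (x := -v)
    (by rw [abs_neg, abs_of_nonneg hv0]; linarith))
  constructor
  · have h0 := Real.add_one_le_exp (phi p 0 ^ 2 * v)
    have h1 := Real.add_one_le_exp (phi p 1 ^ 2 * v)
    have : v / (p * (1 - p)) = (phi p 0 ^ 2 + phi p 1 ^ 2 + 2) * v := by rw [hsum]; ring
    rw [this]
    nlinarith
  · have hb : ∀ k, Real.exp (phi p k ^ 2 * v) ≤ 1 + 2 * (v / p) := by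
      intro k
      have ht0 : 0 ≤ phi p k ^ 2 * v := by positivity
      have ht : phi p k ^ 2 * v ≤ v / p := by
        have := mul_le_mul_of_nonneg_right (phi_sq_le hp0 hp1 k) v.coe_nonneg
        rwa [one_div_mul_eq_div] at this
      have ht6 : v / p ≤ 1 := by rw [div_le_one hp0]; linarith
      have h6 := abs_le.1 (Real.abs_exp_sub_one_sub_id_le (x := phi p k ^ 2 * v)
        (by rw [abs_of_nonneg (by positivity)]; linarith))
      nlinarith
    have h0 := hb 0
    have h1 := hb 1
    have h2 := Real.add_one_le_exp (-(v : ℝ))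
    have h3 : (v : ℝ) ≤ v / p := by rw [le_div_iff₀ hp0]; nlinarith
    linarith

end Moments

/-! ### Exchanging Bernoulli observations for Gaussian ones. -/

/-- The error made when one edge observation is replaced by a Gaussian observation of
variance `v`. -/
noncomputable def stepError (p ε η v : ℝ) : ℝ :=
  (2 * |ε| / p ^ 2 / (1 - p) * v + 2 * v ^ 2 + 3 * η / p * v + 312 / η * (v / p) ^ 2) / p

/-- The Gaussian factors have mean one, so the linear terms integrate to zero whatever `c₀` and `c₁`
are. What is left is the second moment minus fourth-moment errors. -/
theorem gaussOp_lower {p η : ℝ} (hp0 : 0 < p) (hp1 : p ≤ 1 / 2) {v : ℝ≥0} (hv : 6 * v ≤ p)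
    (hη : 0 < η) {a₀ a₁ c₀ c₁ : ℝ} (ha₀ : 0 < a₀) (ha₁ : 0 < a₁)
    (h : ∀ s₀ s₁ η : ℝ, 0 < 1 + s₀ → 0 < 1 + s₁ → 0 < η →
      potential p a₀ a₁ + c₀ * s₀ + c₁ * s₁ +
        curvature p a₀ a₁ * ((1 - η / 2) * (s₀ - s₁) ^ 2 - 2 / η * (s₀ ^ 4 + s₁ ^ 4)) ≤
      potential p (a₀ * (1 + s₀)) (a₁ * (1 + s₁))) :
    potential p a₀ a₁ + curvature p a₀ a₁ * (v / (p * (1 - p)) - 2 * v ^ 2 - 3 * η / p * v -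
      312 / η * (v / p) ^ 2) ≤ gaussOp p v a₀ a₁ := by
  have hp1' : p < 1 := by linarith
  have hβ := curvature_nonneg hp0 hp1' ha₀ ha₁
  set β := curvature p a₀ a₁
  set γ := gaussianReal 0 v
  set F := fun k => gaussFactor p k v
  have iF : ∀ k, Integrable (fun y => F k y - 1) γ := fun k =>
    (integrable_gaussFactor p k v).sub (integrable_const _)
  have iF0 : ∀ k, ∫ y, (F k y - 1) ∂γ = 0 := fun k => by
    rw [integral_sub (integrable_gaussFactor p k v) (integrable_const _), integral_gaussFactor]
    simp
  have i2 := (integral_gaussFactor_sub_sq hp0 hp1' v).1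
  have i4 : ∀ k, Integrable (fun y => (F k y - 1) ^ 4) γ := fun k =>
    (integral_gaussFactor_sub_one_pow_four p k v).1
  have hpt : ∀ y, potential p a₀ a₁ + c₀ * (F 0 y - 1) + c₁ * (F 1 y - 1) +
      β * ((1 - η / 2) * (F 0 y - F 1 y) ^ 2 - 2 / η * ((F 0 y - 1) ^ 4 + (F 1 y - 1) ^ 4)) ≤
      potential p (a₀ * F 0 y) (a₁ * F 1 y) := by
    intro y
    have := h (F 0 y - 1) (F 1 y - 1) η (by simpa using gaussFactor_pos p 0 v y)
      (by simpa using gaussFactor_pos p 1 v y) hη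
    simpa using this
  have ia := integrable_const (μ := γ) (potential p a₀ a₁)
  have ib := (iF 0).const_mul c₀
  have ic := (iF 1).const_mul c₁
  have id' := i2.const_mul (1 - η / 2)
  have ie := ((i4 0).fun_add (i4 1)).const_mul (2 / η)
  have hle := integral_mono (((ia.fun_add ib).fun_add ic).fun_add ((integrable_fun_sub id' ie).const_mul β))
    (integrable_potential_gaussFactor hp0 hp1' v ha₀ ha₁) hpt
  refine le_trans ?_ hle
  have hcalc : ∫ y, (potential p a₀ a₁ + c₀ * (F 0 y - 1) + c₁ * (F 1 y - 1) +
      β * ((1 - η / 2) * (F 0 y - F 1 y) ^ 2 - 2 / η * ((F 0 y - 1) ^ 4 + (F 1 y - 1) ^ 4))) ∂γ =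
      potential p a₀ a₁ + β * ((1 - η / 2) * (∫ y, (F 0 y - F 1 y) ^ 2 ∂γ) -
        2 / η * (∫ y, (F 0 y - 1) ^ 4 ∂γ + ∫ y, (F 1 y - 1) ^ 4 ∂γ)) := by
    rw [integral_add ((ia.fun_add ib).fun_add ic) ((integrable_fun_sub id' ie).const_mul β),
      integral_add (ia.fun_add ib) ic,
      integral_add ia ib, integral_const_mul, integral_const_mul, integral_const_mul,
      integral_sub id' ie, integral_const_mul, integral_const_mul, integral_add (i4 0) (i4 1),
      iF0, iF0]
    simp [γ, F]
  refine le_trans ?_ hcalc.ge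
  refine add_le_add le_rfl (mul_le_mul_of_nonneg_left ?_ hβ)
  obtain ⟨hlo, hup⟩ := second_moment_bounds hp0 hp1 hv
  have h40 := fourth_moment_le hp0 hp1 0 hv
  have h41 := fourth_moment_le hp0 hp1 1 hv
  have h5 : 2 / η * (∫ y, (F 0 y - 1) ^ 4 ∂γ + ∫ y, (F 1 y - 1) ^ 4 ∂γ) ≤
      2 / η * (156 * (v / p) ^ 2) :=
    mul_le_mul_of_nonneg_left (by linarith) (by positivity)
  have h6 := mul_le_mul_of_nonneg_left hup (by positivity : 0 ≤ η / 2)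
  have h7 : 2 / η * (156 * (v / p) ^ 2) = 312 / η * (v / p) ^ 2 := by ring
  have h8 : η / 2 * (6 * (v / p)) = 3 * η / p * v := by ring
  rw [h7] at h5
  rw [h8] at h6
  linarith

/-- Replacing one edge observation by a Gaussian observation. -/
theorem edge_step_le {p θ ε η m : ℝ} (hp0 : 0 < p) (hp1 : p ≤ 1 / 2) (hε : |ε| / p ≤ 1 / 2)
    (h0 : 0 < θ) (h1 : θ ≤ 1 / 2) (hη : 0 < η) (hm : ∀ k, |phi p k * m| ≤ 1 / p) {v : ℝ≥0}
    (hv : (v : ℝ) = θ / (1 - θ) * ε ^ 2 * m ^ 2) (hvp : 6 * v ≤ p) {a₀ a₁ : ℝ} (ha₀ : 0 < a₀)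
    (ha₁ : 0 < a₁) :
    (1 - θ) * potential p (a₀ * (1 - θ / (1 - θ) * (ε * phi p 0 * m)))
        (a₁ * (1 - θ / (1 - θ) * (ε * phi p 1 * m))) +
      θ * potential p (a₀ * (1 + ε * phi p 0 * m)) (a₁ * (1 + ε * phi p 1 * m)) ≤
      gaussOp p v a₀ a₁ + (a₀ + a₁) * stepError p ε η v := by
  have hp1' : p < 1 := by linarith
  have hq : 0 < 1 - p := by linarith
  obtain ⟨c₀, c₁, hup, hlo⟩ := exists_potential_bounds hp0 hp1' ha₀ ha₁
  have hG := gaussOp_lower hp0 hp1 hvp hη ha₀ ha₁ hlo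
  have hx : ∀ k, |ε * phi p k * m| ≤ |ε| / p := by
    intro k
    rw [mul_assoc, abs_mul]
    refine (mul_le_mul_of_nonneg_left (hm k) (abs_nonneg _)).trans (le_of_eq ?_)
    ring
  have hθ1 : θ / (1 - θ) ≤ 1 := by rw [div_le_one (by linarith)]; linarith
  have hθ0 : 0 ≤ θ / (1 - θ) := div_nonneg h0.le (by linarith)
  have hx' : ∀ k, |-(θ / (1 - θ) * (ε * phi p k * m))| ≤ |ε| / p := by
    intro k
    rw [abs_neg, abs_mul, abs_of_nonneg hθ0]
    exact (mul_le_of_le_one_left (abs_nonneg _) hθ1).trans (hx k)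
  have e1 := mul_le_mul_of_nonneg_left (hup _ _ _ hε (hx' 0) (hx' 1)) (by linarith : 0 ≤ 1 - θ)
  have e2 := mul_le_mul_of_nonneg_left (hup _ _ _ hε (hx 0) (hx 1)) h0.le
  rw [← sub_eq_add_neg, ← sub_eq_add_neg] at e1
  have hβ := curvature_nonneg hp0 hp1' ha₀ ha₁
  have hβ' := curvature_le hp0 hp1' ha₀ ha₁
  set β := curvature p a₀ a₁
  set X := |ε| / p
  set x₀ := ε * phi p 0 * m with hx₀
  set x₁ := ε * phi p 1 * m with hx₁
  have hne : 1 - θ ≠ 0 := by linarith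
  have hdiff : (phi p 0 - phi p 1) ^ 2 = 1 / (p * (1 - p)) := by
    have : (phi p 0 - phi p 1) ^ 2 = phi p 0 * phi p 0 + phi p 1 * phi p 1 -
        2 * (phi p 0 * phi p 1) := by ring
    rw [this, phi_zero_mul_phi_zero hp0 hp1', phi_one_mul_phi_one hp0 hp1',
      phi_zero_mul_phi_one hp0 hp1']
    field_simp
    ring
  -- The identity (1 - θ)(θ/(1 - θ))² + θ = θ/(1 - θ) is what dictates the choice of `v`: the
  -- quadratic terms of the edge and of the Gaussian observation then agree to leading order.
  have hsecond : (1 - θ) * (-(θ / (1 - θ) * x₀) - -(θ / (1 - θ) * x₁)) ^ 2 + θ * (x₀ - x₁) ^ 2 =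
      v / (p * (1 - p)) := by
    have h2 : (x₀ - x₁) ^ 2 = ε ^ 2 * m ^ 2 * (1 / (p * (1 - p))) := by
      rw [← hdiff, hx₀, hx₁]; ring
    have h3 : (1 - θ) * (-(θ / (1 - θ) * x₀) - -(θ / (1 - θ) * x₁)) ^ 2 + θ * (x₀ - x₁) ^ 2 =
        ((1 - θ) * (θ / (1 - θ)) ^ 2 + θ) * (x₀ - x₁) ^ 2 := by ring
    have h4 : (1 - θ) * (θ / (1 - θ)) ^ 2 + θ = θ / (1 - θ) := by field_simp; ring
    rw [h3, h4, h2, hv]; ring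
  -- The Bernoulli perturbation is centred too, so the linear terms cancel on both sides of the
  -- exchange.
  have hfirst : ∀ x : ℝ, (1 - θ) * -(θ / (1 - θ) * x) + θ * x = 0 := by
    intro x; field_simp; ring
  have hsum : (1 - θ) * (potential p a₀ a₁ + c₀ * -(θ / (1 - θ) * x₀) + c₁ * -(θ / (1 - θ) * x₁) +
      β * ((1 + 2 * X) * (-(θ / (1 - θ) * x₀) - -(θ / (1 - θ) * x₁)) ^ 2)) +
      θ * (potential p a₀ a₁ + c₀ * x₀ + c₁ * x₁ + β * ((1 + 2 * X) * (x₀ - x₁) ^ 2)) =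
      potential p a₀ a₁ + β * ((1 + 2 * X) * (v / (p * (1 - p)))) := by
    rw [← hsecond]
    linear_combination c₀ * hfirst x₀ + c₁ * hfirst x₁
  have herr : β * (2 * X * (v / (p * (1 - p))) + 2 * v ^ 2 + 3 * η / p * v +
      312 / η * (v / p) ^ 2) ≤ (a₀ + a₁) * stepError p ε η v := by
    have h2 : 2 * X * (v / (p * (1 - p))) = 2 * |ε| / p ^ 2 / (1 - p) * v := by
      simp only [X]; field_simp
    have h3 : (a₀ + a₁) * stepError p ε η v = (a₀ + a₁) / p *
      (2 * |ε| / p ^ 2 / (1 - p) * v + 2 * v ^ 2 + 3 * η / p * v + 312 / η * (v / p) ^ 2) := by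
      rw [stepError]; ring
    rw [h2, h3]
    exact mul_le_mul_of_nonneg_right hβ' (by positivity)
  linarith

/-- A Bernoulli family of edge observations compared with a Gaussian observation. -/
theorem sum_bern_potential_le {ι : Type*} [DecidableEq ι] {p θ ε η : ℝ} (hp0 : 0 < p)
    (hp1 : p ≤ 1 / 2) (hε : |ε| / p ≤ 1 / 2) (h0 : 0 < θ) (h1 : θ ≤ 1 / 2) (hη : 0 < η)
    {m : ι → ℝ} (hm : ∀ k j, |phi p k * m j| ≤ 1 / p) {v : ι → ℝ≥0}
    (hv : ∀ j, (v j : ℝ) = θ / (1 - θ) * ε ^ 2 * m j ^ 2) (hvp : ∀ j, 6 * (v j : ℝ) ≤ p)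
    (I : Finset ι) : ∀ {a₀ a₁ : ℝ}, 0 < a₀ → 0 < a₁ →
    ∑ S ∈ I.powerset, bern θ I S * potential p
      (a₀ * subsetLik θ I (fun j => ε * phi p 0 * m j) S)
      (a₁ * subsetLik θ I (fun j => ε * phi p 1 * m j) S) ≤
      gaussOp p (∑ j ∈ I, v j) a₀ a₁ + (a₀ + a₁) * ∑ j ∈ I, stepError p ε η (v j) := by
  have hp1' : p < 1 := by linarith
  induction I using Finset.induction_on with
  | empty =>
    intro a₀ a₁ _ _
    simp [bern, subsetLik, gaussOp, gaussianReal_zero_var, gaussFactor]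
  | insert i I hi ih =>
    intro a₀ a₁ ha₀ ha₁
    have hx : ∀ k, |ε * phi p k * m i| ≤ 1 / 2 := by
      intro k
      rw [mul_assoc, abs_mul]
      refine (mul_le_mul_of_nonneg_left (hm k i) (abs_nonneg _)).trans (le_trans (le_of_eq ?_) hε)
      ring
    have hθ1 : θ / (1 - θ) ≤ 1 := by rw [div_le_one (by linarith)]; linarith
    have hθ0 : 0 ≤ θ / (1 - θ) := div_nonneg h0.le (by linarith)
    have hy : ∀ k, 0 < 1 + ε * phi p k * m i := fun k => by linarith [(abs_le.1 (hx k)).1]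
    have hz : ∀ k, 0 < 1 - θ / (1 - θ) * (ε * phi p k * m i) := fun k => by
      have := abs_le.1 (hx k)
      nlinarith
    have hne : 1 - θ ≠ 0 := by linarith
    have hsplit : ∀ S ∈ I.powerset, S ⊆ I ∧ i ∉ S := fun S hS =>
      ⟨Finset.mem_powerset.1 hS, fun h => hi (Finset.mem_powerset.1 hS h)⟩
    have hA : ∑ S ∈ I.powerset, bern θ (insert i I) S * potential p
        (a₀ * subsetLik θ (insert i I) (fun j => ε * phi p 0 * m j) S)
        (a₁ * subsetLik θ (insert i I) (fun j => ε * phi p 1 * m j) S) =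
        (1 - θ) * ∑ S ∈ I.powerset, bern θ I S * potential p
        (a₀ * (1 - θ / (1 - θ) * (ε * phi p 0 * m i)) *
          subsetLik θ I (fun j => ε * phi p 0 * m j) S)
        (a₁ * (1 - θ / (1 - θ) * (ε * phi p 1 * m i)) *
          subsetLik θ I (fun j => ε * phi p 1 * m j) S) := by
      rw [Finset.mul_sum]
      refine Finset.sum_congr rfl fun S hS => ?_
      obtain ⟨hSI, hiS⟩ := hsplit S hS
      have e1 : insert i I \ S = insert i (I \ S) := Finset.insert_sdiff_of_notMem _ hiS
      have e2 : i ∉ I \ S := fun h => hi (Finset.mem_sdiff.1 h).1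
      have e3 : bern θ (insert i I) S = (1 - θ) * bern θ I S := by
        rw [bern, bern, e1, Finset.card_insert_of_notMem e2, pow_succ]; ring
      have e4 : ∀ u : ι → ℝ, subsetLik θ (insert i I) u S =
          (1 - θ / (1 - θ) * u i) * subsetLik θ I u S := by
        intro u
        rw [subsetLik, subsetLik, e1, Finset.prod_insert e2]; ring
      rw [e3, e4, e4, mul_assoc, mul_assoc a₀, mul_assoc a₁]
    have hB : ∑ S ∈ I.powerset, bern θ (insert i I) (insert i S) * potential p
        (a₀ * subsetLik θ (insert i I) (fun j => ε * phi p 0 * m j) (insert i S))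
        (a₁ * subsetLik θ (insert i I) (fun j => ε * phi p 1 * m j) (insert i S)) =
        θ * ∑ S ∈ I.powerset, bern θ I S * potential p
        (a₀ * (1 + ε * phi p 0 * m i) * subsetLik θ I (fun j => ε * phi p 0 * m j) S)
        (a₁ * (1 + ε * phi p 1 * m i) * subsetLik θ I (fun j => ε * phi p 1 * m j) S) := by
      rw [Finset.mul_sum]
      refine Finset.sum_congr rfl fun S hS => ?_
      obtain ⟨hSI, hiS⟩ := hsplit S hS
      have e1 : insert i I \ insert i S = I \ S := by
        ext j
        simp only [Finset.mem_sdiff, Finset.mem_insert, not_or]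
        constructor
        · rintro ⟨h | h, h', h''⟩
          · exact absurd h h'
          · exact ⟨h, h''⟩
        · rintro ⟨h, h'⟩
          exact ⟨Or.inr h, fun h2 => hi (h2 ▸ h), h'⟩
      have e3 : bern θ (insert i I) (insert i S) = θ * bern θ I S := by
        rw [bern, bern, e1, Finset.card_insert_of_notMem hiS, pow_succ]; ring
      have e4 : ∀ u : ι → ℝ, subsetLik θ (insert i I) u (insert i S) =
          (1 + u i) * subsetLik θ I u S := by
        intro u
        rw [subsetLik, subsetLik, e1, Finset.prod_insert hiS]; ring
      rw [e3, e4, e4, mul_assoc, mul_assoc a₀, mul_assoc a₁]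
    rw [Finset.sum_powerset_insert hi, hA, hB, Finset.sum_insert hi, Finset.sum_insert hi]
    set V := ∑ j ∈ I, v j
    set E := ∑ j ∈ I, stepError p ε η (v j)
    have ih0 := mul_le_mul_of_nonneg_left (ih (mul_pos ha₀ (hz 0)) (mul_pos ha₁ (hz 1)))
      (by linarith : 0 ≤ 1 - θ)
    have ih1 := mul_le_mul_of_nonneg_left (ih (mul_pos ha₀ (hy 0)) (mul_pos ha₁ (hy 1))) h0.le
    obtain ⟨hint, hadd⟩ := gaussOp_add hp0 hp1' V (v i) ha₀ ha₁
    -- The other edges are already Gaussian. The one-edge exchange is applied inside their integral,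
    -- at the likelihoods `a₀` and `a₁` multiplied by the Gaussian factors, and the semigroup
    -- property merges the variances.
    have hstep : (1 - θ) * gaussOp p V (a₀ * (1 - θ / (1 - θ) * (ε * phi p 0 * m i)))
        (a₁ * (1 - θ / (1 - θ) * (ε * phi p 1 * m i))) +
        θ * gaussOp p V (a₀ * (1 + ε * phi p 0 * m i)) (a₁ * (1 + ε * phi p 1 * m i)) ≤
        gaussOp p (v i + V) a₀ a₁ + (a₀ + a₁) * stepError p ε η (v i) := by
      have j0 := (integrable_potential_gaussFactor hp0 hp1' V (mul_pos ha₀ (hz 0))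
        (mul_pos ha₁ (hz 1))).const_mul (1 - θ)
      have j1 := (integrable_potential_gaussFactor hp0 hp1' V (mul_pos ha₀ (hy 0))
        (mul_pos ha₁ (hy 1))).const_mul θ
      have j2 := (((integrable_gaussFactor p 0 V).const_mul a₀).fun_add
        ((integrable_gaussFactor p 1 V).const_mul a₁)).mul_const (stepError p ε η (v i))
      have hmono := integral_mono (j0.fun_add j1) (hint.fun_add j2) (fun y => by
        have := edge_step_le hp0 hp1 hε h0 h1 hη (fun k => hm k i) (hv i) (hvp i)
          (mul_pos ha₀ (gaussFactor_pos p 0 V y)) (mul_pos ha₁ (gaussFactor_pos p 1 V y))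
        simp only [mul_right_comm a₀ (gaussFactor p 0 V y), mul_right_comm a₁ (gaussFactor p 1 V y)]
          at this
        exact this)
      have k0 : ∫ y, ((1 - θ) * potential p
          (a₀ * (1 - θ / (1 - θ) * (ε * phi p 0 * m i)) * gaussFactor p 0 V y)
          (a₁ * (1 - θ / (1 - θ) * (ε * phi p 1 * m i)) * gaussFactor p 1 V y) +
          θ * potential p (a₀ * (1 + ε * phi p 0 * m i) * gaussFactor p 0 V y)
          (a₁ * (1 + ε * phi p 1 * m i) * gaussFactor p 1 V y)) ∂gaussianReal 0 V =
          (1 - θ) * gaussOp p V (a₀ * (1 - θ / (1 - θ) * (ε * phi p 0 * m i)))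
        (a₁ * (1 - θ / (1 - θ) * (ε * phi p 1 * m i))) +
        θ * gaussOp p V (a₀ * (1 + ε * phi p 0 * m i)) (a₁ * (1 + ε * phi p 1 * m i)) := by
        rw [integral_add j0 j1, integral_const_mul, integral_const_mul, gaussOp, gaussOp]
      have k1 : ∫ y, (gaussOp p (v i) (a₀ * gaussFactor p 0 V y) (a₁ * gaussFactor p 1 V y) +
          (a₀ * gaussFactor p 0 V y + a₁ * gaussFactor p 1 V y) * stepError p ε η (v i))
          ∂gaussianReal 0 V = gaussOp p (v i + V) a₀ a₁ + (a₀ + a₁) * stepError p ε η (v i) := by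
        rw [integral_add hint j2, hadd, integral_mul_const, integral_add
          ((integrable_gaussFactor p 0 V).const_mul a₀)
          ((integrable_gaussFactor p 1 V).const_mul a₁), integral_const_mul, integral_const_mul,
          integral_gaussFactor, integral_gaussFactor, mul_one, mul_one, add_comm V]
      rw [← k0, ← k1]
      exact hmono
    -- Errors are proportional to a₀ + a₁, whose average is unchanged by an observation. They
    -- therefore add up over the edges instead of compounding.
    have hmean : ∀ a x : ℝ, (1 - θ) * (a * (1 - θ / (1 - θ) * x)) + θ * (a * (1 + x)) = a := by
      intro a x; field_simp; ring
    have e5 : (1 - θ) * ((a₀ * (1 - θ / (1 - θ) * (ε * phi p 0 * m i)) +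
        a₁ * (1 - θ / (1 - θ) * (ε * phi p 1 * m i))) * E) +
        θ * ((a₀ * (1 + ε * phi p 0 * m i) + a₁ * (1 + ε * phi p 1 * m i)) * E) =
        (a₀ + a₁) * E := by
      linear_combination E * hmean a₀ (ε * phi p 0 * m i) + E * hmean a₁ (ε * phi p 1 * m i)
    linarith

/-- Exponential tilting of a centred Gaussian is a translation. -/
theorem integral_exp_mul_gaussianReal (v : ℝ≥0) (t : ℝ) {f : ℝ → ℝ} (hf : Continuous f) :
    ∫ y, Real.exp (t * y - t ^ 2 * v / 2) * f y ∂gaussianReal 0 v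
      = ∫ y, f (y + t * v) ∂gaussianReal 0 v := by
  by_cases hv : v = 0
  · simp [hv, gaussianReal_zero_var]
  have h1 : ∫ y, f (y + t * v) ∂gaussianReal 0 v = ∫ y, f y ∂gaussianReal (t * v) v := by
    have h2 := gaussianReal_map_add_const (μ := 0) (v := v) (t * v)
    rw [zero_add] at h2
    rw [← h2, integral_map (by fun_prop) hf.aestronglyMeasurable]
  rw [h1, integral_gaussianReal_eq_integral_smul hv, integral_gaussianReal_eq_integral_smul hv]
  congr 1
  ext y
  have hv' : (v : ℝ) ≠ 0 := by exact_mod_cast hv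
  simp only [smul_eq_mul, gaussianPDFReal]
  rw [← mul_assoc, mul_assoc _ (Real.exp _) (Real.exp _), ← Real.exp_add]
  congr 3
  field_simp
  ring

/-- The sign of -√v is chosen for `gaussOp_one_one`: the exponent there has slope φ(1) - φ(0) ≤ 0,
and `gFun` has slope +√μ. -/
theorem integral_gaussianReal_eq_standard (v : ℝ≥0) {f : ℝ → ℝ} (hf : Continuous f) :
    ∫ y, f y ∂gaussianReal 0 v = ∫ z, f (-√v * z) ∂gaussianReal 0 1 := by
  have h := gaussianReal_map_const_mul (μ := 0) (v := 1) (-√v)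
  have h2 : (NNReal.mk ((-√(v : ℝ)) ^ 2) (sq_nonneg _) * 1 : ℝ≥0) = v := by
    ext
    simp
  rw [mul_zero, h2] at h
  rw [← h, integral_map (by fun_prop) hf.aestronglyMeasurable]

/-! ### The Gaussian channel as the fixed-point map, and the spinodal curve. -/

section Spinodal

variable {p : ℝ}

theorem phi_sub_phi (hp0 : 0 < p) (hp1 : p < 1) :
    0 ≤ phi p 0 - phi p 1 ∧ (phi p 0 - phi p 1) ^ 2 = 1 / (p * (1 - p)) := by
  have hq : 0 < 1 - p := by linarith
  constructor
  · simp only [phi, Matrix.cons_val_zero, Matrix.cons_val_one, Matrix.cons_val_fin_one, sub_neg_eq_add]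
    positivity
  · have : (phi p 0 - phi p 1) ^ 2 = phi p 0 * phi p 0 + phi p 1 * phi p 1 -
        2 * (phi p 0 * phi p 1) := by ring
    rw [this, phi_zero_mul_phi_zero hp0 hp1, phi_one_mul_phi_one hp0 hp1,
      phi_zero_mul_phi_one hp0 hp1]
    field_simp
    ring

theorem continuous_inv_mix (hp0 : 0 < p) (hp1 : p < 1) {g : ℝ → ℝ} (hg : Continuous g) :
    Continuous fun y => 1 / (p + (1 - p) * Real.exp (g y)) := by
  have hq : 0 < 1 - p := by linarith
  refine Continuous.div continuous_const (by fun_prop) fun y => ?_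
  positivity

theorem inv_mix_le (hp0 : 0 < p) (hp1 : p < 1) (x : ℝ) :
    1 / (p + (1 - p) * Real.exp x) ≤ 1 / p := by
  have hq : 0 < 1 - p := by linarith
  exact one_div_le_one_div_of_le hp0 (by linarith [mul_pos hq (Real.exp_pos x)])

/-- The potential of the two Gaussian factors is p/(1 - p) times F₀²/(pF₀ + (1 - p)F₁) minus 2F₀
plus the mixture. The last two have means 2 and 1, giving the -1, and tilting by one factor F₀
translates the Gaussian in the first. -/
theorem gaussOp_one_one (hp0 : 0 < p) (hp1 : p < 1) (v : ℝ≥0) :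
    gaussOp p v 1 1 = p / (1 - p) * ∫ z, (1 / (p + (1 - p) *
      Real.exp (√(v / (p * (1 - p))) * z - v / (p * (1 - p)) / 2)) - 1) ∂gaussianReal 0 1 := by
  have hq : 0 < 1 - p := by linarith
  obtain ⟨hΔ0, hΔ⟩ := phi_sub_phi hp0 hp1
  set f : ℝ → ℝ := fun y => 1 / (p + (1 - p) *
    Real.exp ((phi p 1 - phi p 0) * y - (phi p 1 ^ 2 - phi p 0 ^ 2) * v / 2)) with hf
  have hfc : Continuous f := continuous_inv_mix hp0 hp1 (by fun_prop)
  have hfp : ∀ y, 0 < f y := fun y => by simp only [hf]; positivity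
  have i0 := integrable_gaussFactor p 0 v
  have i1 := integrable_gaussFactor p 1 v
  have i2 : Integrable (fun y => gaussFactor p 0 v y * f y) (gaussianReal 0 v) := by
    refine i0.mul_bdd (c := 1 / p) hfc.aestronglyMeasurable (Eventually.of_forall fun y => ?_)
    rw [Real.norm_of_nonneg (hfp y).le]
    exact inv_mix_le hp0 hp1 _
  have hpt : ∀ y, potential p (1 * gaussFactor p 0 v y) (1 * gaussFactor p 1 v y) =
      p / (1 - p) * (gaussFactor p 0 v y * f y - 2 * gaussFactor p 0 v y +
        (p * gaussFactor p 0 v y + (1 - p) * gaussFactor p 1 v y)) := by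
    intro y
    have h0 := gaussFactor_pos p 0 v y
    have h1 := gaussFactor_pos p 1 v y
    have hfy : f y = gaussFactor p 0 v y /
        (p * gaussFactor p 0 v y + (1 - p) * gaussFactor p 1 v y) := by
      have h2 : gaussFactor p 1 v y = gaussFactor p 0 v y *
          Real.exp ((phi p 1 - phi p 0) * y - (phi p 1 ^ 2 - phi p 0 ^ 2) * v / 2) := by
        rw [gaussFactor, gaussFactor, ← Real.exp_add]; congr 1; ring
      have h3 := Real.exp_pos ((phi p 1 - phi p 0) * y - (phi p 1 ^ 2 - phi p 0 ^ 2) * v / 2)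
      rw [h2, hf]
      field_simp
    rw [hfy, potential, one_mul, one_mul]
    field_simp
    ring
  have hmean : ∫ y, gaussFactor p 0 v y * f y ∂gaussianReal 0 v =
      ∫ z, 1 / (p + (1 - p) *
      Real.exp (√(v / (p * (1 - p))) * z - v / (p * (1 - p)) / 2)) ∂gaussianReal 0 1 := by
    have h1 := integral_exp_mul_gaussianReal v (phi p 0) hfc
    have h2 := integral_gaussianReal_eq_standard v (f := fun y => f (y + phi p 0 * v))
      (by fun_prop)
    simp only [gaussFactor]
    rw [h1, h2]
    congr 1
    ext z
    simp only [hf]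
    congr 4
    have h3 : √(v / (p * (1 - p))) = (phi p 0 - phi p 1) * √v := by
      have : (v : ℝ) / (p * (1 - p)) = (phi p 0 - phi p 1) ^ 2 * v := by rw [hΔ]; ring
      rw [this, Real.sqrt_mul (sq_nonneg _), Real.sqrt_sq hΔ0]
    have h4 : (v : ℝ) / (p * (1 - p)) = (phi p 0 - phi p 1) ^ 2 * v := by rw [hΔ]; ring
    rw [h3, h4]
    ring
  rw [gaussOp]
  simp only [hpt]
  have j1 := i0.const_mul 2
  have j2 := (i0.const_mul p).fun_add (i1.const_mul (1 - p))
  rw [integral_const_mul, integral_add (integrable_fun_sub i2 j1) j2, integral_sub i2 j1,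
    integral_add (i0.const_mul p) (i1.const_mul (1 - p)), integral_const_mul, integral_const_mul,
    integral_const_mul, integral_gaussFactor, integral_gaussFactor, hmean, integral_sub]
  · have h1 : ∫ _ : ℝ, (1 : ℝ) ∂gaussianReal 0 1 = 1 := by simp
    rw [h1]
    ring
  · refine Integrable.of_bound (continuous_inv_mix hp0 hp1 (by fun_prop)).aestronglyMeasurable
      (1 / p) (Eventually.of_forall fun z => ?_)
    rw [Real.norm_of_nonneg (by positivity)]
    exact inv_mix_le hp0 hp1 _
  · exact integrable_const _

/-- The scales are related by μ = v/(p(1 - p)), since the log-likelihood ratio has variance (φ(0) -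
φ(1))² v. -/
theorem gFun_eq_gaussOp (hp0 : 0 < p) (hp1 : p < 1) (lam : ℝ) (v : ℝ≥0) :
    gFun lam p (v / (p * (1 - p))) = lam / (p * (1 - p)) * gaussOp p v 1 1 := by
  have hq : 1 - p ≠ 0 := by linarith
  rw [gaussOp_one_one hp0 hp1, gFun, ← mul_assoc]
  congr 1
  field_simp

theorem continuous_gFun (hp0 : 0 < p) (hp1 : p < 1) (lam : ℝ) : Continuous (gFun lam p) := by
  have hq : 0 < 1 - p := by linarith
  unfold gFun
  refine continuous_const.mul ?_
  refine continuous_of_dominated (bound := fun _ => 1 / p + 1) (fun μ => ?_) (fun μ => ?_)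
    (integrable_const _) (Eventually.of_forall fun z => ?_)
  · exact ((continuous_inv_mix hp0 hp1 (by fun_prop)).sub continuous_const).aestronglyMeasurable
  · refine Eventually.of_forall fun z => (norm_sub_le _ _).trans ?_
    rw [Real.norm_of_nonneg (by positivity), norm_one]
    linarith [inv_mix_le hp0 hp1 (√μ * z - μ / 2)]
  · exact (continuous_inv_mix hp0 hp1 (by fun_prop)).sub continuous_const

theorem gFun_le (hp0 : 0 < p) (hp1 : p < 1) {lam : ℝ} (hlam : 0 ≤ lam) (μ : ℝ) :
    gFun lam p μ ≤ lam / (1 - p) ^ 2 * (1 / p) := by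
  have hq : 0 < 1 - p := by linarith
  refine mul_le_mul_of_nonneg_left ?_ (by positivity)
  calc _ ≤ ∫ _, 1 / p ∂gaussianReal 0 1 := by
        have hc : Continuous fun z => 1 / (p + (1 - p) * Real.exp (√μ * z - μ / 2)) :=
          continuous_inv_mix hp0 hp1 (by fun_prop)
        refine integral_mono (integrable_fun_sub (Integrable.of_bound hc.aestronglyMeasurable
          (1 / p) (Eventually.of_forall fun z => ?_)) (integrable_const _)) (integrable_const _)
          fun z => ?_
        · rw [Real.norm_of_nonneg (by positivity)]
          exact inv_mix_le hp0 hp1 _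
        · have := inv_mix_le hp0 hp1 (√μ * z - μ / 2)
          simp only
          linarith
    _ = 1 / p := by simp

/-- Below the spinodal curve the Gaussian channel contracts the second moment. -/
theorem exists_gaussOp_le (hp0 : 0 < p) (hp1 : p < 1) {lam : ℝ} (h0 : 0 ≤ lam)
    (h : lam < spinodal p) : ∃ lam' > lam, ∀ v : ℝ≥0, lam' * gaussOp p v 1 1 ≤ v := by
  have hq : 0 < 1 - p := by linarith
  -- An empty set would have supremum 0 by convention, contradicting 0 ≤ `lam` < `spinodal p`.
  have hne : {lam : ℝ | 0 ≤ lam ∧ ∀ μ : ℝ, 0 ≤ μ → (gFun lam p μ = μ ↔ μ = 0)}.Nonempty := by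
    by_contra hne
    rw [Set.not_nonempty_iff_eq_empty] at hne
    rw [spinodal, hne, Real.sSup_empty] at h
    linarith
  obtain ⟨lam', ⟨h0', hfix⟩, hlt⟩ := exists_lt_of_lt_csSup hne h
  refine ⟨lam', hlt, fun v => ?_⟩
  set μ : ℝ := v / (p * (1 - p)) with hμ
  have hμ0 : 0 ≤ μ := by positivity
  -- If the map were above the diagonal at μ, boundedness would force a crossing at some x ≥ μ.
  -- Uniqueness gives x = 0, hence μ = 0, which is itself a fixed point.
  have key : gFun lam' p μ ≤ μ := by
    by_contra! hgt
    set K := lam' / (1 - p) ^ 2 * (1 / p)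
    have hK : K < max μ (K + 1) := lt_max_of_lt_right (by linarith)
    have hIVT := intermediate_value_Icc' (le_max_left μ (K + 1))
      (f := fun x => gFun lam' p x - x)
      ((continuous_gFun hp0 hp1 lam').sub continuous_id).continuousOn
    have hmem : (0 : ℝ) ∈ Set.Icc (gFun lam' p (max μ (K + 1)) - max μ (K + 1))
        (gFun lam' p μ - μ) := by
      constructor
      · linarith [gFun_le hp0 hp1 h0' (max μ (K + 1))]
      · linarith
    obtain ⟨x, hx, hx0⟩ := hIVT hmem
    have hxx : gFun lam' p x = x := by simpa [sub_eq_zero] using hx0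
    have hx2 : x = 0 := (hfix x (hμ0.trans hx.1)).1 hxx
    have hμz : μ = 0 := le_antisymm (hx2 ▸ hx.1) hμ0
    have := (hfix 0 le_rfl).2 rfl
    rw [hμz] at hgt
    linarith
  rw [hμ, gFun_eq_gaussOp hp0 hp1, div_mul_eq_mul_div] at key
  exact (div_le_div_iff_of_pos_right (by positivity)).1 key

end Spinodal

/-! ### From energy to success probability. -/

section Success

variable {p : ℝ} {n : ℕ} {M : Matrix (Fin 2) (Fin 2) ℝ}

open Classical in
theorem prob_eq_sum (M : Matrix (Fin 2) (Fin 2) ℝ) (p : ℝ)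
    (E : (Fin n → Fin 2) → SimpleGraph (Fin n) → Prop) :
    prob M p E = ∑ ω, if E ω.1 ω.2 then modelWeight M p ω else 0 := by
  rw [prob, Fintype.sum_prod_type]
  rfl

/-- A transposition moves `i` to the root, whose label is drawn from the prior independently of the
other vertices' labels and graph. -/
theorem sum_modelWeight_mul_label (hM : ∀ k l, M k l = M l k) (p : ℝ) (i : Fin (n + 1))
    (g : Fin 2 → ℝ) : ∑ ω, modelWeight M p ω * g (ω.1 i) = ∑ k, labelProb p k * g k := by
  rw [← Equiv.sum_comp (relabel (Equiv.swap 0 i)), ← Equiv.sum_comp (splitRoot n)]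
  simp only [modelWeight_relabel hM, modelWeight_splitRoot]
  simp only [relabel, Equiv.coe_fn_mk, Function.comp_apply, Equiv.swap_apply_right]
  simp only [splitRoot, Equiv.coe_fn_mk, Fin.cons_zero]
  rw [Fintype.sum_prod_type_right]
  have h : ∀ ω : (Fin n → Fin 2) × SimpleGraph (Fin n), ∑ x : Fin 2 × Finset (Fin n),
      modelWeight M p ω * (labelProb p x.1 * rootLaw M x.1 x.2 ω.1) * g x.1 =
      modelWeight M p ω * ∑ k, labelProb p k * g k := by
    intro ω
    rw [Fintype.sum_prod_type, Finset.mul_sum]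
    refine Finset.sum_congr rfl fun k _ => ?_
    simp only [← Finset.sum_mul, ← Finset.mul_sum, sum_rootLaw]
    ring
  simp only [h]
  rw [← Finset.sum_mul, sum_modelWeight, one_mul]

/-- The rescaled success probability of any estimator of the label of `i` is controlled by the
energy of the label. -/
theorem abs_success_le (hp0 : 0 < p) (hp1 : p < 1) (hM : ∀ k l, M k l = M l k)
    (hM0 : ∀ k l, 0 < M k l) (hM1 : ∀ k l, M k l < 1) (i : Fin (n + 1))
    (t : SimpleGraph (Fin (n + 1)) → Fin 2) :
    |condProb M p (fun _ G => t G = 0) (fun x _ => x i = 0) +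
      condProb M p (fun _ G => t G = 1) (fun x _ => x i = 1) - 1| ≤
      √(vertexEnergy M p i ∅) / √(p * (1 - p)) := by
  classical
  have hq : 0 < 1 - p := by linarith
  have hw := modelWeight_pos (n := n + 1) hp0 hp1 hM0 hM1
  have hlab : ∀ k, prob M p (fun x (_ : SimpleGraph (Fin (n + 1))) => x i = k) = labelProb p k := by
    intro k
    rw [prob_eq_sum]
    have := sum_modelWeight_mul_label (n := n) hM p i (fun l => if l = k then 1 else 0)
    simp only [mul_ite, mul_one, mul_zero, Finset.sum_ite_eq', Finset.mem_univ, if_true] at this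
    convert this
  set A : Fin 2 → ℝ := fun k => prob M p (fun (x : Fin (n + 1) → Fin 2) G => t G = 0 ∧ x i = k)
    with hA
  have hcompl : prob M p (fun (x : Fin (n + 1) → Fin 2) G => t G = 1 ∧ x i = 1) =
      labelProb p 1 - A 1 := by
    rw [← hlab 1]
    simp only [hA, prob_eq_sum]
    rw [← Finset.sum_sub_distrib]
    refine Finset.sum_congr rfl fun ω _ => ?_
    have : t ω.2 = 0 ∨ t ω.2 = 1 := by
      generalize t ω.2 = y
      fin_cases y <;> simp
    rcases this with h | h <;> by_cases h' : ω.1 i = 1 <;> simp [h, h']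
  have hterm : condProb M p (fun _ G => t G = 0) (fun x _ => x i = 0) +
      condProb M p (fun _ G => t G = 1) (fun x _ => x i = 1) - 1 = A 0 / p - A 1 / (1 - p) := by
    have h0 : labelProb p 0 = p := rfl
    have h1 : labelProb p 1 = 1 - p := rfl
    rw [condProb, condProb, hlab, hlab, hcompl, h0, h1]
    change A 0 / p + _ - 1 = _
    field_simp
    ring
  set g : (Fin (n + 1) → Fin 2) × SimpleGraph (Fin (n + 1)) → ℝ :=
    fun ω => if t ω.2 = 0 then 1 else 0
  have hg : ∀ ω ω' : (Fin (n + 1) → Fin 2) × SimpleGraph (Fin (n + 1)),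
      obs ∅ ω = obs ∅ ω' → g ω = g ω' := by
    intro ω ω' h
    rw [obs_eq_iff] at h
    simp only [g, h.1]
  have hsum : ∑ ω, modelWeight M p ω * (g ω * phi p (ω.1 i)) = phi p 0 * A 0 + phi p 1 * A 1 := by
    rw [hA]
    simp only [prob_eq_sum, Finset.mul_sum]
    rw [← Finset.sum_add_distrib]
    refine Finset.sum_congr rfl fun ω _ => ?_
    have : ω.1 i = 0 ∨ ω.1 i = 1 := by
      generalize ω.1 i = y
      fin_cases y <;> simp
    rcases this with h | h <;> by_cases h' : t ω.2 = 0 <;> simp [g, h, h', mul_comm]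
  have hs : 0 < √(p * (1 - p)) := Real.sqrt_pos.2 (by positivity)
  have hphi0 : phi p 0 = √(p * (1 - p)) / p := by
    rw [eq_div_iff hp0.ne', ← labelProb_mul_phi_zero hp0, mul_comm]; rfl
  have hphi1 : phi p 1 = -(√(p * (1 - p)) / (1 - p)) := by
    rw [← neg_div, eq_div_iff hq.ne', ← labelProb_mul_phi_one hp0 hp1, mul_comm]; rfl
  -- Since φ(0) and φ(1) are √(p(1 - p)) times 1/p and -1/(1 - p), the rescaled success is a
  -- multiple of the correlation of the decision with φ(X_i). The label may then be replaced by its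
  -- posterior mean.
  have hval : A 0 / p - A 1 / (1 - p) =
      (∑ ω, modelWeight M p ω * (g ω * phi p (ω.1 i))) / √(p * (1 - p)) := by
    rw [hsum, hphi0, hphi1]
    field_simp
    ring
  rw [hterm, hval, abs_div, abs_of_pos hs]
  refine div_le_div_of_nonneg_right ?_ hs.le
  rw [← sum_mul_condMean hw (obs ∅) (fun ω => phi p (ω.1 i)) g hg]
  refine (Finset.abs_sum_le_sum_abs _ _).trans (le_trans (Finset.sum_le_sum fun ω _ => ?_)
    (sum_abs_le_sqrt hw (sum_modelWeight M p) _))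
  rw [abs_mul, abs_of_pos (hw ω), abs_mul]
  refine mul_le_mul_of_nonneg_left (mul_le_of_le_one_left (abs_nonneg _) ?_) (hw ω).le
  simp only [g]
  split_ifs <;> simp

theorem abs_successProb_le (hp0 : 0 < p) (hp1 : p < 1) (hM : ∀ k l, M k l = M l k)
    (hM0 : ∀ k l, 0 < M k l) (hM1 : ∀ k l, M k l < 1)
    (T : Fin (n + 1) → SimpleGraph (Fin (n + 1)) → Fin 2) :
    |successProb M p T| ≤ √(vertexEnergy M p (0 : Fin (n + 1)) ∅) / √(p * (1 - p)) := by
  have hn : (0 : ℝ) < ((n + 1 : ℕ) : ℝ) := by positivity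
  rw [successProb, abs_mul, abs_of_pos (by positivity), one_div, inv_mul_le_iff₀ hn]
  refine (Finset.abs_sum_le_sum_abs _ _).trans ?_
  refine (Finset.sum_le_card_nsmul _ _ (√(vertexEnergy M p (0 : Fin (n + 1)) ∅) / √(p * (1 - p)))
    fun i _ => ?_).trans (le_of_eq (by simp))
  refine (abs_success_le hp0 hp1 hM hM0 hM1 i (T i)).trans (le_of_eq ?_)
  rw [vertexEnergy_eq_of_card_eq hM p (i := i) (j := 0) (R := ∅) (T := ∅) (by simp) (by simp) rfl]

end Success

/-! ### The contraction of the energy. -/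

section Contraction

variable {p lam' d ε : ℝ}

/-- The contraction coefficient of one step, before multiplication by the number of vertices. -/
noncomputable def stepCoeff (p lam' ε θ : ℝ) : ℝ :=
  (1 / lam' + 2 / p * (2 * |ε| / p ^ 2 / (1 - p) + 2 * (2 * ε ^ 2 / p ^ 2) * θ + 3 / p * √θ +
    312 / p ^ 2 * (2 * ε ^ 2 / p ^ 2) * √θ)) * (θ / (1 - θ) * ε ^ 2)

/-- The choice η = √θ balances the errors 3η/p · v and 312/η · (v/p)²: as v = O(θ), both become
O(√θ) v. Only the term in |ε| v lacks a factor vanishing with θ. -/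
theorem stepError_le {θ v : ℝ} (hp0 : 0 < p) (hθ : 0 < θ) (hv0 : 0 ≤ v)
    (hv : v ≤ 2 * ε ^ 2 / p ^ 2 * θ) :
    stepError p ε (√θ) v ≤ 1 / p * (2 * |ε| / p ^ 2 / (1 - p) + 2 * (2 * ε ^ 2 / p ^ 2) * θ +
      3 / p * √θ + 312 / p ^ 2 * (2 * ε ^ 2 / p ^ 2) * √θ) * v := by
  set κ := 2 * ε ^ 2 / p ^ 2
  have hs : 0 < √θ := Real.sqrt_pos.2 hθ
  have hss : √θ * √θ = θ := Real.mul_self_sqrt hθ.le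
  have h1 : 2 * v ^ 2 ≤ 2 * κ * θ * v := by nlinarith
  have h2 : 312 / √θ * (v / p) ^ 2 ≤ 312 / p ^ 2 * κ * √θ * v := by
    have e1 : 312 / √θ * (v / p) ^ 2 = 312 / p ^ 2 * (v * v / √θ) := by field_simp
    have e2 : 312 / p ^ 2 * κ * √θ * v = 312 / p ^ 2 * (κ * √θ * v) := by ring
    rw [e1, e2]
    refine mul_le_mul_of_nonneg_left ?_ (by positivity)
    rw [div_le_iff₀ hs]
    calc v * v ≤ κ * θ * v := mul_le_mul_of_nonneg_right hv hv0
      _ = κ * √θ * v * √θ := by linear_combination (-(κ * v)) * hss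
  have h3 : 3 * √θ / p * v = 3 / p * √θ * v := by ring
  rw [stepError, div_eq_inv_mul, ← one_div, mul_assoc (1 / p)]
  refine mul_le_mul_of_nonneg_left ?_ (by positivity)
  rw [h3]
  linarith

/-- Since the Gaussian energy is at most V / lam' at every V, the bound is linear in ∑ m_j² for each
realization of the posterior means. -/
theorem sum_bern_potential_le_stepCoeff {n : ℕ} {θ : ℝ} (hp0 : 0 < p) (hp1 : p ≤ 1 / 2)
    (hlam' : 0 < lam') (hG : ∀ v : ℝ≥0, lam' * gaussOp p v 1 1 ≤ v)
    (hε : |ε| / p ≤ 1 / 2) (h0 : 0 < θ) (h1 : θ ≤ 1 / 2)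
    (hθp : 6 * (2 * ε ^ 2 / p ^ 2 * θ) ≤ p) {m : Fin n → ℝ}
    (hm1 : ∀ j, |m j| ≤ 1 / p) (hm : ∀ k j, |phi p k * m j| ≤ 1 / p) :
    ∑ S : Finset (Fin n), bern θ Finset.univ S * potential p
      (subsetLik θ Finset.univ (fun j => ε * phi p 0 * m j) S)
      (subsetLik θ Finset.univ (fun j => ε * phi p 1 * m j) S) ≤
      stepCoeff p lam' ε θ * ∑ j, m j ^ 2 := by
  have hθ0 : 0 ≤ θ / (1 - θ) := div_nonneg h0.le (by linarith)
  have hθ2 : θ / (1 - θ) ≤ 2 * θ := by rw [div_le_iff₀ (by linarith)]; nlinarith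
  let v : Fin n → ℝ≥0 := fun j => ⟨θ / (1 - θ) * ε ^ 2 * m j ^ 2, by positivity⟩
  have hv : ∀ j, (v j : ℝ) = θ / (1 - θ) * ε ^ 2 * m j ^ 2 := fun j => rfl
  have hvle : ∀ j, (v j : ℝ) ≤ 2 * ε ^ 2 / p ^ 2 * θ := by
    intro j
    have h2 : m j ^ 2 ≤ (1 / p) ^ 2 := sq_le_sq' (neg_le_of_abs_le (hm1 j)) (le_of_abs_le (hm1 j))
    rw [hv]
    calc θ / (1 - θ) * ε ^ 2 * m j ^ 2 ≤ 2 * θ * ε ^ 2 * (1 / p) ^ 2 :=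
          mul_le_mul (mul_le_mul_of_nonneg_right hθ2 (sq_nonneg _)) h2 (sq_nonneg _) (by positivity)
      _ = _ := by ring
  have key := sum_bern_potential_le hp0 hp1 hε h0 h1 (Real.sqrt_pos.2 h0) hm hv
    (fun j => (mul_le_mul_of_nonneg_left (hvle j) (by norm_num)).trans hθp) Finset.univ
    one_pos one_pos
  simp only [one_mul, Finset.powerset_univ] at key
  refine key.trans ?_
  have hV : ((∑ j, v j : ℝ≥0) : ℝ) = θ / (1 - θ) * ε ^ 2 * ∑ j, m j ^ 2 := by
    push_cast
    rw [Finset.mul_sum]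
    exact Finset.sum_congr rfl fun j _ => hv j
  have hG' : gaussOp p (∑ j, v j) 1 1 ≤ 1 / lam' * (θ / (1 - θ) * ε ^ 2 * ∑ j, m j ^ 2) := by
    rw [← hV, one_div_mul_eq_div, le_div_iff₀ hlam', mul_comm]
    exact hG _
  have hE : ∑ j, stepError p ε (√θ) (v j) ≤ 1 / p * (2 * |ε| / p ^ 2 / (1 - p) +
      2 * (2 * ε ^ 2 / p ^ 2) * θ + 3 / p * √θ + 312 / p ^ 2 * (2 * ε ^ 2 / p ^ 2) * √θ) *
      (θ / (1 - θ) * ε ^ 2 * ∑ j, m j ^ 2) := by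
    rw [← hV]
    push_cast
    rw [Finset.mul_sum]
    exact Finset.sum_le_sum fun j _ => stepError_le hp0 h0 (v j).coe_nonneg (hvle j)
  rw [stepCoeff]
  calc _ ≤ 1 / lam' * (θ / (1 - θ) * ε ^ 2 * ∑ j, m j ^ 2) + (1 + 1) * (1 / p *
      (2 * |ε| / p ^ 2 / (1 - p) +
      2 * (2 * ε ^ 2 / p ^ 2) * θ + 3 / p * √θ + 312 / p ^ 2 * (2 * ε ^ 2 / p ^ 2) * √θ) *
      (θ / (1 - θ) * ε ^ 2 * ∑ j, m j ^ 2)) :=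
        add_le_add hG' (mul_le_mul_of_nonneg_left hE (by norm_num))
    _ = _ := by ring

theorem stepCoeff_nonneg {θ : ℝ} (hp0 : 0 < p) (hp1 : p < 1) (hlam' : 0 < lam') (h0 : 0 < θ)
    (h1 : θ ≤ 1 / 2) : 0 ≤ stepCoeff p lam' ε θ := by
  have hq : 0 < 1 - p := by linarith
  have hθ : 0 < 1 - θ := by linarith
  unfold stepCoeff
  positivity

/-- The self-consistent inequality for the energy of the root after pinning some labels. -/
theorem exists_pinned_energy_le {n s J : ℕ} {θ : ℝ} (hp0 : 0 < p) (hp1 : p ≤ 1 / 2)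
    (hlam' : 0 < lam') (hG : ∀ v : ℝ≥0, lam' * gaussOp p v 1 1 ≤ v)
    (hε : |ε| / p ≤ 1 / 2) (h0 : 0 < θ) (h1 : θ ≤ 1 / 2)
    (hθp : 6 * (2 * ε ^ 2 / p ^ 2 * θ) ≤ p) (hd : θ * n ≤ d) (hJ : 0 < J) (hn : J * s + 1 ≤ n) :
    ∃ Q : ℝ, vertexEnergy (rankOne p θ ε) p (0 : Fin (n + 1)) ∅ ≤ Q ∧ 0 ≤ Q ∧
      Q ≤ stepCoeff p lam' ε θ * (n * Q + J * s * (1 / p) ^ 2) +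
        6 / p ^ 2 * (2 * (Real.exp (5 * d) * θ * (√n + 1 + d)) +
          Real.exp (3 * d) * (√((1 / p) ^ 2 / J) + 2 / 2 ^ s)) := by
  classical
  have hp1' : p < 1 := by linarith
  set M := rankOne p θ ε
  have hM : ∀ k l, M k l = M l k := rankOne_symm p θ ε
  have hM0 : ∀ k l, 0 < M k l := rankOne_pos hp0 hp1 hε h0
  have hM1 : ∀ k l, M k l < 1 := rankOne_lt_one hp0 hp1 hε h0 h1
  have hw := modelWeight_pos (n := n) hp0 hp1' hM0 hM1
  obtain ⟨R, hRcard, hRn, hpin⟩ := exists_pinning hp0 hp1 hM hM0 hM1 s J hJ hn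
  set Q := vertexEnergy M p 0 (R.map (Fin.succEmb n)) with hQ
  refine ⟨Q, vertexEnergy_mono hp0 hp1' hM0 hM1 _ (Finset.empty_subset _),
    Finset.sum_nonneg fun ω _ => mul_nonneg
      (modelWeight_pos hp0 hp1' hM0 hM1 ω).le (sq_nonneg _), ?_⟩
  have hc0 : 0 ≤ stepCoeff p lam' ε θ := stepCoeff_nonneg hp0 hp1' hlam' h0 h1
  refine (vertexEnergy_root_le hp0 hp1 hε h0 h1 hd R hpin).trans (add_le_add ?_ le_rfl)
  have hmean : ∀ ω, ∑ S : Finset (Fin n), bern θ Finset.univ S * potential p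
      (subsetLik θ Finset.univ (fun j => ε * phi p 0 * vertexMean M p R j ω) S)
      (subsetLik θ Finset.univ (fun j => ε * phi p 1 * vertexMean M p R j ω) S) ≤
      stepCoeff p lam' ε θ * ∑ j, vertexMean M p R j ω ^ 2 := by
    intro ω
    refine sum_bern_potential_le_stepCoeff hp0 hp1 hlam' hG hε h0 h1 hθp (fun j => ?_)
      (fun k j => ?_)
    · exact abs_condMean_le_of_bound hw (obs R) (fun ω => abs_phi_le hp0 hp1 _) ω
    · rw [vertexMean, ← condMean_const_mul]
      exact abs_condMean_le_of_bound hw (obs R) (fun ω => abs_phi_mul_phi_le hp0 hp1 _ _) ω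
  -- An unrevealed vertex gains energy when the root is added, and by exchangeability then has that
  -- of the root. Each of the at most J·s revealed vertices gets the trivial bound (1/p)².
  have hsum : ∑ j, vertexEnergy M p j R ≤ n * Q + J * s * (1 / p) ^ 2 := by
    have hj : ∀ j, vertexEnergy M p j R ≤ Q + if j ∈ R then (1 / p) ^ 2 else 0 := by
      intro j
      by_cases h : j ∈ R
      · rw [if_pos h]
        have h2 : vertexEnergy M p j R ≤ (1 / p) ^ 2 :=
          energy_le_of_bound hw (sum_modelWeight M p) _ fun ω => abs_phi_le hp0 hp1 _
        have h3 : 0 ≤ Q := Finset.sum_nonneg fun ω _ => mul_nonneg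
          (modelWeight_pos hp0 hp1' hM0 hM1 ω).le (sq_nonneg _)
        linarith
      · rw [if_neg h, add_zero]
        refine (vertexEnergy_succ_le hp0 hp1' hM0 hM1 j R).trans (le_of_eq ?_)
        refine vertexEnergy_eq_of_card_eq hM p ?_ ?_ rfl
        · simpa using h
        · simp
    refine (Finset.sum_le_sum fun j _ => hj j).trans ?_
    rw [Finset.sum_add_distrib, Finset.sum_const, Finset.card_univ, Fintype.card_fin, nsmul_eq_mul,
      ← Finset.sum_filter, Finset.sum_const, nsmul_eq_mul]
    refine add_le_add le_rfl (mul_le_mul_of_nonneg_right ?_ (sq_nonneg _))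
    have : (Finset.univ.filter fun j => j ∈ R) = R := by ext; simp
    rw [this]
    exact_mod_cast hRcard
  calc _ ≤ ∑ ω, modelWeight M p ω * (stepCoeff p lam' ε θ * ∑ j, vertexMean M p R j ω ^ 2) :=
        Finset.sum_le_sum fun ω _ => mul_le_mul_of_nonneg_left (hmean ω) (hw ω).le
    _ = stepCoeff p lam' ε θ * ∑ j, vertexEnergy M p j R := by
        simp only [vertexEnergy, energy, Finset.mul_sum]
        rw [Finset.sum_comm]
        refine Finset.sum_congr rfl fun j _ => Finset.sum_congr rfl fun ω _ => ?_
        rw [vertexMean]; ring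
    _ ≤ _ := mul_le_mul_of_nonneg_left hsum hc0

/-- In the contracting regime the graph carries asymptotically no information on a label. -/
theorem tendsto_vertexEnergy_zero (hp0 : 0 < p) (hp1 : p ≤ 1 / 2)
    (hlam' : 0 < lam') (hG : ∀ v : ℝ≥0, lam' * gaussOp p v 1 1 ≤ v)
    (hε : |ε| / p ≤ 1 / 2) (hd : 0 < d)
    (hc : (1 / lam' + 2 / p * (2 * |ε| / p ^ 2 / (1 - p))) * (d * ε ^ 2) < 1) :
    Tendsto (fun n : ℕ => vertexEnergy (rankOne p (d / ((n + 1 : ℕ) : ℝ)) ε) p (0 : Fin (n + 1)) ∅)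
      atTop (𝓝 0) := by
  have hp1' : p < 1 := by linarith
  set θ : ℕ → ℝ := fun n => d / ((n + 1 : ℕ) : ℝ) with hθdef
  have hθpos : ∀ n, 0 < θ n := fun n => by simp only [hθdef]; positivity
  have hθ : Tendsto θ atTop (𝓝 0) :=
    (tendsto_const_div_atTop_nhds_zero_nat d).comp (tendsto_add_atTop_nat 1)
  have hsqrt : Tendsto (fun n => √(θ n)) atTop (𝓝 0) := by
    have h := (Real.continuous_sqrt.tendsto 0).comp hθ
    rwa [Real.sqrt_zero] at h
  have hθn : ∀ n : ℕ, θ n * n = d - θ n := by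
    intro n
    simp only [hθdef]
    push_cast
    field_simp
    ring
  have hθnlim : Tendsto (fun n : ℕ => θ n * n) atTop (𝓝 d) := by
    simp only [hθn]
    simpa using hθ.const_sub d
  -- This kills the non-edge error: the signed label sum is of order √n and each non-edge has weight
  -- of order θ.
  have hθsqrt : Tendsto (fun n : ℕ => θ n * √n) atTop (𝓝 0) := by
    have h : ∀ n : ℕ, √(θ n) * √(θ n * n) = θ n * √n := by
      intro n
      rw [Real.sqrt_mul (hθpos n).le, ← mul_assoc, Real.mul_self_sqrt (hθpos n).le]
    simp only [← h]
    simpa using hsqrt.mul ((Real.continuous_sqrt.tendsto d).comp hθnlim)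
  have hB : Tendsto (fun n => 1 / lam' + 2 / p * (2 * |ε| / p ^ 2 / (1 - p) +
      2 * (2 * ε ^ 2 / p ^ 2) * θ n + 3 / p * √(θ n) +
      312 / p ^ 2 * (2 * ε ^ 2 / p ^ 2) * √(θ n))) atTop
      (𝓝 (1 / lam' + 2 / p * (2 * |ε| / p ^ 2 / (1 - p)))) := by
    have := ((((tendsto_const_nhds (x := 2 * |ε| / p ^ 2 / (1 - p))).add
      (hθ.const_mul (2 * (2 * ε ^ 2 / p ^ 2)))).add (hsqrt.const_mul (3 / p))).add
      (hsqrt.const_mul (312 / p ^ 2 * (2 * ε ^ 2 / p ^ 2)))).const_mul (2 / p)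
    simpa using this.const_add (1 / lam')
  have hθ' : Tendsto (fun n => 1 - θ n) atTop (𝓝 1) := by simpa using hθ.const_sub 1
  have hcoeff : Tendsto (fun n => stepCoeff p lam' ε (θ n)) atTop (𝓝 0) := by
    unfold stepCoeff
    simpa using hB.mul ((hθ.div hθ' one_ne_zero).mul_const (ε ^ 2))
  have hcoeffn : Tendsto (fun n : ℕ => stepCoeff p lam' ε (θ n) * n) atTop
      (𝓝 ((1 / lam' + 2 / p * (2 * |ε| / p ^ 2 / (1 - p))) * (d * ε ^ 2))) := by
    have h := hB.mul ((hθnlim.div hθ' one_ne_zero).mul_const (ε ^ 2))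
    simp only [div_one] at h
    refine h.congr fun n => ?_
    simp only [stepCoeff, Pi.div_apply]
    ring
  obtain ⟨ρ, hρ, hρ1⟩ := exists_between hc
  rw [tendsto_order]
  refine ⟨fun a ha => ?_, fun δ hδ => ?_⟩
  · have h2 := hθ.eventually_le_const (by norm_num : (0 : ℝ) < 1 / 2)
    filter_upwards [h2] with n hn
    refine ha.trans_le (Finset.sum_nonneg fun ω _ => mul_nonneg (modelWeight_pos hp0 hp1'
      (rankOne_pos hp0 hp1 hε (hθpos n)) (rankOne_lt_one hp0 hp1 hε (hθpos n) hn) ω).le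
      (sq_nonneg _))
  · set δ' := (1 - ρ) * δ with hδ'
    have hδ'0 : 0 < δ' := mul_pos (by linarith) hδ
    -- First `s`, then `J`, are fixed from δ and d before n grows. The number J·s of pinned labels
    -- stays bounded, so its contribution vanishes with `stepCoeff`.
    have hs : ∃ s : ℕ, 6 / p ^ 2 * (Real.exp (3 * d) * (2 / 2 ^ s)) < δ' / 3 := by
      have h := (tendsto_pow_atTop_nhds_zero_of_lt_one (by norm_num : (0 : ℝ) ≤ 1 / 2)
        (by norm_num)).const_mul (6 / p ^ 2 * (Real.exp (3 * d) * 2))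
      rw [mul_zero] at h
      obtain ⟨s, hs⟩ := (h.eventually_lt_const (by positivity : 0 < δ' / 3)).exists
      refine ⟨s, lt_of_eq_of_lt ?_ hs⟩
      rw [one_div, inv_pow]; ring
    obtain ⟨s, hs⟩ := hs
    have hJ : ∃ J : ℕ, 0 < J ∧
        6 / p ^ 2 * (Real.exp (3 * d) * √((1 / p) ^ 2 / J)) < δ' / 3 := by
      have h := ((Real.continuous_sqrt.tendsto 0).comp
        (tendsto_const_div_atTop_nhds_zero_nat ((1 / p) ^ 2))).const_mul
        (6 / p ^ 2 * Real.exp (3 * d))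
      rw [Real.sqrt_zero, mul_zero] at h
      obtain ⟨J, hJ, hJ0⟩ := ((h.eventually_lt_const (by positivity : 0 < δ' / 3)).and
        (eventually_gt_atTop 0)).exists
      refine ⟨J, hJ0, lt_of_eq_of_lt ?_ hJ⟩
      simp only [Function.comp_apply]
      ring
    obtain ⟨J, hJ0, hJ⟩ := hJ
    have herr : Tendsto (fun n : ℕ => stepCoeff p lam' ε (θ n) * (J * s * (1 / p) ^ 2) +
        6 / p ^ 2 * (2 * (Real.exp (5 * d) * θ n * (√n + 1 + d)))) atTop (𝓝 0) := by
      have h1 := hcoeff.mul_const (J * s * (1 / p) ^ 2)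
      have h2 := ((hθsqrt.add (hθ.mul_const (1 + d))).const_mul (6 / p ^ 2 * 2 * Real.exp (5 * d)))
      have h3 := h1.add h2
      simp only [zero_mul, add_zero, mul_zero] at h3
      refine h3.congr fun n => ?_
      ring
    filter_upwards [hθ.eventually_le_const (by norm_num : (0 : ℝ) < 1 / 2),
      (by simpa using (hθ.const_mul (2 * ε ^ 2 / p ^ 2)).const_mul 6 :
        Tendsto (fun n => 6 * (2 * ε ^ 2 / p ^ 2 * θ n)) atTop (𝓝 0)).eventually_le_const hp0,
      herr.eventually_lt_const (by positivity : 0 < δ' / 3),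
      hcoeffn.eventually_lt_const hρ, eventually_ge_atTop (J * s + 1)] with n hn1 hn2 hn3 hn4 hn5
    obtain ⟨Q, hQ1, hQ0, hQ2⟩ := exists_pinned_energy_le hp0 hp1 hlam' hG hε (hθpos n) hn1 hn2
      (by rw [hθn]; linarith [hθpos n] : θ n * n ≤ d) hJ0 hn5
    refine lt_of_le_of_lt hQ1 ?_
    have h5 : stepCoeff p lam' ε (θ n) * n * Q ≤ ρ * Q := mul_le_mul_of_nonneg_right hn4.le hQ0
    have h6 : Q < ρ * Q + δ' := by
      have e : stepCoeff p lam' ε (θ n) * (n * Q + J * s * (1 / p) ^ 2) +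
        6 / p ^ 2 * (2 * (Real.exp (5 * d) * θ n * (√n + 1 + d)) +
          Real.exp (3 * d) * (√((1 / p) ^ 2 / J) + 2 / 2 ^ s)) =
        stepCoeff p lam' ε (θ n) * n * Q + (stepCoeff p lam' ε (θ n) * (J * s * (1 / p) ^ 2) +
        6 / p ^ 2 * (2 * (Real.exp (5 * d) * θ n * (√n + 1 + d)))) +
        6 / p ^ 2 * (Real.exp (3 * d) * √((1 / p) ^ 2 / J)) +
        6 / p ^ 2 * (Real.exp (3 * d) * (2 / 2 ^ s)) := by ring
      linarith
    have h7 : (1 - ρ) * Q < (1 - ρ) * δ := by linarith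
    exact lt_of_mul_lt_mul_left h7 (by linarith)

end Contraction

end SBM

/-! ### The theorem. -/

theorem proposition4 (p lam : ℝ) (hp0 : 0 < p) (hp1 : p ≤ 1 / 2)
    (hlam : lam < SBM.spinodal p)
    (a b c : ℝ → ℝ)
    (hbal1 : ∀ᶠ d in atTop, p * a d + (1 - p) * b d = 1)
    (hbal2 : ∀ᶠ d in atTop, p * b d + (1 - p) * c d = 1)
    (hsnr : ∀ᶠ d in atTop, d * (1 - b d) ^ 2 = lam) :
    ∃ L : ℝ → ℝ,
      (∀ᶠ d in atTop,
        Tendsto (fun n : ℕ => SBM.optSuccess p (a d) (b d) (c d) d n) atTop (𝓝 (L d))) ∧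
      Tendsto L atTop (𝓝 0) := by
  -- For every large d the limit in n is already 0; large d is needed only to make the contraction
  -- coefficient less than 1.
  refine ⟨fun _ => 0, ?_, tendsto_const_nhds⟩
  have hp1' : p < 1 := by linarith
  have hlam0 : 0 ≤ lam := by
    obtain ⟨d, h, hd⟩ := (hsnr.and (eventually_ge_atTop 0)).exists
    rw [← h]
    positivity
  obtain ⟨lam', hlt, hG⟩ := SBM.exists_gaussOp_le hp0 hp1' hlam0 hlam
  have hlam' : 0 < lam' := hlam0.trans_lt hlt
  have hε : Tendsto (fun d => |1 - b d|) atTop (𝓝 0) := by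
    have h : Tendsto (fun d : ℝ => √(lam / d)) atTop (𝓝 0) := by
      have h := (Real.continuous_sqrt.tendsto 0).comp
        ((tendsto_const_nhds (x := lam)).div_atTop tendsto_id)
      rwa [Real.sqrt_zero] at h
    refine h.congr' ?_
    filter_upwards [hsnr, eventually_gt_atTop 0] with d h1 h2
    rw [← h1, mul_div_cancel_left₀ _ h2.ne', Real.sqrt_sq_eq_abs]
  have hsmall : Tendsto (fun d => |1 - b d| / p) atTop (𝓝 0) := by simpa using hε.div_const p
  -- The coefficient tends to lam / lam' < 1, because ε = 1 - b has modulus √(lam / d).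
  have hcontr : Tendsto (fun d => (1 / lam' + 2 / p * (2 * |1 - b d| / p ^ 2 / (1 - p))) * lam)
      atTop (𝓝 (1 / lam' * lam)) := by
    have := ((((hε.const_mul 2).div_const (p ^ 2)).div_const (1 - p)).const_mul (2 / p)).const_add
      (1 / lam')
    simpa using this.mul_const lam
  have hlt1 : 1 / lam' * lam < 1 := by rw [one_div_mul_eq_div, div_lt_one hlam']; exact hlt
  filter_upwards [hbal1, hbal2, hsnr, eventually_gt_atTop 0,
    hsmall.eventually_le_const (by norm_num : (0 : ℝ) < 1 / 2),
    hcontr.eventually_lt_const hlt1] with d h1 h2 h3 hd h4 h5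
  rw [← h3] at h5
  have hQ := SBM.tendsto_vertexEnergy_zero hp0 hp1 hlam' hG h4 hd h5
  -- The energy estimates concern n + 1 vertices, the root included.
  rw [← tendsto_add_atTop_iff_nat 1]
  have hlim := ((Real.continuous_sqrt.tendsto 0).comp hQ).div_const √(p * (1 - p))
  rw [Real.sqrt_zero, zero_div] at hlim
  refine squeeze_zero_norm' ?_ hlim
  have hθ : Tendsto (fun n : ℕ => d / ((n + 1 : ℕ) : ℝ)) atTop (𝓝 0) :=
    (tendsto_const_div_atTop_nhds_zero_nat d).comp (tendsto_add_atTop_nat 1)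
  filter_upwards [hθ.eventually_le_const (by norm_num : (0 : ℝ) < 1 / 2)] with n hn
  rw [SBM.optSuccess, SBM.connectivity_eq_rankOne hp0 hp1' h1 h2, Real.norm_eq_abs]
  exact SBM.abs_successProb_le hp0 hp1' (SBM.rankOne_symm _ _ _)
    (SBM.rankOne_pos hp0 hp1 h4 (by positivity))
    (SBM.rankOne_lt_one hp0 hp1 h4 (by positivity) hn) _
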